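/- **Setting.** Let $M$ be a smooth oriented $n$-manifold (Hausdorff, $\sigma$-compact, possibly with boundary) with a pseudo-Riemannian metric $g$ of any signature and Hodge star $\ast$, normalized by $a\wedge\ast b=g(a,b)\,\mathrm{vol}$. Let $\mathbb K=\mathbb R$ or $\mathbb C$, let $\mathfrak l\xrightarrow{\beta}\mathfrak h\xrightarrow{\alpha}\mathfrak g$ be a finite-dimensional differential 2-crossed module over $\mathbb K$, with action $\triangleright$ of $\mathfrak g$ on $\mathfrak h$, $\mathfrak l$ and Peiffer lifting $\{\,,\}:\mathfrak h\times\mathfrak h\to\mathfrak l$, (so $\alpha,\beta$ are Lie algebra maps with $\alpha\beta=0$, equivariant for $\triangleright$, which acts by derivations and on $\mathfrak g$ by the adjoint action, $\{\,,\}$ is bilinear and $\mathfrak g$-equivariant, and $\beta\{Y,Y'\}=[Y,Y']-\alpha(Y)\triangleright Y'$, $[Z,Z']=\{\beta Z,\beta Z'\}$, $\{[Y_1,Y_2],Y_3\}=\alpha(Y_1)\triangleright\{Y_2,Y_3\}+\{Y_1,[Y_2,Y_3]\}-\alpha(Y_2)\triangleright\{Y_1,Y_3\}-\{Y_2,[Y_1,Y_3]\}$,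 $\{Y_1,[Y_2,Y_3]\}=\{\beta\{Y_1,Y_2\},Y_3\}-\{\beta\{Y_1,Y_3\},Y_2\}$, $\{\beta Z,Y\}+\{Y,\beta Z\}=-\alpha(Y)\triangleright Z$), and let $\langle\,,\rangle$ be symmetric non-degenerate $\mathfrak g$-invariant bilinear forms on $\mathfrak g,\mathfrak h,\mathfrak l$. Define bilinear maps $\sigma:\mathfrak h\times\mathfrak h\to\mathfrak g$, $\kappa:\mathfrak l\times\mathfrak l\to\mathfrak g$, $\eta_1,\eta_2:\mathfrak l\times\mathfrak h\to\mathfrak h$ and linear maps $\alpha^*:\mathfrak g\to\mathfrak h$, $\beta^*:\mathfrak h\to\mathfrak l$ by $$\langle\sigma(Y,Y'),X\rangle=-\langle Y,X\triangleright Y'\rangle,\quad \langle\kappa(Z,Z'),X\rangle=-\langle Z,X\triangleright Z'\rangle,$$ $$\langle\{Y,Y'\},Z\rangle=-\langle Y',\eta_1(Z,Y)\rangle=-\langle Y,\eta_2(Z,Y')\rangle,\quad \langle Y,\alpha^*(X)\rangle=\langle\alpha(Y),X\rangle,\quad \langle Z,\beta^*(Y)\rangle=\langle\beta(Z),Y\rangle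 .$$ For a bilinear map $b$, $\wedge^{b}$ is the wedge product of vector-valued forms with the values paired by $b$; write $\bar b(u,v)=u\wedge^b v$, and $\wedge^{\blacktriangleright}$ for $\wedge^{\triangleright}$. Forms of negative degree are zero. A generalized $p$-form is a pair $(a,a')$ of a $p$-form and a $(p+1)$-form. Fix a constant $k\in\mathbb K$, $k\neq0$. For $(a,a')$ of degree $p$ and $(b,b')$ of degree $q$ put $$(a,a')\wedge^{B}(b,b')=\bigl(a\wedge^B b,\ a\wedge^B b'+(-1)^q a'\wedge^B b\bigr),\qquad \mathbf d(a,a')=\bigl(da+(-1)^{p+1}k\,a',\ da'\bigr),$$ $$\star(a,a')=\bigl((-1)^{n-p-1}\ast a',\ \ast a\bigr),\qquad \int_{(\partial M,M)}(a,a')=\int_M a',$$ let linear maps act on both components, and let $\langle\!\langle\,,\rangle\!\rangle$ be $\wedge^{\langle\,,\rangle}$. Let $A_1,A_2$ ($\mathfrak g$-valued), $B_2,B_3$ ($\mathfrak h$-valued), $C_3,C_4$ ($\mathfrak l$-valued) be smooth forms on $M$ of the indicated degrees, $\mathcal A=(A_1,A_2)$, $\mathcal B=(B_2,B_3)$, $\mathcal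 C=(C_3,C_4)$, and $$\mathcal F=\mathbf d\mathcal A+\tfrac12\mathcal A\wedge^{[,]}\mathcal A-\alpha(\mathcal B),\quad \mathcal G=\mathbf d\mathcal B+\mathcal A\wedge^{\blacktriangleright}\mathcal B-\beta(\mathcal C),\quad \mathcal H=\mathbf d\mathcal C+\mathcal A\wedge^{\blacktriangleright}\mathcal C+\mathcal B\wedge^{\{,\}}\mathcal B,$$ $$S=\int_{(\partial M,M)}\langle\!\langle\mathcal F,\star\mathcal F\rangle\!\rangle+\langle\!\langle\mathcal G,\star\mathcal G\rangle\!\rangle+\langle\!\langle\mathcal H,\star\mathcal H\rangle\!\rangle .$$ The first variation of $S$ is taken along smooth variations with compact support in the interior of $M$, as the $t$-derivative at $0$ of the integral of the change of the Lagrangian; for compact $M$ this change is $S[\varphi+t\,\delta\varphi]-S[\varphi]$. Write $\mathbb F=dA_1+\tfrac12A_1\wedge^{[,]}A_1-\alpha(B_2)$, $\mathbb G=dB_2+A_1\wedge^{\triangleright}B_2-\beta(C_3)$, $\mathbb H=dC_3+A_1\wedge^{\triangleright}C_3+B_2\wedge^{\{,\}}B_2$, let $D=d+A_1\wedge^{[,]}$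 on $\mathfrak g$-valued and $D=d+A_1\wedge^{\triangleright}$ on $\mathfrak h$- or $\mathfrak l$-valued forms, and $$F_1=\mathbb F+kA_2,\quad F_2=DA_2-\alpha(B_3),\quad G_1=\mathbb G-kB_3,\quad G_2=DB_3+A_2\wedge^{\triangleright}B_2-\beta(C_4),$$ $$H_1=\mathbb H+kC_4,\quad H_2=DC_4-A_2\wedge^{\triangleright}C_3+B_2\wedge^{\{,\}}B_3+B_3\wedge^{\{,\}}B_2 .$$ **Theorem.** (1) The first variation of $S$ with respect to each single field $A_1,A_2,B_2,B_3,C_3,C_4$ exists and vanishes (the other fields being kept fixed) if and only if, respectively, $$D\ast F_1+A_2\wedge^{[,]}\ast F_2-\bar\sigma(\ast G_1,B_2)+(-1)^{n+1}\bar\sigma(\ast G_2,B_3)+(-1)^{n+1}\bar\kappa(\ast H_1,C_3)-\bar\kappa(\ast H_2,C_4)=0,$$ $$k\ast F_1-D\ast F_2-\bar\sigma(\ast G_2,B_2)+(-1)^{n+1}\bar\kappa(\ast H_2,C_3)=0,$$ $$\alpha^*(\ast F_1)+D\ast G_1+A_2\wedge^{\triangleright}\ast G_2+\bar\eta_2(\ast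 H_1,B_2)+\bar\eta_1(\ast H_1,B_2)+(-1)^{n+1}\bar\eta_1(\ast H_2,B_3)+(-1)^{n+1}\bar\eta_2(\ast H_2,B_3)=0,$$ $$\alpha^*(\ast F_2)+k\ast G_1-D\ast G_2+\bar\eta_1(\ast H_2,B_2)+\bar\eta_2(\ast H_2,B_2)=0,$$ $$D\ast H_1+A_2\wedge^{\triangleright}\ast H_2-\beta^*(\ast G_1)=0,$$ $$k\ast H_1-D\ast H_2-\beta^*(\ast G_2)=0 .$$ The first variation of $S$ with respect to all six fields jointly vanishes if and only if all six equations hold. (2) The first and second equation together are equivalent to the first of the following equations of generalized forms, the third and fourth together to the second, and the fifth and sixth together to the third: $$\mathbf d\star\mathcal F+\mathcal A\wedge^{[,]}\star\mathcal F=\bar\sigma(\star\mathcal G,\mathcal B)+(-1)^{n+1}\bar\kappa(\star\mathcal H,\mathcal C),$$ $$\mathbf d\star\mathcal G+\mathcal A\wedge^{\blacktriangleright}\star\mathcal G=-\bar\eta_1(\star\mathcal H,\mathcal B)-\bar\eta_2(\star\mathcal H,\mathcal B)-\alpha^*(\star\mathcal F),$$ $$\mathbf d\star\mathcal H+\mathcal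 A\wedge^{\blacktriangleright}\star\mathcal H=\beta^*(\star\mathcal G).$$ (3) Suppose $A_2=0$, $B_3=0$, $C_4=0$. Then the integrand of $S$ is the ordinary 3-form Yang–Mills Lagrangian, so that $S=\int_M\langle\mathbb F,\ast\mathbb F\rangle+\langle\mathbb G,\ast\mathbb G\rangle+\langle\mathbb H,\ast\mathbb H\rangle$. The first, third and fifth equation of (1) are equivalent, respectively, to the ordinary 3-form Yang–Mills equations $$d\ast\mathbb F+A_1\wedge^{[,]}\ast\mathbb F=\bar\sigma(\ast\mathbb G,B_2)+(-1)^n\bar\kappa(\ast\mathbb H,C_3),$$ $$d\ast\mathbb G+A_1\wedge^{\triangleright}\ast\mathbb G=-\bar\eta_2(\ast\mathbb H,B_2)-\bar\eta_1(\ast\mathbb H,B_2)-\alpha^*(\ast\mathbb F),$$ $$d\ast\mathbb H+A_1\wedge^{\triangleright}\ast\mathbb H=\beta^*(\ast\mathbb G),$$ and the second, fourth and sixth to $\mathbb F=0$, $\mathbb G=0$ and $\mathbb H=0$. -/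

import Mathlib

open scoped Manifold ContDiff

/-! ## Lie algebras with a vector space topology -/

/-- A Lie ring carrying a norm. No compatibility of norm and bracket is required: on a
finite-dimensional Lie algebra the norm only serves to fix the vector space topology, which is
needed to differentiate vector-valued forms. -/
class NormedLieRing (V : Type*) extends NormedAddCommGroup V, LieRing V

/-- A Lie algebra over `𝕜` carrying a norm which makes it a normed space over `𝕜`. -/
class NormedLieAlgebra (𝕜 : Type*) (V : Type*) [NormedField 𝕜] [NormedLieRing V]
    extends NormedSpace 𝕜 V, LieAlgebra 𝕜 V

namespace GYM

noncomputable section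

/-! ## Multilinear algebra on one vector space -/

section Pointwise

variable {T V W U : Type*} [AddCommGroup T] [Module ℝ T] [TopologicalSpace T]
  [IsTopologicalAddGroup T] [ContinuousSMul ℝ T] [T2Space T] [FiniteDimensional ℝ T]
  [NormedAddCommGroup V] [NormedSpace ℝ V] [NormedAddCommGroup W] [NormedSpace ℝ W]
  [NormedAddCommGroup U] [NormedSpace ℝ U]

theorem alternating_continuous {m : ℕ} (f : T [⋀^Fin m]→ₗ[ℝ] V) : Continuous f := by
  let b := Module.finBasis ℝ T
  have h : (f : (Fin m → T) → V) = fun v =>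
      ∑ s : Fin m → Fin (Module.finrank ℝ T), (∏ i, b.coord (s i) (v i)) • f (fun i => b (s i)) := by
    funext v
    conv_lhs => rw [show v = fun i => ∑ j, b.coord j (v i) • b j from
      funext fun i => (b.sum_repr (v i)).symm]
    rw [← AlternatingMap.coe_multilinearMap, MultilinearMap.map_sum]
    refine Finset.sum_congr rfl fun s _ => ?_
    rw [MultilinearMap.map_smul_univ]
  rw [h]
  refine continuous_finsetSum _ fun s _ => ?_
  refine Continuous.smul (continuous_finsetProd _ fun i _ => ?_) continuous_const
  exact (LinearMap.continuous_of_finiteDimensional (b.coord (s i))).comp (continuous_apply i)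

/-- An alternating map on a finite-dimensional space, as a continuous alternating map. -/
def toCAM {m : ℕ} (f : T [⋀^Fin m]→ₗ[ℝ] V) : T [⋀^Fin m]→L[ℝ] V :=
  { f with cont := alternating_continuous f }

@[simp] theorem toCAM_apply {m : ℕ} (f : T [⋀^Fin m]→ₗ[ℝ] V) (v : Fin m → T) :
    toCAM f v = f v := rfl

/-- The wedge product `a ∧^B b` of a `V`-valued `p`-form and a `W`-valued `q`-form with respect to
a bilinear map `B : V × W → U`; explicitly the sum of
`sign σ • B (a (v ∘ σ ∘ inl)) (b (v ∘ σ ∘ inr))` over all `(p, q)`-shuffles `σ`. In components,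
`(∑ aⁱ Xᵢ) ∧^B (∑ bʲ Yⱼ) = ∑ (aⁱ ∧ bʲ) B(Xᵢ, Yⱼ)`. -/
def wedgeAt {𝕜 : Type*} [RCLike 𝕜] [Module 𝕜 V] [Module 𝕜 W] [Module 𝕜 U]
    [IsScalarTower ℝ 𝕜 V] [IsScalarTower ℝ 𝕜 W] [IsScalarTower ℝ 𝕜 U]
    (B : V →ₗ[𝕜] W →ₗ[𝕜] U) {p q r : ℕ} (h : p + q = r)
    (a : T [⋀^Fin p]→L[ℝ] V) (b : T [⋀^Fin q]→L[ℝ] W) : T [⋀^Fin r]→L[ℝ] U :=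
  toCAM (((TensorProduct.lift (B.restrictScalars₁₂ ℝ ℝ)).compAlternatingMap
    (a.toAlternatingMap.domCoprod b.toAlternatingMap)).domDomCongr
      (finSumFinEquiv.trans (finCongr h)))

/-- The contraction `w ↦ f (u, w)` of a form with the vectors `u` in the first slots. -/
def contractAt {p r n : ℕ} (h : p + r = n) (f : T [⋀^Fin n]→ₗ[ℝ] ℝ) (u : Fin p → T) :
    T [⋀^Fin r]→ₗ[ℝ] ℝ where
  toFun w := f.domDomCongr (finSumFinEquiv.trans (finCongr h)).symm (Sum.elim u w)
  map_update_add' w i x y := by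
    classical
    have key : ∀ z, Sum.elim u (Function.update w i z)
        = Function.update (Sum.elim u w) (Sum.inr i) z := fun z => by
      rw [Sum.update_elim_inr]
    have := (f.domDomCongr (finSumFinEquiv.trans (finCongr h)).symm).map_update_add
      (Sum.elim u w) (Sum.inr i) x y
    rw [← key, ← key, ← key] at this
    convert this
  map_update_smul' w i c x := by
    classical
    have key : ∀ z, Sum.elim u (Function.update w i z)
        = Function.update (Sum.elim u w) (Sum.inr i) z := fun z => by
      rw [Sum.update_elim_inr]
    have := (f.domDomCongr (finSumFinEquiv.trans (finCongr h)).symm).map_update_smul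
      (Sum.elim u w) (Sum.inr i) c x
    rw [← key, ← key] at this
    convert this
  map_eq_zero_of_eq' w i j hij hne :=
    (f.domDomCongr (finSumFinEquiv.trans (finCongr h)).symm).map_eq_zero_of_eq
      (Sum.elim u w) (i := Sum.inr i) (j := Sum.inr j) hij (by simpa using hne)

/-- The metric volume form: the form of value `± √|det g(bᵢ, bⱼ)|` on the basis `b`, the sign
being that of the orientation form `τ` on `b`. It does not depend on `b`. -/
def volAt {n : ℕ} (b : Module.Basis (Fin n) ℝ T) (g : LinearMap.BilinForm ℝ T)
    (τ : T [⋀^Fin n]→L[ℝ] ℝ) : T [⋀^Fin n]→ₗ[ℝ] ℝ :=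
  ((SignType.sign (τ b) : ℝ) * √|(Matrix.of fun i j => g (b i) (b j)).det|) • b.det

/-- The Hodge star of a vector-valued `p`-form `θ`:
`(⋆θ)(w) = (1/p!) ∑ θ(b^{s₁}, …, b^{s_p}) vol(b_{s₁}, …, b_{s_p}, w)`, where `b^i` is the basis with
`g(b^i, b_j) = δ_{ij}`. It does not depend on `b`, and satisfies `α ∧ ⋆β = g(α, β) vol`. -/
def hodgeAt {p r n : ℕ} (h : p + r = n) (b : Module.Basis (Fin n) ℝ T)
    (g : LinearMap.BilinForm ℝ T) (hg : g.Nondegenerate) (τ : T [⋀^Fin n]→L[ℝ] ℝ)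
    (θ : T [⋀^Fin p]→L[ℝ] V) : T [⋀^Fin r]→L[ℝ] V :=
  toCAM (((p.factorial : ℝ)⁻¹) • ∑ s : Fin p → Fin n,
    (LinearMap.toSpanSingleton ℝ V (θ fun i => g.dualBasis hg b (s i))).compAlternatingMap
      (contractAt h (volAt b g τ) fun i => b (s i)))

end Pointwise

/-! ## Differential forms on a manifold -/

section Forms

variable {n : ℕ} {H : Type*} [TopologicalSpace H]
  (I : ModelWithCorners ℝ (EuclideanSpace ℝ (Fin n)) H)
  (M : Type*) [TopologicalSpace M] [ChartedSpace H M]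

instance (x : M) : FiniteDimensional ℝ (TangentSpace I x) :=
  inferInstanceAs (FiniteDimensional ℝ (EuclideanSpace ℝ (Fin n)))

instance (x : M) : T2Space (TangentSpace I x) :=
  inferInstanceAs (T2Space (EuclideanSpace ℝ (Fin n)))

/-- Fields of `V`-valued alternating `m`-linear forms on the tangent spaces of `M`
(`m : ℕ`, no smoothness). -/
abbrev NForm (V : Type*) [NormedAddCommGroup V] [NormedSpace ℝ V] (m : ℕ) :=
  ∀ x : M, TangentSpace I x [⋀^Fin m]→L[ℝ] V

/-- `V`-valued forms of integer degree `p` on `M` (no smoothness): an `m`-form for each natural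
number `m` equal to `p`. So this is the space of `p`-forms if `p ≥ 0`, and zero if `p < 0`. -/
abbrev Form (V : Type*) [NormedAddCommGroup V] [NormedSpace ℝ V] (p : ℤ) :=
  ∀ m : {m : ℕ // (m : ℤ) = p}, NForm I M V m.1

/-- Generalized forms `(a, a')` of type `N = 1` and degree `p`: pairs of a `p`-form and a
`(p+1)`-form. -/
abbrev GForm (V : Type*) [NormedAddCommGroup V] [NormedSpace ℝ V] (p : ℤ) :=
  Form I M V p × Form I M V (p + 1)

variable {I M}
variable {V W U : Type*} [NormedAddCommGroup V] [NormedSpace ℝ V]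
  [NormedAddCommGroup W] [NormedSpace ℝ W] [NormedAddCommGroup U] [NormedSpace ℝ U]

/-- The coordinate expression `(φ⁻¹)^* θ` of a form in the preferred chart `φ` at `x₀`. -/
def inChart {m : ℕ} (θ : NForm I M V m) (x₀ : M) (y : EuclideanSpace ℝ (Fin n)) :
    EuclideanSpace ℝ (Fin n) [⋀^Fin m]→L[ℝ] V :=
  (θ ((extChartAt I x₀).symm y)).compContinuousLinearMap
    (mfderivWithin 𝓘(ℝ, EuclideanSpace ℝ (Fin n)) I (extChartAt I x₀).symm (Set.range I) y)

/-- Smoothness of an `m`-form: all its coordinate expressions are smooth. -/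
def NSmooth {m : ℕ} (θ : NForm I M V m) : Prop :=
  ∀ x₀ : M, ContDiffOn ℝ ∞ (inChart θ x₀) (extChartAt I x₀).target

/-- Smoothness of a form of integer degree. -/
def Smooth {p : ℤ} (θ : Form I M V p) : Prop := ∀ m, NSmooth (θ m)

/-- The support of the form is compact and contained in the interior `M ∖ ∂M`. -/
def CompactInteriorSupport {p : ℤ} (θ : Form I M V p) : Prop :=
  ∀ m, IsCompact (closure {x : M | θ m x ≠ 0}) ∧ closure {x : M | θ m x ≠ 0} ⊆ I.interior M

/-- Smooth forms of compact support in the interior of `M`, i.e. admissible variations. -/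
def IsTest {p : ℤ} (θ : Form I M V p) : Prop := Smooth θ ∧ CompactInteriorSupport θ

/-- The exterior derivative of an `m`-form: at `x`, the exterior derivative of the coordinate
expression in the preferred chart at `x`, pulled back to the tangent space at `x`. -/
def nd {m : ℕ} (θ : NForm I M V m) : NForm I M V (m + 1) := fun x =>
  (extDerivWithin (inChart θ x) (Set.range I) (extChartAt I x x)).compContinuousLinearMap
    (mfderiv I 𝓘(ℝ, EuclideanSpace ℝ (Fin n)) (extChartAt I x) x)

/-- The exterior derivative `d` of forms of integer degree. -/
def d {p r : ℤ} (θ : Form I M V p) (h : p + 1 = r := by omega) : Form I M V r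
  | ⟨0, _⟩ => 0
  | ⟨m + 1, hm⟩ => nd (θ ⟨m, by push_cast at hm; omega⟩)

/-- The wedge product `a ∧^B b` of forms of integer degree. -/
def wedge {𝕜 : Type*} [RCLike 𝕜] [Module 𝕜 V] [Module 𝕜 W] [Module 𝕜 U]
    [IsScalarTower ℝ 𝕜 V] [IsScalarTower ℝ 𝕜 W] [IsScalarTower ℝ 𝕜 U]
    (B : V →ₗ[𝕜] W →ₗ[𝕜] U) {p q r : ℤ} (a : Form I M V p) (b : Form I M W q)
    (h : p + q = r := by omega) : Form I M U r := fun m =>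
  if hpq : 0 ≤ p ∧ 0 ≤ q then fun x =>
    wedgeAt B (p := p.toNat) (q := q.toNat) (by have := m.2; omega)
      (a ⟨p.toNat, by omega⟩ x) (b ⟨q.toNat, by omega⟩ x)
  else 0

/-- A linear map applied to the values of a form. -/
def mapForm {𝕜 : Type*} [RCLike 𝕜] [Module 𝕜 V] [Module 𝕜 W] [IsScalarTower ℝ 𝕜 V]
    [IsScalarTower ℝ 𝕜 W] (f : V →ₗ[𝕜] W) {p : ℤ} (a : Form I M V p) : Form I M W p := fun m x =>
  toCAM ((f.restrictScalars ℝ).compAlternatingMap (a m x).toAlternatingMap)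

/-- The coordinate basis at `x` of the preferred chart at `x`. -/
def coordBasis (x : M) : Module.Basis (Fin n) ℝ (TangentSpace I x) :=
  (EuclideanSpace.basisFun (Fin n) ℝ).toBasis

variable (I M) in
/-- A smooth pseudo-Riemannian metric (of any signature) on `M`. -/
structure PseudoRiemannianMetric where
  val : ∀ x : M, LinearMap.BilinForm ℝ (TangentSpace I x)
  symm : ∀ x v w, val x v w = val x w v
  nondegenerate : ∀ x, (val x).Nondegenerate
  smooth : ∀ (x₀ : M) (u v : EuclideanSpace ℝ (Fin n)), ContDiffOn ℝ ∞ (fun y =>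
    val ((extChartAt I x₀).symm y)
      (mfderivWithin 𝓘(ℝ, EuclideanSpace ℝ (Fin n)) I (extChartAt I x₀).symm (Set.range I) y u)
      (mfderivWithin 𝓘(ℝ, EuclideanSpace ℝ (Fin n)) I (extChartAt I x₀).symm (Set.range I) y v))
    (extChartAt I x₀).target

variable (I M) in
/-- An orientation of `M`, given by a nowhere vanishing smooth form `τ` of top degree. Only the
signs of the values of `τ` are used. -/
structure OrientationForm where
  τ : NForm I M ℝ n
  smooth : NSmooth τ
  ne_zero : ∀ x, τ x ≠ 0

/-- The Hodge star `∗` of forms of integer degree, from degree `p` to degree `r = n - p`. -/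
def star (g : PseudoRiemannianMetric I M) (o : OrientationForm I M) {p r : ℤ}
    (θ : Form I M V p) (h : p + r = n := by omega) : Form I M V r := fun m =>
  if hp : 0 ≤ p then fun x =>
    hodgeAt (p := p.toNat) (by have := m.2; omega) (coordBasis x) (g.val x) (g.nondegenerate x)
      (o.τ x) (θ ⟨p.toNat, by omega⟩ x)
  else 0

section Integral

variable [IsManifold I ∞ M] [T2Space M] [SigmaCompactSpace M]

variable (I M) in
/-- A smooth partition of unity subordinate to the preferred charts. -/
def chartPartition : SmoothPartitionOfUnity M I M Set.univ :=
  (SmoothPartitionOfUnity.exists_isSubordinate_chartAt_source I M).choose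

variable (I M) in
theorem chartPartition_isSubordinate :
    (chartPartition I M).IsSubordinate fun x => (chartAt H x).source :=
  (SmoothPartitionOfUnity.exists_isSubordinate_chartAt_source I M).choose_spec

/-- The integral `∫_M θ` of a (compactly supported) form of top degree over the oriented manifold
`M`: with a partition of unity `ρᵢ` subordinate to charts `φᵢ`, the sum of the Lebesgue integrals
of `(φᵢ⁻¹)^*(ρᵢ θ)(e₁, …, e_n)` over the chart targets, with sign `±` according to whether `φᵢ`
preserves or reverses orientation. -/
def nIntegral (o : OrientationForm I M) (θ : NForm I M V n) : V :=
  ∑ᶠ i : M, ∫ y in (extChartAt I i).target,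
    (chartPartition I M i ((extChartAt I i).symm y) *
      (SignType.sign (inChart o.τ i y (EuclideanSpace.basisFun (Fin n) ℝ)) : ℝ)) •
        inChart θ i y (EuclideanSpace.basisFun (Fin n) ℝ)

/-- The integral over `M` of a form of integer degree equal to `n`. -/
def integral (o : OrientationForm I M) {p : ℤ} (θ : Form I M V p) (h : p = n := by omega) : V :=
  nIntegral o (θ ⟨n, h.symm⟩)

/-- The integral of a generalized `(n-1)`-form over `(∂M, M)`:
`∫_{(∂M, M)} (a, a') = ∫_M a'`. -/
def gIntegral (o : OrientationForm I M) {p : ℤ} (θ : GForm I M V p)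
    (h : p + 1 = n := by omega) : V :=
  integral o θ.2 h

end Integral

/-! ## Operations on generalized forms -/

/-- The generalized product
`(a, a') ∧^B (b, b') = (a ∧^B b, a ∧^B b' + (-1)^q a' ∧^B b)`, with `(b, b')` of degree `q`. -/
def gwedge {𝕜 : Type*} [RCLike 𝕜] [Module 𝕜 V] [Module 𝕜 W] [Module 𝕜 U]
    [IsScalarTower ℝ 𝕜 V] [IsScalarTower ℝ 𝕜 W] [IsScalarTower ℝ 𝕜 U]
    (B : V →ₗ[𝕜] W →ₗ[𝕜] U) {p q r : ℤ} (a : GForm I M V p) (b : GForm I M W q)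
    (h : p + q = r := by omega) : GForm I M U r :=
  (wedge B a.1 b.1, wedge B a.1 b.2 + (-1 : ℝ) ^ q • wedge B a.2 b.1)

/-- A linear map applied to both components of a generalized form. -/
def gmap {𝕜 : Type*} [RCLike 𝕜] [Module 𝕜 V] [Module 𝕜 W] [IsScalarTower ℝ 𝕜 V]
    [IsScalarTower ℝ 𝕜 W] (f : V →ₗ[𝕜] W) {p : ℤ} (a : GForm I M V p) : GForm I M W p :=
  (mapForm f a.1, mapForm f a.2)

/-- The generalized exterior derivative
`𝐝 (a, a') = (d a + (-1)^{p+1} k a', d a')` on generalized `p`-forms. -/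
def gd {𝕜 : Type*} [RCLike 𝕜] [NormedSpace 𝕜 V] [IsScalarTower ℝ 𝕜 V] (k : 𝕜) {p r : ℤ}
    (a : GForm I M V p) (h : p + 1 = r := by omega) : GForm I M V r :=
  (d a.1 + (-1 : ℝ) ^ (p + 1) • k • (fun m => a.2 ⟨m.1, by have := m.2; omega⟩ : Form I M V r),
    d a.2)

/-- The generalized Hodge star `⋆ (a, a') = ((-1)^{n-p-1} ∗a', ∗a)` on generalized `p`-forms,
of degree `r = n - p - 1`. -/
def gstar (g : PseudoRiemannianMetric I M) (o : OrientationForm I M) {p r : ℤ}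
    (a : GForm I M V p) (h : p + r + 1 = n := by omega) : GForm I M V r :=
  ((-1 : ℝ) ^ ((n : ℤ) - p - 1) • star g o a.2, star g o a.1)

end Forms

/-! ## Differential 2-crossed modules and invariant forms -/

section Algebra

variable (𝕜 : Type*) [RCLike 𝕜] (𝔤 𝔥 𝔩 : Type*)
  [NormedLieRing 𝔤] [NormedLieAlgebra 𝕜 𝔤]
  [NormedLieRing 𝔥] [NormedLieAlgebra 𝕜 𝔥]
  [NormedLieRing 𝔩] [NormedLieAlgebra 𝕜 𝔩]

/-- A differential 2-crossed module `𝔩 → 𝔥 → 𝔤`, with maps `β`, `α`, actions `X ▷ Y = actH X Y` and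
`X ▷ Z = actL X Z` of `𝔤` by derivations (the action on `𝔤` is the adjoint one), and Peiffer
lifting `{Y₁, Y₂} = lift Y₁ Y₂`. -/
structure Differential2CrossedModule where
  α : 𝔥 →ₗ⁅𝕜⁆ 𝔤
  β : 𝔩 →ₗ⁅𝕜⁆ 𝔥
  actH : 𝔤 →ₗ[𝕜] 𝔥 →ₗ[𝕜] 𝔥
  actL : 𝔤 →ₗ[𝕜] 𝔩 →ₗ[𝕜] 𝔩
  lift : 𝔥 →ₗ[𝕜] 𝔥 →ₗ[𝕜] 𝔩
  actH_bracket : ∀ (X X' : 𝔤) (Y : 𝔥), actH ⁅X, X'⁆ Y = actH X (actH X' Y) - actH X' (actH X Y)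
  actH_derivation : ∀ (X : 𝔤) (Y Y' : 𝔥), actH X ⁅Y, Y'⁆ = ⁅actH X Y, Y'⁆ + ⁅Y, actH X Y'⁆
  actL_bracket : ∀ (X X' : 𝔤) (Z : 𝔩), actL ⁅X, X'⁆ Z = actL X (actL X' Z) - actL X' (actL X Z)
  actL_derivation : ∀ (X : 𝔤) (Z Z' : 𝔩), actL X ⁅Z, Z'⁆ = ⁅actL X Z, Z'⁆ + ⁅Z, actL X Z'⁆
  α_β : ∀ Z, α (β Z) = 0
  α_act : ∀ X Y, α (actH X Y) = ⁅X, α Y⁆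
  β_act : ∀ X Z, β (actL X Z) = actH X (β Z)
  act_lift : ∀ X Y Y', actL X (lift Y Y') = lift (actH X Y) Y' + lift Y (actH X Y')
  β_lift : ∀ Y Y', β (lift Y Y') = ⁅Y, Y'⁆ - actH (α Y) Y'
  bracket_eq_lift : ∀ Z Z' : 𝔩, ⁅Z, Z'⁆ = lift (β Z) (β Z')
  lift_bracket_left : ∀ Y₁ Y₂ Y₃ : 𝔥, lift ⁅Y₁, Y₂⁆ Y₃ =
    actL (α Y₁) (lift Y₂ Y₃) + lift Y₁ ⁅Y₂, Y₃⁆ - actL (α Y₂) (lift Y₁ Y₃) - lift Y₂ ⁅Y₁, Y₃⁆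
  lift_bracket_right : ∀ Y₁ Y₂ Y₃ : 𝔥, lift Y₁ ⁅Y₂, Y₃⁆ =
    lift (β (lift Y₁ Y₂)) Y₃ - lift (β (lift Y₁ Y₃)) Y₂
  lift_β : ∀ Z Y, lift (β Z) Y + lift Y (β Z) = -actL (α Y) Z

variable {𝕜 𝔤 𝔥 𝔩}

/-- Symmetric non-degenerate invariant bilinear forms on `𝔤`, `𝔥` and `𝔩`. Invariance is under the
infinitesimal action of `𝔤`, as follows from invariance under a Lie group `G` with Lie algebra
`𝔤` by differentiation. -/
structure InvariantForms (X : Differential2CrossedModule 𝕜 𝔤 𝔥 𝔩) where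
  Bg : LinearMap.BilinForm 𝕜 𝔤
  Bh : LinearMap.BilinForm 𝕜 𝔥
  Bl : LinearMap.BilinForm 𝕜 𝔩
  symm_g : ∀ x y, Bg x y = Bg y x
  symm_h : ∀ x y, Bh x y = Bh y x
  symm_l : ∀ x y, Bl x y = Bl y x
  nondegenerate_g : Bg.Nondegenerate
  nondegenerate_h : Bh.Nondegenerate
  nondegenerate_l : Bl.Nondegenerate
  invariant_g : ∀ x y z : 𝔤, Bg ⁅x, y⁆ z = -Bg y ⁅x, z⁆
  invariant_h : ∀ x y z, Bh (X.actH x y) z = -Bh y (X.actH x z)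
  invariant_l : ∀ x y z, Bl (X.actL x y) z = -Bl y (X.actL x z)

variable (𝕜 𝔤) in
/-- The Lie bracket as a bilinear map. -/
def bracket : 𝔤 →ₗ[𝕜] 𝔤 →ₗ[𝕜] 𝔤 :=
  LinearMap.mk₂ 𝕜 (fun x y => ⁅x, y⁆) add_lie smul_lie lie_add (fun c x y => lie_smul c x y)

namespace InvariantForms

set_option linter.unusedSectionVars false

variable [FiniteDimensional 𝕜 𝔤] [FiniteDimensional 𝕜 𝔥] [FiniteDimensional 𝕜 𝔩]
  {X : Differential2CrossedModule 𝕜 𝔤 𝔥 𝔩} (P : InvariantForms X)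

/-- `σ : 𝔥 × 𝔥 → 𝔤`, defined by `⟨σ(Y, Y'), X⟩ = -⟨Y, X ▷ Y'⟩`. -/
def σ : 𝔥 →ₗ[𝕜] 𝔥 →ₗ[𝕜] 𝔤 :=
  LinearMap.mk₂ 𝕜 (fun Y Y' => (P.Bg.toDual P.nondegenerate_g).symm (-(P.Bh Y ∘ₗ X.actH.flip Y')))
    (fun a b c => by rw [← map_add]; congr 1; ext; simp; ring)
    (fun a b c => by rw [← map_smul]; congr 1; ext; simp)
    (fun a b c => by rw [← map_add]; congr 1; ext; simp; ring)
    (fun a b c => by rw [← map_smul]; congr 1; ext; simp)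

theorem σ_spec (x : 𝔤) (Y Y' : 𝔥) : P.Bg (P.σ Y Y') x = -P.Bh Y (X.actH x Y') := by
  simp [σ]

/-- `κ : 𝔩 × 𝔩 → 𝔤`, defined by `⟨κ(Z, Z'), X⟩ = -⟨Z, X ▷ Z'⟩`. -/
def κ : 𝔩 →ₗ[𝕜] 𝔩 →ₗ[𝕜] 𝔤 :=
  LinearMap.mk₂ 𝕜 (fun Z Z' => (P.Bg.toDual P.nondegenerate_g).symm (-(P.Bl Z ∘ₗ X.actL.flip Z')))
    (fun a b c => by rw [← map_add]; congr 1; ext; simp; ring)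
    (fun a b c => by rw [← map_smul]; congr 1; ext; simp)
    (fun a b c => by rw [← map_add]; congr 1; ext; simp; ring)
    (fun a b c => by rw [← map_smul]; congr 1; ext; simp)

theorem κ_spec (x : 𝔤) (Z Z' : 𝔩) : P.Bg (P.κ Z Z') x = -P.Bl Z (X.actL x Z') := by
  simp [κ]

/-- `η₁ : 𝔩 × 𝔥 → 𝔥`, defined by `⟨{Y, Y'}, Z⟩ = -⟨Y', η₁(Z, Y)⟩`. -/
def η₁ : 𝔩 →ₗ[𝕜] 𝔥 →ₗ[𝕜] 𝔥 :=
  LinearMap.mk₂ 𝕜 (fun Z Y => (P.Bh.toDual P.nondegenerate_h).symm (-(P.Bl Z ∘ₗ X.lift Y)))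
    (fun a b c => by rw [← map_add]; congr 1; ext; simp; ring)
    (fun a b c => by rw [← map_smul]; congr 1; ext; simp)
    (fun a b c => by rw [← map_add]; congr 1; ext; simp; ring)
    (fun a b c => by rw [← map_smul]; congr 1; ext; simp)

theorem η₁_spec (Y Y' : 𝔥) (Z : 𝔩) : P.Bl (X.lift Y Y') Z = -P.Bh Y' (P.η₁ Z Y) := by
  rw [P.symm_h]; simp [η₁, P.symm_l]

/-- `η₂ : 𝔩 × 𝔥 → 𝔥`, defined by `⟨{Y, Y'}, Z⟩ = -⟨Y, η₂(Z, Y')⟩`. -/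
def η₂ : 𝔩 →ₗ[𝕜] 𝔥 →ₗ[𝕜] 𝔥 :=
  LinearMap.mk₂ 𝕜 (fun Z Y' => (P.Bh.toDual P.nondegenerate_h).symm (-(P.Bl Z ∘ₗ X.lift.flip Y')))
    (fun a b c => by rw [← map_add]; congr 1; ext; simp; ring)
    (fun a b c => by rw [← map_smul]; congr 1; ext; simp)
    (fun a b c => by rw [← map_add]; congr 1; ext; simp; ring)
    (fun a b c => by rw [← map_smul]; congr 1; ext; simp)

theorem η₂_spec (Y Y' : 𝔥) (Z : 𝔩) : P.Bl (X.lift Y Y') Z = -P.Bh Y (P.η₂ Z Y') := by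
  rw [P.symm_h]; simp [η₂, P.symm_l]

/-- `α* : 𝔤 → 𝔥`, defined by `⟨Y, α*(X)⟩ = ⟨α(Y), X⟩`. -/
def αs : 𝔤 →ₗ[𝕜] 𝔥 :=
  (P.Bh.toDual P.nondegenerate_h).symm.toLinearMap ∘ₗ
    (P.Bg.flip.compr₂ LinearMap.id).compl₂ (X.α : 𝔥 →ₗ[𝕜] 𝔤)

theorem αs_spec (x : 𝔤) (Y : 𝔥) : P.Bh Y (P.αs x) = P.Bg (X.α Y) x := by
  rw [P.symm_h]; simp [αs]

/-- `β* : 𝔥 → 𝔩`, defined by `⟨Z, β*(Y)⟩ = ⟨β(Z), Y⟩`. -/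
def βs : 𝔥 →ₗ[𝕜] 𝔩 :=
  (P.Bl.toDual P.nondegenerate_l).symm.toLinearMap ∘ₗ
    (P.Bh.flip.compr₂ LinearMap.id).compl₂ (X.β : 𝔩 →ₗ[𝕜] 𝔥)

theorem βs_spec (Y : 𝔥) (Z : 𝔩) : P.Bl Z (P.βs Y) = P.Bh (X.β Z) Y := by
  rw [P.symm_l]; simp [βs]

end InvariantForms

end Algebra

/-! ## Generalized 3-form Yang–Mills theory -/

section YangMills

variable {𝕜 : Type*} [RCLike 𝕜] {𝔤 𝔥 𝔩 : Type*}
  [NormedLieRing 𝔤] [NormedLieAlgebra 𝕜 𝔤] [NormedSpace ℝ 𝔤] [IsScalarTower ℝ 𝕜 𝔤]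
  [NormedLieRing 𝔥] [NormedLieAlgebra 𝕜 𝔥] [NormedSpace ℝ 𝔥] [IsScalarTower ℝ 𝕜 𝔥]
  [NormedLieRing 𝔩] [NormedLieAlgebra 𝕜 𝔩] [NormedSpace ℝ 𝔩] [IsScalarTower ℝ 𝕜 𝔩]
  [FiniteDimensional 𝕜 𝔤] [FiniteDimensional 𝕜 𝔥] [FiniteDimensional 𝕜 𝔩]
  {n : ℕ} {H : Type*} [TopologicalSpace H]
  {I : ModelWithCorners ℝ (EuclideanSpace ℝ (Fin n)) H}
  {M : Type*} [TopologicalSpace M] [ChartedSpace H M]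

variable (I M 𝔤 𝔥 𝔩) in
/-- The six component fields of a generalized 3-connection
`𝒜 = (A₁, A₂)`, `ℬ = (B₂, B₃)`, `𝒞 = (C₃, C₄)` (indices are degrees). -/
@[ext] structure Generalized3Connection where
  A₁ : Form I M 𝔤 1
  A₂ : Form I M 𝔤 2
  B₂ : Form I M 𝔥 2
  B₃ : Form I M 𝔥 3
  C₃ : Form I M 𝔩 3
  C₄ : Form I M 𝔩 4

namespace Generalized3Connection

/-- All six component fields are smooth. -/
def Smooth (φ : Generalized3Connection 𝔤 𝔥 𝔩 I M) : Prop :=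
  GYM.Smooth φ.A₁ ∧ GYM.Smooth φ.A₂ ∧ GYM.Smooth φ.B₂ ∧ GYM.Smooth φ.B₃ ∧
    GYM.Smooth φ.C₃ ∧ GYM.Smooth φ.C₄

/-- All six component fields are smooth with compact support in the interior of `M`. -/
def IsTest (φ : Generalized3Connection 𝔤 𝔥 𝔩 I M) : Prop :=
  GYM.IsTest φ.A₁ ∧ GYM.IsTest φ.A₂ ∧ GYM.IsTest φ.B₂ ∧ GYM.IsTest φ.B₃ ∧
    GYM.IsTest φ.C₃ ∧ GYM.IsTest φ.C₄

/-- The varied fields `φ + t δφ`. -/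
def vary (φ δφ : Generalized3Connection 𝔤 𝔥 𝔩 I M) (t : ℝ) :
    Generalized3Connection 𝔤 𝔥 𝔩 I M where
  A₁ := φ.A₁ + t • δφ.A₁
  A₂ := φ.A₂ + t • δφ.A₂
  B₂ := φ.B₂ + t • δφ.B₂
  B₃ := φ.B₃ + t • δφ.B₃
  C₃ := φ.C₃ + t • δφ.C₃
  C₄ := φ.C₄ + t • δφ.C₄

/-- The generalized `1`-form `𝒜 = (A₁, A₂)`. -/
def 𝒜 (φ : Generalized3Connection 𝔤 𝔥 𝔩 I M) : GForm I M 𝔤 1 := (φ.A₁, φ.A₂)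

/-- The generalized `2`-form `ℬ = (B₂, B₃)`. -/
def ℬ (φ : Generalized3Connection 𝔤 𝔥 𝔩 I M) : GForm I M 𝔥 2 := (φ.B₂, φ.B₃)

/-- The generalized `3`-form `𝒞 = (C₃, C₄)`. -/
def 𝒞 (φ : Generalized3Connection 𝔤 𝔥 𝔩 I M) : GForm I M 𝔩 3 := (φ.C₃, φ.C₄)

variable (X : Differential2CrossedModule 𝕜 𝔤 𝔥 𝔩) (P : InvariantForms X) (k : 𝕜)
  (g : PseudoRiemannianMetric I M) (o : OrientationForm I M)
  (φ δφ : Generalized3Connection 𝔤 𝔥 𝔩 I M)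

/-! ### Generalized curvatures, action and its variation -/

/-- `𝓕 = 𝐝𝒜 + 𝒜 ∧ 𝒜 - α(ℬ)`, where `𝒜 ∧ 𝒜 = ½ 𝒜 ∧^{[,]} 𝒜`. -/
def 𝓕 : GForm I M 𝔤 2 :=
  gd k φ.𝒜 + (1 / 2 : ℝ) • gwedge (bracket 𝕜 𝔤) φ.𝒜 φ.𝒜 - gmap (X.α : 𝔥 →ₗ[𝕜] 𝔤) φ.ℬ

/-- `𝓖 = 𝐝ℬ + 𝒜 ∧^▶ ℬ - β(𝒞)`. -/
def 𝓖 : GForm I M 𝔥 3 :=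
  gd k φ.ℬ + gwedge X.actH φ.𝒜 φ.ℬ - gmap (X.β : 𝔩 →ₗ[𝕜] 𝔥) φ.𝒞

/-- `𝓗 = 𝐝𝒞 + 𝒜 ∧^▶ 𝒞 + ℬ ∧^{{,}} ℬ`. -/
def 𝓗 : GForm I M 𝔩 4 :=
  gd k φ.𝒞 + gwedge X.actL φ.𝒜 φ.𝒞 + gwedge X.lift φ.ℬ φ.ℬ

/-- `⋆𝓕`, of degree `n - 3`. -/
def star𝓕 : GForm I M 𝔤 (n - 3) := gstar g o (φ.𝓕 X k)

/-- `⋆𝓖`, of degree `n - 4`. -/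
def star𝓖 : GForm I M 𝔥 (n - 4) := gstar g o (φ.𝓖 X k)

/-- `⋆𝓗`, of degree `n - 5`. -/
def star𝓗 : GForm I M 𝔩 (n - 5) := gstar g o (φ.𝓗 X k)

/-- The Lagrangian `⟪𝓕, ⋆𝓕⟫ + ⟪𝓖, ⋆𝓖⟫ + ⟪𝓗, ⋆𝓗⟫`, a generalized `(n-1)`-form. -/
def lagrangian : GForm I M 𝕜 (n - 1) :=
  gwedge P.Bg (φ.𝓕 X k) (φ.star𝓕 X k g o) + gwedge P.Bh (φ.𝓖 X k) (φ.star𝓖 X k g o) +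
    gwedge P.Bl (φ.𝓗 X k) (φ.star𝓗 X k g o)

section

variable [IsManifold I ∞ M] [T2Space M] [SigmaCompactSpace M]

/-- The action `S = ∫_{(∂M, M)} ⟪𝓕, ⋆𝓕⟫ + ⟪𝓖, ⋆𝓖⟫ + ⟪𝓗, ⋆𝓗⟫` (for compact `M`). -/
def action : 𝕜 := gIntegral o (φ.lagrangian X P k g o)

/-- The change `S[φ + t δφ] - S[φ]` of the action, as the integral of the change of the
Lagrangian, which has compact support if `δφ` has; so `M` need not be compact. -/
def actionChange (t : ℝ) : 𝕜 :=
  gIntegral o ((φ.vary δφ t).lagrangian X P k g o - φ.lagrangian X P k g o)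

/-- The first variation `d/dt S[φ + t δφ]` at `t = 0` exists and vanishes. -/
def Stationary : Prop := HasDerivAt (φ.actionChange X P k g o δφ) 0 (0 : ℝ)

end

/-! ### Ordinary curvatures and the six field equations -/

/-- `𝔽 = dA₁ + A₁ ∧ A₁ - α(B₂)`, where `A₁ ∧ A₁ = ½ A₁ ∧^{[,]} A₁`. -/
def 𝔽 : Form I M 𝔤 2 :=
  d φ.A₁ + (1 / 2 : ℝ) • wedge (bracket 𝕜 𝔤) φ.A₁ φ.A₁ - mapForm (X.α : 𝔥 →ₗ[𝕜] 𝔤) φ.B₂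

/-- `𝔾 = dB₂ + A₁ ∧^▷ B₂ - β(C₃)`. -/
def 𝔾 : Form I M 𝔥 3 :=
  d φ.B₂ + wedge X.actH φ.A₁ φ.B₂ - mapForm (X.β : 𝔩 →ₗ[𝕜] 𝔥) φ.C₃

/-- `ℍ = dC₃ + A₁ ∧^▷ C₃ + B₂ ∧^{{,}} B₂`. -/
def ℍ : Form I M 𝔩 4 :=
  d φ.C₃ + wedge X.actL φ.A₁ φ.C₃ + wedge X.lift φ.B₂ φ.B₂

variable (𝕜) in
/-- The covariant derivative `Dθ = dθ + A₁ ∧^{[,]} θ` of `𝔤`-valued forms. -/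
def Dg {p r : ℤ} (θ : Form I M 𝔤 p) (h : p + 1 = r := by omega) : Form I M 𝔤 r :=
  d θ + wedge (bracket 𝕜 𝔤) φ.A₁ θ

/-- The covariant derivative `Dθ = dθ + A₁ ∧^▷ θ` of `𝔥`-valued forms. -/
def Dh {p r : ℤ} (θ : Form I M 𝔥 p) (h : p + 1 = r := by omega) : Form I M 𝔥 r :=
  d θ + wedge X.actH φ.A₁ θ

/-- The covariant derivative `Dθ = dθ + A₁ ∧^▷ θ` of `𝔩`-valued forms. -/
def Dl {p r : ℤ} (θ : Form I M 𝔩 p) (h : p + 1 = r := by omega) : Form I M 𝔩 r :=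
  d θ + wedge X.actL φ.A₁ θ

/-- `∗(𝔽 + k A₂)`. -/
def sF₁ : Form I M 𝔤 (n - 2) := star g o (φ.𝔽 X + k • φ.A₂)

/-- `∗(D A₂ - α(B₃))`. -/
def sF₂ : Form I M 𝔤 (n - 3) := star g o (φ.Dg 𝕜 φ.A₂ - mapForm (X.α : 𝔥 →ₗ[𝕜] 𝔤) φ.B₃)

/-- `∗(𝔾 - k B₃)`. -/
def sG₁ : Form I M 𝔥 (n - 3) := star g o (φ.𝔾 X - k • φ.B₃)

/-- `∗(D B₃ + A₂ ∧^▷ B₂ - β(C₄))`. -/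
def sG₂ : Form I M 𝔥 (n - 4) :=
  star g o (φ.Dh X φ.B₃ + wedge X.actH φ.A₂ φ.B₂ - mapForm (X.β : 𝔩 →ₗ[𝕜] 𝔥) φ.C₄)

/-- `∗(ℍ + k C₄)`. -/
def sH₁ : Form I M 𝔩 (n - 4) := star g o (φ.ℍ X + k • φ.C₄)

/-- `∗(D C₄ - A₂ ∧^▷ C₃ + B₂ ∧^{{,}} B₃ + B₃ ∧^{{,}} B₂)`. -/
def sH₂ : Form I M 𝔩 (n - 5) :=
  star g o (φ.Dl X φ.C₄ - wedge X.actL φ.A₂ φ.C₃ + wedge X.lift φ.B₂ φ.B₃ +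
    wedge X.lift φ.B₃ φ.B₂ : Form I M 𝔩 5)

/-- The field equation of `A₁`:
`D∗(𝔽 + kA₂) + A₂ ∧^{[,]} ∗(DA₂ - α(B₃)) - σ̄(∗(𝔾 - kB₃), B₂)
+ (-1)^{n+1} σ̄(∗(DB₃ + A₂ ∧^▷ B₂ - β(C₄)), B₃) + (-1)^{n+1} κ̄(∗(ℍ + kC₄), C₃)
- κ̄(∗(DC₄ - A₂ ∧^▷ C₃ + B₂ ∧^{{,}} B₃ + B₃ ∧^{{,}} B₂), C₄) = 0`. -/
def FieldEqA₁ : Prop :=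
  (φ.Dg 𝕜 (φ.sF₁ X k g o) + wedge (bracket 𝕜 𝔤) φ.A₂ (φ.sF₂ X g o)
    - wedge P.σ (φ.sG₁ X k g o) φ.B₂
    + (-1 : ℝ) ^ (n + 1) • wedge P.σ (φ.sG₂ X g o) φ.B₃
    + (-1 : ℝ) ^ (n + 1) • wedge P.κ (φ.sH₁ X k g o) φ.C₃
    - wedge P.κ (φ.sH₂ X g o) φ.C₄ : Form I M 𝔤 (n - 1)) = 0

/-- The field equation of `A₂`:
`k∗(𝔽 + kA₂) - D∗(DA₂ - α(B₃)) - σ̄(∗(DB₃ + A₂ ∧^▷ B₂ - β(C₄)), B₂)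
+ (-1)^{n+1} κ̄(∗(DC₄ - A₂ ∧^▷ C₃ + B₂ ∧^{{,}} B₃ + B₃ ∧^{{,}} B₂), C₃) = 0`. -/
def FieldEqA₂ : Prop :=
  (k • φ.sF₁ X k g o - φ.Dg 𝕜 (φ.sF₂ X g o) - wedge P.σ (φ.sG₂ X g o) φ.B₂
    + (-1 : ℝ) ^ (n + 1) • wedge P.κ (φ.sH₂ X g o) φ.C₃ : Form I M 𝔤 (n - 2)) = 0

/-- The field equation of `B₂`:
`α*(∗(𝔽 + kA₂)) + D∗(𝔾 - kB₃) + A₂ ∧^▷ ∗(DB₃ + A₂ ∧^▷ B₂ - β(C₄)) + η̄₂(∗(ℍ + kC₄), B₂)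
+ η̄₁(∗(ℍ + kC₄), B₂)
+ (-1)^{n+1} η̄₁(∗(DC₄ - A₂ ∧^▷ C₃ + B₂ ∧^{{,}} B₃ + B₃ ∧^{{,}} B₂), B₃)
+ (-1)^{n+1} η̄₂(∗(DC₄ - A₂ ∧^▷ C₃ + B₂ ∧^{{,}} B₃ + B₃ ∧^{{,}} B₂), B₃) = 0`. -/
def FieldEqB₂ : Prop :=
  (mapForm P.αs (φ.sF₁ X k g o) + φ.Dh X (φ.sG₁ X k g o) + wedge X.actH φ.A₂ (φ.sG₂ X g o)
    + wedge P.η₂ (φ.sH₁ X k g o) φ.B₂ + wedge P.η₁ (φ.sH₁ X k g o) φ.B₂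
    + (-1 : ℝ) ^ (n + 1) • wedge P.η₁ (φ.sH₂ X g o) φ.B₃
    + (-1 : ℝ) ^ (n + 1) • wedge P.η₂ (φ.sH₂ X g o) φ.B₃ : Form I M 𝔥 (n - 2)) = 0

/-- The field equation of `B₃`:
`α*(∗(DA₂ - α(B₃))) + k∗(𝔾 - kB₃) - D∗(DB₃ + A₂ ∧^▷ B₂ - β(C₄))
+ η̄₁(∗(DC₄ - A₂ ∧^▷ C₃ + B₂ ∧^{{,}} B₃ + B₃ ∧^{{,}} B₂), B₂)
+ η̄₂(∗(DC₄ - A₂ ∧^▷ C₃ + B₂ ∧^{{,}} B₃ + B₃ ∧^{{,}} B₂), B₂) = 0`. -/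
def FieldEqB₃ : Prop :=
  (mapForm P.αs (φ.sF₂ X g o) + k • φ.sG₁ X k g o - φ.Dh X (φ.sG₂ X g o)
    + wedge P.η₁ (φ.sH₂ X g o) φ.B₂ + wedge P.η₂ (φ.sH₂ X g o) φ.B₂ : Form I M 𝔥 (n - 3)) = 0

/-- The field equation of `C₃`:
`D∗(ℍ + kC₄) + A₂ ∧^▷ ∗(DC₄ - A₂ ∧^▷ C₃ + B₂ ∧^{{,}} B₃ + B₃ ∧^{{,}} B₂) - β*(∗(𝔾 - kB₃)) = 0`. -/
def FieldEqC₃ : Prop :=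
  (φ.Dl X (φ.sH₁ X k g o) + wedge X.actL φ.A₂ (φ.sH₂ X g o)
    - mapForm P.βs (φ.sG₁ X k g o) : Form I M 𝔩 (n - 3)) = 0

/-- The field equation of `C₄`:
`k∗(ℍ + kC₄) - D∗(DC₄ - A₂ ∧^▷ C₃ + B₂ ∧^{{,}} B₃ + B₃ ∧^{{,}} B₂)
- β*(∗(DB₃ + A₂ ∧^▷ B₂ - β(C₄))) = 0`. -/
def FieldEqC₄ : Prop :=
  (k • φ.sH₁ X k g o - φ.Dl X (φ.sH₂ X g o) - mapForm P.βs (φ.sG₂ X g o) :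
    Form I M 𝔩 (n - 4)) = 0

/-! ### Ordinary 3-form Yang–Mills theory -/

/-- `∗𝔽`. -/
def s𝔽 : Form I M 𝔤 (n - 2) := star g o (φ.𝔽 X)

/-- `∗𝔾`. -/
def s𝔾 : Form I M 𝔥 (n - 3) := star g o (φ.𝔾 X)

/-- `∗ℍ`. -/
def sℍ : Form I M 𝔩 (n - 4) := star g o (φ.ℍ X)

/-- The ordinary 3-form Yang–Mills Lagrangian `⟨𝔽, ∗𝔽⟩ + ⟨𝔾, ∗𝔾⟩ + ⟨ℍ, ∗ℍ⟩` of
`(A₁, B₂, C₃)`. -/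
def ordinaryLagrangian : Form I M 𝕜 n :=
  wedge P.Bg (φ.𝔽 X) (φ.s𝔽 X g o) + wedge P.Bh (φ.𝔾 X) (φ.s𝔾 X g o) +
    wedge P.Bl (φ.ℍ X) (φ.sℍ X g o)

end Generalized3Connection

end YangMills

end
end GYM

open GYM

/-! Let `x` run over the six component curvatures `F₁, F₂, G₁, G₂, H₁, H₂`. In the top component of
`⟪𝓕, ⋆𝓕⟫` the sign `(-1)^{n-p-1}` of `⋆` meets the equal sign `(-1)^q` of the generalized product,
`q = n-p-1` being the degree of `⋆𝓕`, and the two cancel. So the integrand of `S` is the plain sum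
of the terms `⟨x, ∗x⟩` (`lagrangian_snd_apply`). Every `x` is polynomial of degree at most two in
the fields, hence the change of the Lagrangian along `φ + t δφ` is an exact polynomial of degree
four in `t` with coefficients of compact support. By the symmetry of `a ∧ ∗b` its linear coefficient
is twice the sum of the terms `⟨δx, ∗x⟩`. The derivative at `t = 0` therefore always exists, and
stationarity says that the integral of this sum vanishes (`stationary_iff`).

Each `⟨δx, E⟩`, with `E` in place of `∗x`, is rewritten as an exact form plus terms in which the
bare variation of a field stands on the left (`wedge_linF₁` to `wedge_linH₂`). The invariant pairing
satisfies a Leibniz rule for `D` (`wedge_covariant_left`), while `σ`, `κ`, `η₁`, `η₂`, `α*`, `β*`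
are by definition the adjoints that carry the algebraic maps across the pairing. All signs come from
graded commutativity. The exact part integrates to zero by Stokes' theorem, because variations have
compact support in the interior. What remains is a sum of pairings of the variations with the
Euler–Lagrange forms, up to an overall sign for the `𝔥`-valued fields. Non-degeneracy of the
invariant forms and the fundamental lemma `eq_zero_of_integral_wedge_eq_zero` turn its vanishing
into the field equations.

In the equations of generalized forms, the second component is the field equation of `A₁`, `B₂` or
`C₃`, and the first component is `±(-1)^n` times that of `A₂`, `B₃` or `C₄`. If `A₂ = B₃ = C₄ = 0`,
then `F₂ = G₂ = H₂ = 0`, and the equations of `A₂`, `B₃`, `C₄` reduce to `k∗𝔽 = 0`, `k∗𝔾 = 0`, `k∗ℍ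
= 0`. Since `k ≠ 0` and the Hodge star is injective, the curvatures themselves vanish.

The calculus of forms rests on a few facts. The wedge product is a normalized sum over all
permutations (`wedgeAt_apply`), which gives graded commutativity and associativity by reindexing.
The local exterior derivative is `∑ dxʲ ∧ ∂ⱼ`, so that the Leibniz rule follows from these two. The
pointwise star does not depend on the basis, hence is natural and smooth in charts. Stokes' theorem
is reduced by a partition of unity to the vanishing of the integral of a derivative of a compactly
supported function. -/

namespace GYM
noncomputable section

set_option linter.unusedSectionVars false
set_option linter.unusedVariables false

/-! ### The wedge product on one vector space: permutation formula, commutativity, associativity. -/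

section Pointwise

/-- The identification `Fin p ⊕ Fin q ≃ Fin (p + q)` putting the first summand first. -/
abbrev blockEquiv {p q r : ℕ} (h : p + q = r) : Fin p ⊕ Fin q ≃ Fin r :=
  finSumFinEquiv.trans (finCongr h)

/-- Substitute `σ ↦ σ τ`; the sign is multiplicative and squares to one. Every rearrangement of the
arguments of a wedge product below is an instance. -/
theorem sum_sign_smul_comp_perm {ι U : Type*} [Fintype ι] [DecidableEq ι] [AddCommGroup U]
    [Module ℝ U] (G : Equiv.Perm ι → U) (τ : Equiv.Perm ι) :
    ∑ σ : Equiv.Perm ι, ((σ.sign : ℤ) : ℝ) • G (σ * τ) =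
      ((τ.sign : ℤ) : ℝ) • ∑ σ : Equiv.Perm ι, ((σ.sign : ℤ) : ℝ) • G σ := by
  rw [Finset.smul_sum, ← Equiv.sum_comp (Equiv.mulRight τ)
    (fun σ => ((τ.sign : ℤ) : ℝ) • ((σ.sign : ℤ) : ℝ) • G σ)]
  refine Finset.sum_congr rfl fun σ _ => ?_
  rw [Equiv.coe_mulRight, smul_smul]
  congr 1
  rw [Equiv.Perm.sign_mul]
  push_cast
  have : (((τ.sign : ℤ) : ℝ)) * ((τ.sign : ℤ) : ℝ) = 1 := by
    rcases Int.units_eq_one_or τ.sign with h | h <;> simp [h]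
  linear_combination (-((σ.sign : ℤ) : ℝ)) * this

variable {𝕜 : Type*} [RCLike 𝕜] {T V W U : Type*} [AddCommGroup T] [Module ℝ T]
  [TopologicalSpace T]
  [IsTopologicalAddGroup T] [ContinuousSMul ℝ T] [T2Space T] [FiniteDimensional ℝ T]
  [NormedAddCommGroup V] [NormedSpace ℝ V] [NormedAddCommGroup W] [NormedSpace ℝ W]
  [NormedAddCommGroup U] [NormedSpace ℝ U]
  [Module 𝕜 V] [Module 𝕜 W] [Module 𝕜 U]
    [IsScalarTower ℝ 𝕜 V] [IsScalarTower ℝ 𝕜 W] [IsScalarTower ℝ 𝕜 U]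

theorem wedgeAt_apply_eq_lift (B : V →ₗ[𝕜] W →ₗ[𝕜] U) {p q r : ℕ} (h : p + q = r)
    (a : T [⋀^Fin p]→L[ℝ] V) (b : T [⋀^Fin q]→L[ℝ] W) (v : Fin r → T) :
    wedgeAt B h a b v = TensorProduct.lift (B.restrictScalars₁₂ ℝ ℝ)
      (a.toAlternatingMap.domCoprod b.toAlternatingMap fun i => v (blockEquiv h i)) := rfl

/-- The alternatization of `a ⊗ b` is `p! q!` times the sum over shuffles when `a` and `b` are
already alternating. The sum over all permutations needs no choice of shuffle representatives, so it
is the form used in all computations. -/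
theorem wedgeAt_apply (B : V →ₗ[𝕜] W →ₗ[𝕜] U) {p q r : ℕ} (h : p + q = r)
    (a : T [⋀^Fin p]→L[ℝ] V) (b : T [⋀^Fin q]→L[ℝ] W) (v : Fin r → T) :
    wedgeAt B h a b v = ((p.factorial * q.factorial : ℕ) : ℝ)⁻¹ • ∑ σ : Equiv.Perm (Fin r),
      ((σ.sign : ℤ) : ℝ) • B (a fun i => v (σ (blockEquiv h (.inl i))))
        (b fun i => v (σ (blockEquiv h (.inr i)))) := by
  have key := congrArg (fun f : T [⋀^Fin p ⊕ Fin q]→ₗ[ℝ] TensorProduct ℝ V W =>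
      TensorProduct.lift (B.restrictScalars₁₂ ℝ ℝ) (f fun i => v (blockEquiv h i)))
    (MultilinearMap.domCoprod_alternization_eq a.toAlternatingMap b.toAlternatingMap)
  have hne : ((p.factorial * q.factorial : ℕ) : ℝ) ≠ 0 := by positivity
  rw [eq_inv_smul_iff₀ hne, wedgeAt_apply_eq_lift]
  simp only [Fintype.card_fin, AlternatingMap.smul_apply, map_nsmul] at key
  rw [Nat.cast_smul_eq_nsmul, ← key, MultilinearMap.alternatization_apply, map_sum,
    ← (Equiv.permCongr (blockEquiv h)).sum_comp]
  refine Finset.sum_congr rfl fun σ _ => ?_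
  rw [Equiv.Perm.sign_permCongr, Units.smul_def, ← Int.cast_smul_eq_zsmul ℝ, map_smul]
  simp [MultilinearMap.domDomCongr_apply]

theorem wedgeAt_add_left (B : V →ₗ[𝕜] W →ₗ[𝕜] U) {p q r : ℕ} (h : p + q = r)
    (a a' : T [⋀^Fin p]→L[ℝ] V) (b : T [⋀^Fin q]→L[ℝ] W) :
    wedgeAt B h (a + a') b = wedgeAt B h a b + wedgeAt B h a' b := by
  ext v
  simp [wedgeAt_apply, Finset.sum_add_distrib]

theorem wedgeAt_add_right (B : V →ₗ[𝕜] W →ₗ[𝕜] U) {p q r : ℕ} (h : p + q = r)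
    (a : T [⋀^Fin p]→L[ℝ] V) (b b' : T [⋀^Fin q]→L[ℝ] W) :
    wedgeAt B h a (b + b') = wedgeAt B h a b + wedgeAt B h a b' := by
  ext v
  simp [wedgeAt_apply, Finset.sum_add_distrib]

theorem wedgeAt_real_smul_left (B : V →ₗ[𝕜] W →ₗ[𝕜] U) {p q r : ℕ} (h : p + q = r) (c : ℝ)
    (a : T [⋀^Fin p]→L[ℝ] V) (b : T [⋀^Fin q]→L[ℝ] W) :
    wedgeAt B h (c • a) b = c • wedgeAt B h a b := by
  ext v
  simp only [wedgeAt_apply, ContinuousAlternatingMap.smul_apply, LinearMap.map_smul_of_tower,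
    LinearMap.smul_apply, Finset.smul_sum, smul_smul]
  refine Finset.sum_congr rfl fun σ _ => ?_
  congr 1
  ring

theorem wedgeAt_real_smul_right (B : V →ₗ[𝕜] W →ₗ[𝕜] U) {p q r : ℕ} (h : p + q = r) (c : ℝ)
    (a : T [⋀^Fin p]→L[ℝ] V) (b : T [⋀^Fin q]→L[ℝ] W) :
    wedgeAt B h a (c • b) = c • wedgeAt B h a b := by
  ext v
  simp only [wedgeAt_apply, ContinuousAlternatingMap.smul_apply, LinearMap.map_smul_of_tower,
    Finset.smul_sum, smul_smul]
  refine Finset.sum_congr rfl fun σ _ => ?_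
  congr 1
  ring

theorem wedgeAt_comp {T' : Type*} [AddCommGroup T'] [Module ℝ T'] [TopologicalSpace T']
    [IsTopologicalAddGroup T'] [ContinuousSMul ℝ T'] [T2Space T'] [FiniteDimensional ℝ T']
    (B : V →ₗ[𝕜] W →ₗ[𝕜] U) {p q r : ℕ} (h : p + q = r)
    (a : T [⋀^Fin p]→L[ℝ] V) (b : T [⋀^Fin q]→L[ℝ] W) (L : T' →L[ℝ] T) :
    (wedgeAt B h a b).compContinuousLinearMap L =
      wedgeAt B h (a.compContinuousLinearMap L) (b.compContinuousLinearMap L) := by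
  ext v
  simp [wedgeAt_apply, Function.comp_def]

/-- Evaluation of a triple wedge product bracketed to the left. -/
theorem wedgeAt_wedgeAt_left_apply {V₁ V₂ V₃ V₁₂ : Type*}
    [NormedAddCommGroup V₁] [NormedSpace ℝ V₁] [NormedAddCommGroup V₂] [NormedSpace ℝ V₂]
    [NormedAddCommGroup V₃] [NormedSpace ℝ V₃] [NormedAddCommGroup V₁₂] [NormedSpace ℝ V₁₂]
    [Module 𝕜 V₁] [Module 𝕜 V₂] [Module 𝕜 V₃] [Module 𝕜 V₁₂]
    [IsScalarTower ℝ 𝕜 V₁] [IsScalarTower ℝ 𝕜 V₂] [IsScalarTower ℝ 𝕜 V₃] [IsScalarTower ℝ 𝕜 V₁₂]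
    (B₁ : V₁ →ₗ[𝕜] V₂ →ₗ[𝕜] V₁₂) (B₂ : V₁₂ →ₗ[𝕜] V₃ →ₗ[𝕜] U) {p q s pq r : ℕ}
    (h₁ : p + q = pq) (h₂ : pq + s = r)
    (a : T [⋀^Fin p]→L[ℝ] V₁) (b : T [⋀^Fin q]→L[ℝ] V₂) (c : T [⋀^Fin s]→L[ℝ] V₃) (v : Fin r → T) :
    wedgeAt B₂ h₂ (wedgeAt B₁ h₁ a b) c v =
      ((p.factorial * q.factorial * s.factorial : ℕ) : ℝ)⁻¹ • ∑ σ : Equiv.Perm (Fin r),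
      ((σ.sign : ℤ) : ℝ) • B₂
        (B₁ (a fun i => v (σ (blockEquiv h₂ (.inl (blockEquiv h₁ (.inl i))))))
          (b fun i => v (σ (blockEquiv h₂ (.inl (blockEquiv h₁ (.inr i)))))))
        (c fun i => v (σ (blockEquiv h₂ (.inr i)))) := by
  set S := ∑ σ : Equiv.Perm (Fin r),
      ((σ.sign : ℤ) : ℝ) • B₂
        (B₁ (a fun i => v (σ (blockEquiv h₂ (.inl (blockEquiv h₁ (.inl i))))))
          (b fun i => v (σ (blockEquiv h₂ (.inl (blockEquiv h₁ (.inr i)))))))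
        (c fun i => v (σ (blockEquiv h₂ (.inr i)))) with hS
  let G : Equiv.Perm (Fin r) → Equiv.Perm (Fin pq) → U := fun σ τ => B₂
        (B₁ (a fun i => v (σ (blockEquiv h₂ (.inl (τ (blockEquiv h₁ (.inl i)))))))
          (b fun i => v (σ (blockEquiv h₂ (.inl (τ (blockEquiv h₁ (.inr i))))))))
        (c fun i => v (σ (blockEquiv h₂ (.inr i))))
  -- The inner permutation `τ` is absorbed into the outer one by the substitution `σ ↦ σ ∘ (τ ⊕ 1)`;
  -- the sign produced cancels the sign of `τ`. The result is independent of `τ`.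
  have key : ∀ τ : Equiv.Perm (Fin pq), ∑ σ : Equiv.Perm (Fin r), ((σ.sign : ℤ) : ℝ) •
      ((τ.sign : ℤ) : ℝ) • G σ τ = S := by
    intro τ
    have := sum_sign_smul_comp_perm (fun σ : Equiv.Perm (Fin r) => B₂
        (B₁ (a fun i => v (σ (blockEquiv h₂ (.inl (blockEquiv h₁ (.inl i))))))
          (b fun i => v (σ (blockEquiv h₂ (.inl (blockEquiv h₁ (.inr i)))))))
        (c fun i => v (σ (blockEquiv h₂ (.inr i)))))
      ((blockEquiv h₂).permCongr (Equiv.Perm.sumCongr τ 1))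
    rw [← hS, Equiv.Perm.sign_permCongr, Equiv.Perm.sign_sumCongr, map_one, mul_one] at this
    simp only [Equiv.Perm.coe_mul, Function.comp_apply, Equiv.permCongr_apply,
      Equiv.symm_apply_apply, Equiv.Perm.sumCongr_apply, Sum.map_inl, Sum.map_inr,
      Equiv.Perm.coe_one, id_eq] at this
    have h1 : (((τ.sign : ℤ) : ℝ)) * ((τ.sign : ℤ) : ℝ) = 1 := by
      rcases Int.units_eq_one_or τ.sign with h | h <;> simp [h]
    calc _ = ((τ.sign : ℤ) : ℝ) • ((τ.sign : ℤ) : ℝ) • S := by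
          rw [← this, Finset.smul_sum]
          exact Finset.sum_congr rfl fun σ _ => smul_comm _ _ _
      _ = S := by rw [smul_smul, h1, one_smul]
  have key' : ∀ τ : Equiv.Perm (Fin pq), ∑ σ : Equiv.Perm (Fin r), ((pq.factorial * s.factorial : ℕ) : ℝ)⁻¹ •
      ((σ.sign : ℤ) : ℝ) • ((p.factorial * q.factorial : ℕ) : ℝ)⁻¹ • ((τ.sign : ℤ) : ℝ) • G σ τ =
      (((pq.factorial * s.factorial : ℕ) : ℝ)⁻¹ * ((p.factorial * q.factorial : ℕ) : ℝ)⁻¹) • S := fun τ => by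
    rw [← key τ, Finset.smul_sum]
    refine Finset.sum_congr rfl fun σ _ => ?_
    rw [smul_comm ((σ.sign : ℤ) : ℝ), smul_smul]
  rw [wedgeAt_apply]
  simp only [wedgeAt_apply, LinearMap.map_smul_of_tower, LinearMap.smul_apply, map_sum,
    LinearMap.sum_apply, Finset.smul_sum]
  -- The `(p+q)!` equal contributions of the inner permutations cancel the factor `1/(p+q)!` of the
  -- outer product.
  rw [Finset.sum_comm, Finset.sum_congr rfl fun τ _ => key' τ, Finset.sum_const, Finset.card_univ,
    Fintype.card_perm, Fintype.card_fin, ← Nat.cast_smul_eq_nsmul ℝ, smul_smul]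
  congr 1
  have : ((pq.factorial : ℕ) : ℝ) ≠ 0 := by positivity
  push_cast
  field_simp

/-- Evaluation of a triple wedge product bracketed to the right. -/
theorem wedgeAt_wedgeAt_right_apply {V₁ V₂ V₃ V₂₃ : Type*}
    [NormedAddCommGroup V₁] [NormedSpace ℝ V₁] [NormedAddCommGroup V₂] [NormedSpace ℝ V₂]
    [NormedAddCommGroup V₃] [NormedSpace ℝ V₃] [NormedAddCommGroup V₂₃] [NormedSpace ℝ V₂₃]
    [Module 𝕜 V₁] [Module 𝕜 V₂] [Module 𝕜 V₃] [Module 𝕜 V₂₃]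
    [IsScalarTower ℝ 𝕜 V₁] [IsScalarTower ℝ 𝕜 V₂] [IsScalarTower ℝ 𝕜 V₃] [IsScalarTower ℝ 𝕜 V₂₃]
    (C₁ : V₂ →ₗ[𝕜] V₃ →ₗ[𝕜] V₂₃) (C₂ : V₁ →ₗ[𝕜] V₂₃ →ₗ[𝕜] U) {p q s qs r : ℕ}
    (h₃ : q + s = qs) (h₄ : p + qs = r)
    (a : T [⋀^Fin p]→L[ℝ] V₁) (b : T [⋀^Fin q]→L[ℝ] V₂) (c : T [⋀^Fin s]→L[ℝ] V₃) (v : Fin r → T) :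
    wedgeAt C₂ h₄ a (wedgeAt C₁ h₃ b c) v =
      ((p.factorial * q.factorial * s.factorial : ℕ) : ℝ)⁻¹ • ∑ σ : Equiv.Perm (Fin r),
      ((σ.sign : ℤ) : ℝ) • C₂ (a fun i => v (σ (blockEquiv h₄ (.inl i))))
        (C₁ (b fun i => v (σ (blockEquiv h₄ (.inr (blockEquiv h₃ (.inl i))))))
          (c fun i => v (σ (blockEquiv h₄ (.inr (blockEquiv h₃ (.inr i))))))) := by
  set S := ∑ σ : Equiv.Perm (Fin r),
      ((σ.sign : ℤ) : ℝ) • C₂ (a fun i => v (σ (blockEquiv h₄ (.inl i))))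
        (C₁ (b fun i => v (σ (blockEquiv h₄ (.inr (blockEquiv h₃ (.inl i))))))
          (c fun i => v (σ (blockEquiv h₄ (.inr (blockEquiv h₃ (.inr i))))))) with hS
  let G : Equiv.Perm (Fin r) → Equiv.Perm (Fin qs) → U := fun σ τ =>
      C₂ (a fun i => v (σ (blockEquiv h₄ (.inl i))))
        (C₁ (b fun i => v (σ (blockEquiv h₄ (.inr (τ (blockEquiv h₃ (.inl i)))))))
          (c fun i => v (σ (blockEquiv h₄ (.inr (τ (blockEquiv h₃ (.inr i))))))))
  have key : ∀ τ : Equiv.Perm (Fin qs), ∑ σ : Equiv.Perm (Fin r), ((σ.sign : ℤ) : ℝ) •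
      ((τ.sign : ℤ) : ℝ) • G σ τ = S := by
    intro τ
    have := sum_sign_smul_comp_perm (fun σ : Equiv.Perm (Fin r) =>
        C₂ (a fun i => v (σ (blockEquiv h₄ (.inl i))))
        (C₁ (b fun i => v (σ (blockEquiv h₄ (.inr (blockEquiv h₃ (.inl i))))))
          (c fun i => v (σ (blockEquiv h₄ (.inr (blockEquiv h₃ (.inr i))))))))
      ((blockEquiv h₄).permCongr (Equiv.Perm.sumCongr 1 τ))
    rw [← hS, Equiv.Perm.sign_permCongr, Equiv.Perm.sign_sumCongr, map_one, one_mul] at this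
    simp only [Equiv.Perm.coe_mul, Function.comp_apply, Equiv.permCongr_apply,
      Equiv.symm_apply_apply, Equiv.Perm.sumCongr_apply, Sum.map_inl, Sum.map_inr,
      Equiv.Perm.coe_one, id_eq] at this
    have h1 : (((τ.sign : ℤ) : ℝ)) * ((τ.sign : ℤ) : ℝ) = 1 := by
      rcases Int.units_eq_one_or τ.sign with h | h <;> simp [h]
    calc _ = ((τ.sign : ℤ) : ℝ) • ((τ.sign : ℤ) : ℝ) • S := by
          rw [← this, Finset.smul_sum]
          exact Finset.sum_congr rfl fun σ _ => smul_comm _ _ _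
      _ = S := by rw [smul_smul, h1, one_smul]
  have key' : ∀ τ : Equiv.Perm (Fin qs), ∑ σ : Equiv.Perm (Fin r), ((p.factorial * qs.factorial : ℕ) : ℝ)⁻¹ •
      ((σ.sign : ℤ) : ℝ) • ((q.factorial * s.factorial : ℕ) : ℝ)⁻¹ • ((τ.sign : ℤ) : ℝ) • G σ τ =
      (((p.factorial * qs.factorial : ℕ) : ℝ)⁻¹ * ((q.factorial * s.factorial : ℕ) : ℝ)⁻¹) • S := fun τ => by
    rw [← key τ, Finset.smul_sum]
    refine Finset.sum_congr rfl fun σ _ => ?_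
    rw [smul_comm ((σ.sign : ℤ) : ℝ), smul_smul]
  rw [wedgeAt_apply]
  simp only [wedgeAt_apply, LinearMap.map_smul_of_tower, map_sum, Finset.smul_sum]
  rw [Finset.sum_comm, Finset.sum_congr rfl fun τ _ => key' τ, Finset.sum_const, Finset.card_univ,
    Fintype.card_perm, Fintype.card_fin, ← Nat.cast_smul_eq_nsmul ℝ, smul_smul]
  congr 1
  have : ((qs.factorial : ℕ) : ℝ) ≠ 0 := by positivity
  push_cast
  field_simp

/-- Only the paired values enter the permutation formula, so the value spaces may differ. This is
how scalars and linear maps are passed from one factor to the other. -/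
theorem wedgeAt_congr {V' W' : Type*} [NormedAddCommGroup V'] [NormedSpace ℝ V']
    [NormedAddCommGroup W'] [NormedSpace ℝ W'] [Module 𝕜 V'] [Module 𝕜 W']
    [IsScalarTower ℝ 𝕜 V'] [IsScalarTower ℝ 𝕜 W']
    (B : V →ₗ[𝕜] W →ₗ[𝕜] U) (B' : V' →ₗ[𝕜] W' →ₗ[𝕜] U) {p q r : ℕ} (h : p + q = r)
    {a : T [⋀^Fin p]→L[ℝ] V} {b : T [⋀^Fin q]→L[ℝ] W}
    {a' : T [⋀^Fin p]→L[ℝ] V'} {b' : T [⋀^Fin q]→L[ℝ] W'}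
    (hab : ∀ u w, B (a u) (b w) = B' (a' u) (b' w)) :
    wedgeAt B h a b = wedgeAt B' h a' b' := by
  ext v
  simp only [wedgeAt_apply, hab]

/-- Exchanging adjacent blocks of lengths `p` and `q` is the `q`-th power of the cyclic rotation of
`p + q` letters. Its sign is `(-1)^{(p+q-1)q}`, and `(q-1)q` is even. -/
theorem sign_blockSwap {p q r : ℕ} (h : p + q = r) (h' : q + p = r) :
    Equiv.Perm.sign ((blockEquiv h).symm.trans ((Equiv.sumComm _ _).trans (blockEquiv h'))) =
      (-1) ^ (p * q) := by
  subst h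
  have key : (blockEquiv rfl).symm.trans ((Equiv.sumComm _ _).trans (blockEquiv h')) =
      finRotate (p + q) ^ q := by
    rcases Nat.eq_zero_or_pos (p + q) with h0 | h0
    · ext i
      exact absurd i.2 (by omega)
    · obtain ⟨m, hm⟩ : ∃ m, p + q = m + 1 := ⟨p + q - 1, by omega⟩
      have hrot : ∀ (k : ℕ) (i : Fin (p + q)), ((finRotate (p + q) ^ k) i : ℕ) =
          (i + k) % (p + q) := by
        intro k
        induction k with
        | zero => intro i; simp [Nat.mod_eq_of_lt i.2]
        | succ k ih =>
          intro i
          rw [pow_succ', Equiv.Perm.mul_apply]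
          have h1 : ∀ j : Fin (p + q), (finRotate (p + q) j : ℕ) = (j + 1) % (p + q) := by
            rw [hm]
            intro j
            rw [finRotate_apply, Fin.val_add, Fin.val_one', Nat.add_mod_mod]
          rw [h1, ih, Nat.mod_add_mod, Nat.add_assoc]
      ext i
      rw [hrot]
      obtain ⟨j, rfl⟩ := (blockEquiv (rfl : p + q = p + q)).surjective i
      rcases j with j | j
      · have := j.2
        simp [Nat.mod_eq_of_lt (show q + (j : ℕ) < q + p by omega), Nat.add_comm _ q]
      · have := j.2
        simp [show p + (j : ℕ) + q = j + (p + q) by omega, Nat.mod_eq_of_lt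
          (show (j : ℕ) < p + q by omega)]
  rw [key, map_pow, sign_finRotate, ← pow_mul]
  apply Units.ext
  push_cast
  rcases Nat.eq_zero_or_pos q with rfl | hq
  · simp
  · have : (p + q - 1) * q = p * q + (q - 1) * q := by
      rw [Nat.add_sub_assoc hq, Nat.add_mul]
    rw [this, pow_add, Even.neg_one_pow (n := (q - 1) * q), mul_one]
    have := Nat.even_mul_succ_self (q - 1)
    rwa [Nat.sub_add_cancel hq] at this

/-- Graded commutativity of the wedge product. -/
theorem wedgeAt_comm (B : V →ₗ[𝕜] W →ₗ[𝕜] U) (B' : W →ₗ[𝕜] V →ₗ[𝕜] U)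
    (hB : ∀ v w, B v w = B' w v) {p q r : ℕ} (h : p + q = r)
    (h' : q + p = r) (a : T [⋀^Fin p]→L[ℝ] V) (b : T [⋀^Fin q]→L[ℝ] W) :
    wedgeAt B h a b = (-1 : ℝ) ^ (p * q) • wedgeAt B' h' b a := by
  ext v
  rw [ContinuousAlternatingMap.smul_apply, wedgeAt_apply, wedgeAt_apply, smul_comm,
    Nat.mul_comm q.factorial]
  congr 1
  have := sum_sign_smul_comp_perm (fun σ : Equiv.Perm (Fin r) =>
      B' (b fun i => v (σ (blockEquiv h' (.inl i)))) (a fun i => v (σ (blockEquiv h' (.inr i)))))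
      ((blockEquiv h').symm.trans ((Equiv.sumComm _ _).trans (blockEquiv h)))
  rw [sign_blockSwap, Nat.mul_comm q p] at this
  push_cast at this
  rw [← this]
  refine Finset.sum_congr rfl fun σ _ => ?_
  rw [hB]
  have e : ∀ i, ((blockEquiv h').symm.trans ((Equiv.sumComm _ _).trans (blockEquiv h)))
      (blockEquiv h' i) = blockEquiv h i.swap := fun i => by
    rw [Equiv.trans_apply, Equiv.symm_apply_apply, Equiv.trans_apply, Equiv.sumComm_apply]
  simp only [Function.comp_apply, e, Sum.swap_inl, Sum.swap_inr]

/-- Associativity of the wedge product. -/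
theorem wedgeAt_assoc {V₁ V₂ V₃ V₁₂ V₂₃ : Type*}
    [NormedAddCommGroup V₁] [NormedSpace ℝ V₁] [NormedAddCommGroup V₂] [NormedSpace ℝ V₂]
    [NormedAddCommGroup V₃] [NormedSpace ℝ V₃] [NormedAddCommGroup V₁₂] [NormedSpace ℝ V₁₂]
    [NormedAddCommGroup V₂₃] [NormedSpace ℝ V₂₃]
    [Module 𝕜 V₁] [Module 𝕜 V₂] [Module 𝕜 V₃] [Module 𝕜 V₁₂] [Module 𝕜 V₂₃]
    [IsScalarTower ℝ 𝕜 V₁] [IsScalarTower ℝ 𝕜 V₂] [IsScalarTower ℝ 𝕜 V₃] [IsScalarTower ℝ 𝕜 V₁₂]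
    [IsScalarTower ℝ 𝕜 V₂₃]
    (B₁ : V₁ →ₗ[𝕜] V₂ →ₗ[𝕜] V₁₂) (B₂ : V₁₂ →ₗ[𝕜] V₃ →ₗ[𝕜] U)
    (C₁ : V₂ →ₗ[𝕜] V₃ →ₗ[𝕜] V₂₃) (C₂ : V₁ →ₗ[𝕜] V₂₃ →ₗ[𝕜] U)
    (hB : ∀ x y z, B₂ (B₁ x y) z = C₂ x (C₁ y z)) {p q s pq qs r : ℕ}
    (h₁ : p + q = pq) (h₂ : pq + s = r) (h₃ : q + s = qs) (h₄ : p + qs = r)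
    (a : T [⋀^Fin p]→L[ℝ] V₁) (b : T [⋀^Fin q]→L[ℝ] V₂) (c : T [⋀^Fin s]→L[ℝ] V₃) :
    wedgeAt B₂ h₂ (wedgeAt B₁ h₁ a b) c = wedgeAt C₂ h₄ a (wedgeAt C₁ h₃ b c) := by
  ext v
  rw [wedgeAt_wedgeAt_left_apply, wedgeAt_wedgeAt_right_apply]
  congr 1
  refine Finset.sum_congr rfl fun σ _ => ?_
  rw [hB]
  -- Both bracketings cut `Fin r` into the same three consecutive blocks, of lengths `p`, `q`, `s`.
  have e1 : ∀ i, blockEquiv h₂ (.inl (blockEquiv h₁ (.inl i))) = blockEquiv h₄ (.inl i) :=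
    fun i => by ext; simp
  have e2 : ∀ i, blockEquiv h₂ (.inl (blockEquiv h₁ (.inr i))) =
      blockEquiv h₄ (.inr (blockEquiv h₃ (.inl i))) := fun i => by ext; simp
  have e3 : ∀ i, blockEquiv h₂ (.inr i) = blockEquiv h₄ (.inr (blockEquiv h₃ (.inr i))) :=
    fun i => by ext; simp; omega
  simp only [e1, e2, e3]

end Pointwise

/-! ### The Hodge star on one vector space: independence of the basis, symmetry, injectivity. -/

section Hodge

variable {𝕜 : Type*} [RCLike 𝕜] {T V W U : Type*} [AddCommGroup T] [Module ℝ T]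
  [TopologicalSpace T]
  [IsTopologicalAddGroup T] [ContinuousSMul ℝ T] [T2Space T] [FiniteDimensional ℝ T]
  [NormedAddCommGroup V] [NormedSpace ℝ V] [NormedAddCommGroup W] [NormedSpace ℝ W]
  [NormedAddCommGroup U] [NormedSpace ℝ U]
  [Module 𝕜 V] [Module 𝕜 W] [Module 𝕜 U]
    [IsScalarTower ℝ 𝕜 V] [IsScalarTower ℝ 𝕜 W] [IsScalarTower ℝ 𝕜 U]

theorem contractAt_apply {p r n : ℕ} (h : p + r = n) (f : T [⋀^Fin n]→ₗ[ℝ] ℝ) (u : Fin p → T)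
    (w : Fin r → T) :
    contractAt h f u w = f fun j => Sum.elim u w ((blockEquiv h).symm j) := rfl

theorem hodgeAt_apply {p r n : ℕ} (h : p + r = n) (b : Module.Basis (Fin n) ℝ T)
    (g : LinearMap.BilinForm ℝ T) (hg : g.Nondegenerate) (τ : T [⋀^Fin n]→L[ℝ] ℝ)
    (θ : T [⋀^Fin p]→L[ℝ] V) (w : Fin r → T) :
    hodgeAt h b g hg τ θ w = ((p.factorial : ℝ)⁻¹) • ∑ s : Fin p → Fin n,
      contractAt h (volAt b g τ) (fun i => b (s i)) w • θ fun i => g.dualBasis hg b (s i) := by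
  rw [hodgeAt, toCAM_apply, AlternatingMap.smul_apply]
  congr 1
  exact (map_sum (AddMonoidHom.mk' (fun F : T [⋀^Fin r]→ₗ[ℝ] V => F w) fun _ _ => rfl) _ _)

theorem hodgeAt_add {p r n : ℕ} (h : p + r = n) (b : Module.Basis (Fin n) ℝ T)
    (g : LinearMap.BilinForm ℝ T) (hg : g.Nondegenerate) (τ : T [⋀^Fin n]→L[ℝ] ℝ)
    (θ θ' : T [⋀^Fin p]→L[ℝ] V) :
    hodgeAt h b g hg τ (θ + θ') = hodgeAt h b g hg τ θ + hodgeAt h b g hg τ θ' := by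
  ext w
  simp [hodgeAt_apply, Finset.sum_add_distrib]

theorem hodgeAt_smul {p r n : ℕ} (h : p + r = n) (b : Module.Basis (Fin n) ℝ T)
    (g : LinearMap.BilinForm ℝ T) (hg : g.Nondegenerate) (τ : T [⋀^Fin n]→L[ℝ] ℝ) (c : ℝ)
    (θ : T [⋀^Fin p]→L[ℝ] V) :
    hodgeAt h b g hg τ (c • θ) = c • hodgeAt h b g hg τ θ := by
  ext w
  simp only [hodgeAt_apply, ContinuousAlternatingMap.smul_apply, Finset.smul_sum, smul_smul]
  refine Finset.sum_congr rfl fun s _ => ?_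
  congr 1
  ring

/-! ### Contractions over dual frames -/

theorem sum_dualBasis_smul {n : ℕ} (b : Module.Basis (Fin n) ℝ T) (g : LinearMap.BilinForm ℝ T)
    (hg : g.Nondegenerate) (x : T) : ∑ i, g x (b i) • g.dualBasis hg b i = x := by
  conv_rhs => rw [← (g.dualBasis hg b).sum_repr x]
  simp only [LinearMap.BilinForm.dualBasis_repr_apply]

theorem sum_dualBasis_smul' {n : ℕ} (b : Module.Basis (Fin n) ℝ T) (g : LinearMap.BilinForm ℝ T)
    (hg : g.Nondegenerate) (hs : ∀ x y, g x y = g y x) (x : T) :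
    ∑ i, g x (g.dualBasis hg b i) • b i = x := by
  conv_rhs => rw [← sum_dualBasis_smul (g.dualBasis hg b) g hg x]
  rw [LinearMap.BilinForm.dualBasis_dualBasis hg ⟨hs⟩]

/-- The total contraction of two multilinear maps over a pair of dual frames does not depend on
the pair. -/
theorem sum_contract_eq {p n : ℕ} {g : LinearMap.BilinForm ℝ T} (hs : ∀ x y, g x y = g y x)
    {c c' e e' : Fin n → T} (hc : ∀ x, ∑ i, g x (c i) • c' i = x)
    (he : ∀ x, ∑ i, g x (e' i) • e i = x) (β : V →ₗ[ℝ] W →ₗ[ℝ] U)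
    (F : MultilinearMap ℝ (fun _ : Fin p => T) V) (G : MultilinearMap ℝ (fun _ : Fin p => T) W) :
    ∑ s : Fin p → Fin n, β (F fun i => c (s i)) (G fun i => c' (s i)) =
      ∑ s : Fin p → Fin n, β (F fun i => e (s i)) (G fun i => e' (s i)) := by
  -- Expanding `c` in `e` on one side and `e'` in `c'` on the other turns both sums into the same
  -- double sum with coefficients `∏ g(c_{s i}, e'_{t i})`.
  have hF : ∀ s : Fin p → Fin n, F (fun i => c (s i)) =
      ∑ t : Fin p → Fin n, (∏ i, g (c (s i)) (e' (t i))) • F fun i => e (t i) := by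
    intro s
    conv_lhs => rw [show (fun i => c (s i)) = fun i => ∑ j, g (c (s i)) (e' j) • e j from
      funext fun i => (he _).symm]
    rw [MultilinearMap.map_sum]
    exact Finset.sum_congr rfl fun t _ => MultilinearMap.map_smul_univ _ _ _
  have hG : ∀ t : Fin p → Fin n, G (fun i => e' (t i)) =
      ∑ s : Fin p → Fin n, (∏ i, g (c (s i)) (e' (t i))) • G fun i => c' (s i) := by
    intro t
    conv_lhs => rw [show (fun i => e' (t i)) = fun i => ∑ j, g (e' (t i)) (c j) • c' j from
      funext fun i => (hc _).symm]
    rw [MultilinearMap.map_sum]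
    refine Finset.sum_congr rfl fun s _ => ?_
    rw [MultilinearMap.map_smul_univ]
    simp only [hs (e' _)]
  simp only [hF, hG, map_sum, LinearMap.sum_apply, map_smul, LinearMap.smul_apply]
  exact Finset.sum_comm

/-! ### Independence of the basis and naturality -/

/-- A change of basis of determinant `δ` multiplies `τ` on the basis by `δ` and the Gram determinant
by `δ²`. The resulting factor `sign δ · |δ| = δ` is exactly the ratio of the two determinant forms.
-/
theorem volAt_eq_volAt {n : ℕ} (b c : Module.Basis (Fin n) ℝ T) (g : LinearMap.BilinForm ℝ T)
    (τ : T [⋀^Fin n]→L[ℝ] ℝ) : volAt b g τ = volAt c g τ := by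
  have hτ : τ c = τ b * b.det c := by
    have := congrArg (fun f : T [⋀^Fin n]→ₗ[ℝ] ℝ => f c)
      (AlternatingMap.eq_smul_basis_det b τ.toAlternatingMap)
    simpa using this
  have hdet : b.det = b.det c • c.det := AlternatingMap.eq_smul_basis_det c b.det
  have hG : (Matrix.of fun i j => g (c i) (c j)).det =
      (b.det c) ^ 2 * (Matrix.of fun i j => g (b i) (b j)).det := by
    have := congrArg Matrix.det (LinearMap.BilinForm.toMatrix_mul_basis_toMatrix b c g)
    rw [Matrix.det_mul, Matrix.det_mul, Matrix.det_transpose, ← b.det_apply] at this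
    have hb : ∀ e : Module.Basis (Fin n) ℝ T, (Matrix.of fun i j => g (e i) (e j)) =
        LinearMap.BilinForm.toMatrix e g := fun e => by ext i j; simp
    rw [hb, hb, ← this]
    ring
  rw [volAt, volAt, hτ, hG, abs_mul, abs_sq, Real.sqrt_mul (sq_nonneg _),
    Real.sqrt_sq_eq_abs]
  conv_lhs => rw [hdet, smul_smul]
  congr 1
  rw [sign_mul]
  push_cast
  conv_lhs => rw [← sign_mul_abs (b.det c)]
  ring

/-- For fixed `w` the star is the total contraction of `u ↦ vol(u, w)` with `θ` over a basis and its
dual, and such contractions do not depend on the pair of dual frames. -/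
theorem hodgeAt_eq_hodgeAt {p r n : ℕ} (h : p + r = n) (b c : Module.Basis (Fin n) ℝ T)
    (g : LinearMap.BilinForm ℝ T) (hg : g.Nondegenerate) (hs : ∀ x y, g x y = g y x)
    (τ : T [⋀^Fin n]→L[ℝ] ℝ) (θ : T [⋀^Fin p]→L[ℝ] V) :
    hodgeAt h b g hg τ θ = hodgeAt h c g hg τ θ := by
  ext w
  rw [hodgeAt_apply, hodgeAt_apply, volAt_eq_volAt b c]
  congr 1
  -- `contractAt` is bundled as a form in the last slots; here the dependence on the first slots is
  -- needed.
  let F : MultilinearMap ℝ (fun _ : Fin p => T) ℝ :=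
    { toFun := fun u =>
        (volAt c g τ).domDomCongr (finSumFinEquiv.trans (finCongr h)).symm (Sum.elim u w)
      map_update_add' := fun u i x y => by
        classical
        have := ((volAt c g τ).domDomCongr
          (finSumFinEquiv.trans (finCongr h)).symm).map_update_add (Sum.elim u w) (Sum.inl i) x y
        simp only [Sum.update_elim_inl] at this
        convert this
      map_update_smul' := fun u i a x => by
        classical
        have := ((volAt c g τ).domDomCongr
          (finSumFinEquiv.trans (finCongr h)).symm).map_update_smul (Sum.elim u w) (Sum.inl i) a x
        simp only [Sum.update_elim_inl] at this
        convert this }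
  exact sum_contract_eq hs (sum_dualBasis_smul b g hg) (sum_dualBasis_smul' c g hg hs)
    (LinearMap.lsmul ℝ V) F θ.toMultilinearMap

theorem volAt_comp {T' : Type*} [AddCommGroup T'] [Module ℝ T'] [TopologicalSpace T']
    [IsTopologicalAddGroup T'] [ContinuousSMul ℝ T'] [T2Space T'] [FiniteDimensional ℝ T'] {n : ℕ}
    (b : Module.Basis (Fin n) ℝ T') (g : LinearMap.BilinForm ℝ T)
    (τ : T [⋀^Fin n]→L[ℝ] ℝ) (L : T' ≃L[ℝ] T) (w : Fin n → T') :
    volAt (b.map L.toLinearEquiv) g τ (fun i => L (w i)) =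
      volAt b (g.compl₁₂ (L : T' →ₗ[ℝ] T) (L : T' →ₗ[ℝ] T))
        (τ.compContinuousLinearMap (L : T' →L[ℝ] T)) w := by
  have : (b.map L.toLinearEquiv).det (fun i => L (w i)) = b.det w := by
    rw [Module.Basis.det_map]
    congr 1
    funext i
    exact L.symm_apply_apply _
  have hb : (fun i => L (b i)) = b.map L.toLinearEquiv := rfl
  simp [volAt, this, Function.comp_def, hb]

/-- Naturality under linear isomorphisms. By independence of the basis the star on `T` may be
computed in the `L`-image of a basis of `T'`, where dual bases and volume forms correspond termwise.
Applied to the derivative of a chart, it gives the star in coordinates. -/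
theorem hodgeAt_comp {T' : Type*} [AddCommGroup T'] [Module ℝ T'] [TopologicalSpace T']
    [IsTopologicalAddGroup T'] [ContinuousSMul ℝ T'] [T2Space T'] [FiniteDimensional ℝ T']
    {p r n : ℕ} (h : p + r = n) (b : Module.Basis (Fin n) ℝ T) (b' : Module.Basis (Fin n) ℝ T')
    (g : LinearMap.BilinForm ℝ T) (hg : g.Nondegenerate) (hs : ∀ x y, g x y = g y x)
    (τ : T [⋀^Fin n]→L[ℝ] ℝ) (θ : T [⋀^Fin p]→L[ℝ] V) (L : T' ≃L[ℝ] T)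
    (hg' : LinearMap.BilinForm.Nondegenerate
      (g.compl₁₂ (L : T' →ₗ[ℝ] T) (L : T' →ₗ[ℝ] T) : LinearMap.BilinForm ℝ T')) :
    (hodgeAt h b g hg τ θ).compContinuousLinearMap (L : T' →L[ℝ] T) =
      hodgeAt h b' (g.compl₁₂ (L : T' →ₗ[ℝ] T) (L : T' →ₗ[ℝ] T)) hg'
        (τ.compContinuousLinearMap (L : T' →L[ℝ] T))
        (θ.compContinuousLinearMap (L : T' →L[ℝ] T)) := by
  rw [hodgeAt_eq_hodgeAt h b (b'.map L.toLinearEquiv) g hg hs]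
  ext w
  rw [ContinuousAlternatingMap.compContinuousLinearMap_apply, hodgeAt_apply, hodgeAt_apply]
  congr 1
  refine Finset.sum_congr rfl fun s _ => ?_
  -- The preimage of the dual vector is expanded in the dual basis of the pulled back metric; only
  -- the `i`-th coefficient survives.
  have hd : ∀ i, g.dualBasis hg (b'.map L.toLinearEquiv) i =
      L (LinearMap.BilinForm.dualBasis _ hg' b' i) := by
    intro i
    have := sum_dualBasis_smul b' _ hg' (L.symm (g.dualBasis hg (b'.map L.toLinearEquiv) i))
    rw [← L.apply_symm_apply (g.dualBasis hg (b'.map L.toLinearEquiv) i), ← this]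
    congr 1
    rw [Finset.sum_eq_single i]
    · have := LinearMap.BilinForm.apply_dualBasis_left hg (b'.map L.toLinearEquiv) i i
      simp at this
      simp [this]
    · intro j _ hj
      have := LinearMap.BilinForm.apply_dualBasis_left hg (b'.map L.toLinearEquiv) i j
      simp [hj] at this
      simp [this]
    · simp
  congr 1
  · rw [contractAt_apply, contractAt_apply, ← volAt_comp]
    congr 1
    funext j
    rcases (blockEquiv h).symm j with i | i <;> simp
  · simp only [ContinuousAlternatingMap.compContinuousLinearMap_apply, hd, Function.comp_def]
    rfl

/-! ### Pairings -/

/-- Lets a tuple of distinct basis vectors be treated as the first block of a reordered basis. -/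
theorem exists_perm_blockEquiv {p q n : ℕ} (h : p + q = n) {s : Fin p → Fin n}
    (hs : Function.Injective s) :
    ∃ σ : Equiv.Perm (Fin n), ∀ i, σ (blockEquiv h (.inl i)) = s i := by
  classical
  obtain ⟨e, he⟩ := Set.MapsTo.exists_equiv_extend_of_card_eq (α := Fin n) (β := Fin n)
    (t := Finset.univ) (by simp) (s := Set.range fun i : Fin p => blockEquiv h (.inl i))
    (f := fun j => Sum.elim s (fun _ => j) ((blockEquiv h).symm j)) (fun _ _ => by simp) (by
      rintro _ ⟨i, rfl⟩ _ ⟨j, rfl⟩ hij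
      simp only [Equiv.symm_apply_apply, Sum.elim_inl] at hij
      rw [hs hij])
  refine ⟨e.trans (Equiv.subtypeUnivEquiv (by simp)), fun i => ?_⟩
  have := he _ ⟨i, rfl⟩
  rw [Equiv.symm_apply_apply] at this
  exact this

/-- The wedge product with a contraction of a form of top degree. -/
theorem wedgeAt_contractAt_apply (B : V →ₗ[𝕜] W →ₗ[𝕜] U) {p q n : ℕ} (h : p + q = n)
    (f : T [⋀^Fin n]→ₗ[ℝ] ℝ) (a : T [⋀^Fin p]→L[ℝ] V) (w : W) (v : Fin n → T) :
    wedgeAt B h a (toCAM ((LinearMap.toSpanSingleton ℝ W w).compAlternatingMap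
      (contractAt h f fun i => v (blockEquiv h (.inl i))))) v =
      f v • B (a fun i => v (blockEquiv h (.inl i))) w := by
  rw [wedgeAt_apply]
  have hne : ((p.factorial * q.factorial : ℕ) : ℝ) ≠ 0 := by positivity
  rw [inv_smul_eq_iff₀ hne]
  set R := f v • B (a fun i => v (blockEquiv h (.inl i))) w with hR
  -- The block-preserving permutations. Each contributes the same term `R`, the signs cancelling,
  -- and their number `p! q!` is the normalization.
  let Φ : Equiv.Perm (Fin p) × Equiv.Perm (Fin q) → Equiv.Perm (Fin n) := fun x =>
    (blockEquiv h).permCongr (Equiv.Perm.sumCongrHom _ _ x)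
  have hΦ : Function.Injective Φ := (Equiv.injective _).comp Equiv.Perm.sumCongrHom_injective
  rw [← Fintype.sum_of_injective Φ hΦ (fun _ => R)]
  · rw [Finset.sum_const, Finset.card_univ, Fintype.card_prod, Fintype.card_perm,
      Fintype.card_perm, Fintype.card_fin, Fintype.card_fin, Nat.cast_smul_eq_nsmul]
  · intro σ hσ
    -- A permutation outside the range of `Φ` sends some index of the second block into the first.
    -- The contracted form is then evaluated with a repeated vector and vanishes.
    have hm : ¬ Set.MapsTo ((blockEquiv h).symm.permCongr σ) (Set.range Sum.inr)
        (Set.range Sum.inr) := by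
      intro hm
      rw [← Equiv.Perm.perm_mapsTo_inl_iff_mapsTo_inr] at hm
      obtain ⟨x, hx⟩ := Equiv.Perm.mem_sumCongrHom_range_of_perm_mapsTo_inl hm
      refine hσ ⟨x, ?_⟩
      simp only [Φ, hx]
      ext i
      simp
    simp only [Set.MapsTo, Set.mem_range, not_forall] at hm
    obtain ⟨_, ⟨j, rfl⟩, hj⟩ := hm
    obtain ⟨i, hi⟩ : ∃ i, (blockEquiv h).symm.permCongr σ (Sum.inr j) = Sum.inl i := by
      rcases hx : (blockEquiv h).symm.permCongr σ (Sum.inr j) with i | i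
      · exact ⟨i, rfl⟩
      · exact absurd ⟨i, hx.symm⟩ hj
    have hi' : σ (blockEquiv h (.inr j)) = blockEquiv h (.inl i) := by
      rw [← hi]
      simp
    have : contractAt h f (fun i => v (blockEquiv h (.inl i)))
        (fun i => v (σ (blockEquiv h (.inr i)))) = 0 := by
      rw [contractAt_apply]
      refine f.map_eq_zero_of_eq _ (i := blockEquiv h (.inl i)) (j := blockEquiv h (.inr j)) ?_ ?_
      · simp only [Equiv.symm_apply_apply, Sum.elim_inl, Sum.elim_inr, hi']
      · intro hij
        exact Sum.inl_ne_inr ((blockEquiv h).injective hij)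
    rw [toCAM_apply, LinearMap.compAlternatingMap_apply, this]
    simp
  · rintro ⟨τ, ρ⟩
    have h1 : ∀ i, Φ (τ, ρ) (blockEquiv h (.inl i)) = blockEquiv h (.inl (τ i)) := by
      intro i
      simp only [Φ, Equiv.permCongr_apply, Equiv.symm_apply_apply]
      rfl
    have h2 : ∀ i, Φ (τ, ρ) (blockEquiv h (.inr i)) = blockEquiv h (.inr (ρ i)) := by
      intro i
      simp only [Φ, Equiv.permCongr_apply, Equiv.symm_apply_apply]
      rfl
    have h3 : a (fun i => v (blockEquiv h (.inl (τ i)))) =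
        ((τ.sign : ℤ) : ℝ) • a (fun i => v (blockEquiv h (.inl i))) := by
      have := AlternatingMap.map_perm a.toAlternatingMap (fun i => v (blockEquiv h (.inl i))) τ
      rw [Units.smul_def, ← Int.cast_smul_eq_zsmul ℝ] at this
      exact this
    have h4 : contractAt h f (fun i => v (blockEquiv h (.inl i)))
        (fun i => v (blockEquiv h (.inr (ρ i)))) = ((ρ.sign : ℤ) : ℝ) • f v := by
      have := AlternatingMap.map_perm (contractAt h f (fun i => v (blockEquiv h (.inl i))))
        (fun i => v (blockEquiv h (.inr i))) ρ
      rw [Units.smul_def, ← Int.cast_smul_eq_zsmul ℝ] at this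
      refine this.trans ?_
      congr 1
      rw [contractAt_apply]
      congr 1
      funext j
      obtain ⟨j, rfl⟩ := (blockEquiv h).surjective j
      rw [Equiv.symm_apply_apply]
      rcases j with j | j <;> rfl
    have h5 : (Φ (τ, ρ)).sign = τ.sign * ρ.sign := by
      exact (Equiv.Perm.sign_permCongr _ _).trans (Equiv.Perm.sign_sumCongr _ _)
    simp only [h1, h2, h3, h5, toCAM_apply, LinearMap.compAlternatingMap_apply, h4, hR,
      LinearMap.toSpanSingleton_apply, LinearMap.map_smul_of_tower, LinearMap.smul_apply, smul_smul]
    have h6 : ∀ ρ : ℤˣ, ((ρ : ℤ) : ℝ) * ((ρ : ℤ) : ℝ) = 1 := fun ρ => by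
      rcases Int.units_eq_one_or ρ with h | h <;> simp [h]
    congr 1
    push_cast
    linear_combination (-f v * (((ρ.sign : ℤ) : ℝ) * ((ρ.sign : ℤ) : ℝ))) * h6 τ.sign - f v * h6 ρ.sign

theorem map_comp_perm_real {n : ℕ} (f : T [⋀^Fin n]→ₗ[ℝ] V) (v : Fin n → T)
    (σ : Equiv.Perm (Fin n)) : f (fun i => v (σ i)) = ((σ.sign : ℤ) : ℝ) • f v := by
  have := AlternatingMap.map_perm f v σ
  rw [Units.smul_def, ← Int.cast_smul_eq_zsmul ℝ] at this
  exact this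

/-- The wedge product with a Hodge dual form. -/
theorem wedgeAt_hodgeAt_apply (B : V →ₗ[𝕜] W →ₗ[𝕜] U) {p q n : ℕ} (h : p + q = n)
    (b : Module.Basis (Fin n) ℝ T)
    (g : LinearMap.BilinForm ℝ T) (hg : g.Nondegenerate) (τ : T [⋀^Fin n]→L[ℝ] ℝ)
    (a : T [⋀^Fin p]→L[ℝ] V) (c : T [⋀^Fin p]→L[ℝ] W) :
    wedgeAt B h a (hodgeAt h b g hg τ c) b =
      ((p.factorial : ℝ)⁻¹ * volAt b g τ b) • ∑ s : Fin p → Fin n,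
        B (a fun i => b (s i)) (c fun i => g.dualBasis hg b (s i)) := by
  -- For injective `s`, reorder the basis so that `s` fills the first block; the sign of the
  -- reordering appears on both sides and is cancelled. For a repeated index both sides vanish.
  have key : ∀ (s : Fin p → Fin n) (w : W),
      wedgeAt B h a (toCAM ((LinearMap.toSpanSingleton ℝ W w).compAlternatingMap
        (contractAt h (volAt b g τ) fun i => b (s i)))) b =
      volAt b g τ b • B (a fun i => b (s i)) w := by
    intro s w
    by_cases hs : Function.Injective s
    · obtain ⟨σ, hσ⟩ := exists_perm_blockEquiv h hs
      have := wedgeAt_contractAt_apply B h (volAt b g τ) a w (fun i => b (σ i))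
      simp only [hσ] at this
      change (wedgeAt B h a _).toAlternatingMap _ = _ at this
      rw [map_comp_perm_real, map_comp_perm_real, smul_assoc] at this
      refine (smul_right_injective U (r := ((σ.sign : ℤ) : ℝ)) ?_) this
      rcases Int.units_eq_one_or σ.sign with h | h <;> simp [h]
    · obtain ⟨i, j, hij, hne⟩ : ∃ i j, s i = s j ∧ i ≠ j := by
        simpa [Function.Injective] using hs
      have h1 : contractAt h (volAt b g τ) (fun i => b (s i)) = 0 := by
        ext w
        rw [contractAt_apply]
        refine AlternatingMap.map_eq_zero_of_eq _ _ (i := blockEquiv h (.inl i))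
          (j := blockEquiv h (.inl j)) ?_ ?_
        · simp only [Equiv.symm_apply_apply, Sum.elim_inl, hij]
        · simpa using hne
      have h2 : a (fun i => b (s i)) = 0 :=
        a.map_eq_zero_of_eq _ (i := i) (j := j) (by simp only [hij]) hne
      rw [h1, h2, wedgeAt_apply]
      simp
  have hsum : hodgeAt h b g hg τ c = ((p.factorial : ℝ)⁻¹) • ∑ s : Fin p → Fin n,
      toCAM ((LinearMap.toSpanSingleton ℝ W (c fun i => g.dualBasis hg b (s i))).compAlternatingMap
        (contractAt h (volAt b g τ) fun i => b (s i))) := by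
    ext w
    rw [hodgeAt_apply, ContinuousAlternatingMap.smul_apply, ContinuousAlternatingMap.sum_apply]
    rfl
  have hlin : ∀ F : (Fin p → Fin n) → T [⋀^Fin q]→L[ℝ] W,
      wedgeAt B h a (∑ s, F s) = ∑ s, wedgeAt B h a (F s) := fun F =>
    map_sum (AddMonoidHom.mk' (wedgeAt B h a) (wedgeAt_add_right B h a)) F _
  rw [hsum, wedgeAt_real_smul_right, hlin, ContinuousAlternatingMap.smul_apply,
    ContinuousAlternatingMap.sum_apply, mul_smul]
  congr 1
  rw [Finset.smul_sum]
  exact Finset.sum_congr rfl fun s _ => key s _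

/-- An injective tuple of `n` indices out of `n` is a permutation, so a form of top degree is
determined by one value. -/
theorem ext_top {n : ℕ} (b : Module.Basis (Fin n) ℝ T) {f f' : T [⋀^Fin n]→L[ℝ] V}
    (h : f b = f' b) : f = f' := by
  apply ContinuousAlternatingMap.toAlternatingMap_injective
  refine Module.Basis.ext_alternating b fun s hs => ?_
  let σ := Equiv.ofBijective s (Finite.injective_iff_bijective.1 hs)
  have := map_comp_perm_real f.toAlternatingMap b σ
  rw [show f.toAlternatingMap b = f'.toAlternatingMap b from h, ← map_comp_perm_real] at this
  exact this

/-- Symmetry of `a ∧ ∗c`. -/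
theorem wedgeAt_hodgeAt_comm (B : V →ₗ[𝕜] V →ₗ[𝕜] U) (hB : ∀ x y, B x y = B y x) {p q n : ℕ}
    (h : p + q = n) (b : Module.Basis (Fin n) ℝ T)
    (g : LinearMap.BilinForm ℝ T) (hg : g.Nondegenerate) (hs : ∀ x y, g x y = g y x)
    (τ : T [⋀^Fin n]→L[ℝ] ℝ) (a c : T [⋀^Fin p]→L[ℝ] V) :
    wedgeAt B h a (hodgeAt h b g hg τ c) = wedgeAt B h c (hodgeAt h b g hg τ a) := by
  refine ext_top b ?_
  rw [wedgeAt_hodgeAt_apply, wedgeAt_hodgeAt_apply]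
  congr 1
  -- The contraction is rewritten over the same two frames with their roles exchanged; the symmetry
  -- of `B` then exchanges `a` and `c`.
  refine (sum_contract_eq hs (sum_dualBasis_smul b g hg) (sum_dualBasis_smul b g hg)
    (B.restrictScalars₁₂ ℝ ℝ) a.toMultilinearMap c.toMultilinearMap).trans ?_
  refine Finset.sum_congr rfl fun s _ => hB _ _

theorem volAt_basis_ne_zero {n : ℕ} (b : Module.Basis (Fin n) ℝ T) (g : LinearMap.BilinForm ℝ T)
    (hg : g.Nondegenerate) {τ : T [⋀^Fin n]→L[ℝ] ℝ} (hτ : τ ≠ 0) : volAt b g τ b ≠ 0 := by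
  have h1 : τ b ≠ 0 := fun h => hτ (ext_top b (by simpa using h))
  have h2 : (Matrix.of fun i j => g (b i) (b j)).det ≠ 0 := by
    have := (LinearMap.BilinForm.nondegenerate_iff_det_ne_zero b).1 hg
    rwa [show LinearMap.BilinForm.toMatrix b g = Matrix.of fun i j => g (b i) (b j) from by
      ext i j; simp] at this
  have h3 : √|(Matrix.of fun i j => g (b i) (b j)).det| ≠ 0 := by
    rw [Real.sqrt_ne_zero']
    positivity
  have h4 : (SignType.sign (τ b) : ℝ) ≠ 0 := by
    rcases lt_or_gt_of_ne h1 with h | h <;> simp [h]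
  simp only [volAt, AlternatingMap.smul_apply, b.det_self, smul_eq_mul, mul_one]
  exact mul_ne_zero h4 h3

/-- The Hodge star is injective. -/
theorem hodgeAt_eq_zero [FiniteDimensional ℝ V] {p q n : ℕ}
    (h : p + q = n) (b : Module.Basis (Fin n) ℝ T)
    (g : LinearMap.BilinForm ℝ T) (hg : g.Nondegenerate)
    {τ : T [⋀^Fin n]→L[ℝ] ℝ} (hτ : τ ≠ 0) (c : T [⋀^Fin p]→L[ℝ] V)
    (hc : hodgeAt h b g hg τ c = 0) : c = 0 := by
  apply ContinuousAlternatingMap.toAlternatingMap_injective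
  refine Module.Basis.ext_alternating (g.dualBasis hg b) fun s _ => ?_
  change c _ = 0
  rw [← Module.forall_dual_apply_eq_zero_iff ℝ]
  intro l
  -- The test form `a` is `l ∘ c` pulled back along `bᵢ ↦ bⁱ`. Then `l` applied to the coefficient
  -- of `a ∧ ∗c` is a nonzero multiple of a sum of squares of the numbers `l(c(b^{s}))`, whatever
  -- the signature of `g`.
  let L : T →L[ℝ] T := LinearMap.toContinuousLinearMap (b.constr ℝ (g.dualBasis hg b))
  let a : T [⋀^Fin p]→L[ℝ] ℝ :=
    (toCAM (l.compAlternatingMap c.toAlternatingMap)).compContinuousLinearMap L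
  have ha : ∀ t : Fin p → Fin n, a (fun i => b (t i)) = l (c fun i => g.dualBasis hg b (t i)) := by
    intro t
    simp [a, L, Function.comp_def]
  have h0 := wedgeAt_hodgeAt_apply (LinearMap.lsmul ℝ V) h b g hg τ a c
  have hz : wedgeAt (LinearMap.lsmul ℝ V) h a (0 : T [⋀^Fin q]→L[ℝ] V) = 0 := by
    simpa using wedgeAt_real_smul_right (LinearMap.lsmul ℝ V) h 0 a (0 : T [⋀^Fin q]→L[ℝ] V)
  rw [hc, hz] at h0
  change 0 = _ at h0
  have hne : (p.factorial : ℝ)⁻¹ * volAt b g τ b ≠ 0 :=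
    mul_ne_zero (by positivity) (volAt_basis_ne_zero b g hg hτ)
  have h1 := congrArg l ((smul_eq_zero_iff_right hne).1 h0.symm)
  rw [map_sum, map_zero] at h1
  simp only [ha, LinearMap.lsmul_apply, map_smul, smul_eq_mul] at h1
  rw [Finset.sum_eq_zero_iff_of_nonneg fun t _ => mul_self_nonneg _] at h1
  exact mul_self_eq_zero.1 (h1 s (Finset.mem_univ _))

/-- The wedge pairing is non-degenerate. -/
theorem eq_zero_of_wedgeAt_eq_zero (B : V →ₗ[𝕜] W →ₗ[𝕜] U)
    (hB : ∀ w, (∀ v, B v w = 0) → w = 0) {p q n : ℕ} (h : p + q = n)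
    (b : Module.Basis (Fin n) ℝ T) (E : T [⋀^Fin q]→L[ℝ] W)
    (hE : ∀ a : T [⋀^Fin p]→L[ℝ] V, wedgeAt B h a E b = 0) : E = 0 := by
  have hE' : ∀ a : T [⋀^Fin p]→L[ℝ] V, wedgeAt B h a E = 0 := fun a => ext_top b (hE a)
  apply ContinuousAlternatingMap.toAlternatingMap_injective
  refine Module.Basis.ext_alternating b fun s hs => ?_
  change E _ = 0
  refine hB _ fun x => ?_
  have h' : q + p = n := by omega
  -- Testing against `x` times the contraction of `det` with the vectors `b_s` isolates the single
  -- value `B(x, E(b_s))`, up to sign.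
  obtain ⟨σ, hσ⟩ := exists_perm_blockEquiv h' hs
  have h1 := wedgeAt_contractAt_apply B.flip h' b.det E x (fun i => b (σ i))
  have h2 := hE' (toCAM ((LinearMap.toSpanSingleton ℝ V x).compAlternatingMap
    (contractAt h' b.det fun i => b (σ (blockEquiv h' (.inl i))))))
  rw [wedgeAt_comm B B.flip (fun _ _ => rfl) h h'] at h2
  rw [(smul_eq_zero_iff_right (by positivity)).1 h2, map_comp_perm_real, b.det_self] at h1
  simp only [hσ] at h1
  refine (smul_eq_zero_iff_right ?_).1 h1.symm
  rcases Int.units_eq_one_or σ.sign with h | h <;> simp [h]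

end Hodge

/-! ### Forms on a normed space: smoothness, exterior derivative as a wedge product, Leibniz rule.
-/

section Calculus

variable {𝕜 : Type*} [RCLike 𝕜] {E V W U : Type*}
  [NormedAddCommGroup E] [NormedSpace ℝ E] [FiniteDimensional ℝ E]
  [NormedAddCommGroup V] [NormedSpace ℝ V] [NormedAddCommGroup W] [NormedSpace ℝ W]
  [NormedAddCommGroup U] [NormedSpace ℝ U]
  [Module 𝕜 V] [Module 𝕜 W] [Module 𝕜 U]
    [IsScalarTower ℝ 𝕜 V] [IsScalarTower ℝ 𝕜 W] [IsScalarTower ℝ 𝕜 U]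

/-- The values of a form on tuples of basis vectors. -/
def evalBasis {n m : ℕ} (b : Module.Basis (Fin n) ℝ E) :
    (E [⋀^Fin m]→L[ℝ] V) →ₗ[ℝ] ((Fin m → Fin n) → V) where
  toFun f t := f fun i => b (t i)
  map_add' _ _ := rfl
  map_smul' _ _ := rfl

theorem evalBasis_injective {n m : ℕ} (b : Module.Basis (Fin n) ℝ E) :
    Function.Injective (evalBasis (V := V) (m := m) b) := fun f f' h => by
  apply ContinuousAlternatingMap.toAlternatingMap_injective
  exact Module.Basis.ext_alternating b fun s _ => congrFun h s

instance finiteDimensional_continuousAlternatingMap [FiniteDimensional ℝ V] (m : ℕ) :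
    FiniteDimensional ℝ (E [⋀^Fin m]→L[ℝ] V) :=
  FiniteDimensional.of_injective _ (evalBasis_injective (Module.finBasis ℝ E))

/-- A form is smooth if its values on tuples of basis vectors are. -/
theorem contDiffOn_of_evalBasis [FiniteDimensional ℝ V] {X : Type*} [NormedAddCommGroup X]
    [NormedSpace ℝ X] {n m : ℕ} (b : Module.Basis (Fin n) ℝ E)
    {f : X → E [⋀^Fin m]→L[ℝ] V} {s : Set X} {N : ℕ∞ω}
    (hf : ∀ t : Fin m → Fin n, ContDiffOn ℝ N (fun y => f y fun i => b (t i)) s) :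
    ContDiffOn ℝ N f s := by
  obtain ⟨l, hl⟩ := LinearMap.exists_leftInverse_of_injective (evalBasis (V := V) (m := m) b)
    (LinearMap.ker_eq_bot.2 (evalBasis_injective b))
  have h1 : ContDiffOn ℝ N (fun y => evalBasis b (f y)) s := contDiffOn_pi.2 hf
  have h2 := (LinearMap.toContinuousLinearMap l).contDiff.comp_contDiffOn h1
  refine h2.congr fun y _ => ?_
  exact (LinearMap.congr_fun hl (f y)).symm

theorem contDiffOn_eval {X : Type*} [NormedAddCommGroup X]
    [NormedSpace ℝ X] {m : ℕ} {f : X → E [⋀^Fin m]→L[ℝ] V} {s : Set X} {N : ℕ∞ω}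
    (hf : ContDiffOn ℝ N f s) (v : Fin m → E) : ContDiffOn ℝ N (fun y => f y v) s :=
  (ContinuousAlternatingMap.apply ℝ E V v).contDiff.comp_contDiffOn hf

/-- The wedge product as a continuous bilinear map. -/
def wedgeCLM [FiniteDimensional ℝ V] [FiniteDimensional ℝ W] (B : V →ₗ[𝕜] W →ₗ[𝕜] U) {p q r : ℕ}
    (h : p + q = r) :
    (E [⋀^Fin p]→L[ℝ] V) →L[ℝ] (E [⋀^Fin q]→L[ℝ] W) →L[ℝ] (E [⋀^Fin r]→L[ℝ] U) :=
  LinearMap.toContinuousBilinearMap (LinearMap.mk₂ ℝ (wedgeAt B h) (wedgeAt_add_left B h)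
    (wedgeAt_real_smul_left B h) (wedgeAt_add_right B h)
    (fun c a b => wedgeAt_real_smul_right B h c a b))

theorem contDiffOn_wedgeAt [FiniteDimensional ℝ V] [FiniteDimensional ℝ W] [FiniteDimensional ℝ U]
    {X : Type*} [NormedAddCommGroup X] [NormedSpace ℝ X]
    (B : V →ₗ[𝕜] W →ₗ[𝕜] U) {p q r : ℕ} (h : p + q = r) {s : Set X} {N : ℕ∞ω}
    {a : X → E [⋀^Fin p]→L[ℝ] V} {b : X → E [⋀^Fin q]→L[ℝ] W}
    (ha : ContDiffOn ℝ N a s) (hb : ContDiffOn ℝ N b s) :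
    ContDiffOn ℝ N (fun y => wedgeAt B h (a y) (b y)) s := by
  refine contDiffOn_of_evalBasis (Module.finBasis ℝ E) fun t => ?_
  simp only [wedgeAt_apply]
  refine ContDiffOn.const_smul _ (ContDiffOn.sum fun σ _ => ContDiffOn.const_smul _ ?_)
  have hB : ContDiff ℝ N fun x : V × W => B x.1 x.2 :=
    (LinearMap.toContinuousBilinearMap (B.restrictScalars₁₂ ℝ ℝ)).isBoundedBilinearMap.contDiff
  exact hB.comp_contDiffOn ((contDiffOn_eval ha _).prodMk (contDiffOn_eval hb _))

/-! ### The exterior derivative as a wedge product -/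

theorem wedgeAt_restrictScalars (B : V →ₗ[𝕜] W →ₗ[𝕜] U) {p q r : ℕ}
    (h : p + q = r) (a : E [⋀^Fin p]→L[ℝ] V) (b : E [⋀^Fin q]→L[ℝ] W) :
    wedgeAt (B.restrictScalars₁₂ ℝ ℝ) h a b = wedgeAt B h a b := by
  ext v
  simp only [wedgeAt_apply]
  rfl

/-- The `1`-form given by a linear functional. -/
abbrev oneForm (l : E →L[ℝ] ℝ) : E [⋀^Fin 1]→L[ℝ] ℝ :=
  ContinuousAlternatingMap.ofSubsingleton ℝ E ℝ 0 l

/-- A permutation of `p + 1` letters is determined by the image `i` of `0` and a permutation of the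
other letters. The latter acts on the alternating `θ` by its sign, so each `i` yields `p!` equal
terms. -/
theorem wedgeAt_oneForm_apply (l : E →L[ℝ] ℝ) {p : ℕ} (h : 1 + p = p + 1)
    (θ : E [⋀^Fin p]→L[ℝ] V) (v : Fin (p + 1) → E) :
    wedgeAt (LinearMap.lsmul ℝ V) h (oneForm l) θ v =
      ∑ i : Fin (p + 1), (-1 : ℝ) ^ (i : ℕ) • l (v i) • θ (i.removeNth v) := by
  have h0 : ∀ i : Fin 1, blockEquiv h (.inl i) = 0 := fun i => by ext; simp
  have h1 : ∀ i : Fin p, blockEquiv h (.inr i) = i.succ := fun i => by ext; simp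
  have hp : ((Nat.factorial 1 * p.factorial : ℕ) : ℝ) ≠ 0 := by positivity
  rw [wedgeAt_apply, inv_smul_eq_iff₀ hp, ← Equiv.Perm.decomposeFin.symm.sum_comp,
    Fintype.sum_prod_type, Finset.smul_sum]
  refine Finset.sum_congr rfl fun i _ => ?_
  -- Exchanging `0` and `i` lists the remaining vectors in an order differing from the deletion of
  -- the `i`-th vector by a cycle of known sign.
  have hswap : θ (fun j => v (Equiv.swap 0 i j.succ)) =
      (if i = 0 then (1 : ℝ) else -1) • (-1 : ℝ) ^ (i : ℕ) • θ (i.removeNth v) := by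
    induction i using Fin.cases with
    | zero =>
      simp
      rfl
    | succ i =>
      have := AlternatingMap.map_perm θ.toAlternatingMap (i.succ.removeNth v) i.cycleRange
      rw [Fin.sign_cycleRange] at this
      have e : (i.succ.removeNth v) ∘ i.cycleRange = fun j => v (Equiv.swap 0 i.succ j.succ) := by
        funext j
        simp [Fin.removeNth, Fin.succAbove_cycleRange]
      rw [e] at this
      refine this.trans ?_
      rw [if_neg (Fin.succ_ne_zero i), smul_smul, Units.smul_def, ← Int.cast_smul_eq_zsmul ℝ]
      congr 1
      push_cast
      rw [Fin.val_succ, pow_succ]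
      ring
  have hterm : ∀ e : Equiv.Perm (Fin p),
      (((Equiv.Perm.decomposeFin.symm (i, e)).sign : ℤ) : ℝ) •
        (LinearMap.lsmul ℝ V (oneForm l fun j =>
          v (Equiv.Perm.decomposeFin.symm (i, e) (blockEquiv h (.inl j)))))
        (θ fun j => v (Equiv.Perm.decomposeFin.symm (i, e) (blockEquiv h (.inr j)))) =
      (-1 : ℝ) ^ (i : ℕ) • l (v i) • θ (i.removeNth v) := by
    intro e
    simp only [h0, h1, Equiv.Perm.decomposeFin_symm_apply_zero,
      Equiv.Perm.decomposeFin_symm_apply_succ, Equiv.Perm.decomposeFin.symm_sign]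
    have he : θ (fun j => v (Equiv.swap 0 i (e j).succ)) =
        ((e.sign : ℤ) : ℝ) • θ (fun j => v (Equiv.swap 0 i j.succ)) :=
      map_comp_perm_real θ.toAlternatingMap (fun j => v (Equiv.swap 0 i j.succ)) e
    have h6 : ((e.sign : ℤ) : ℝ) * ((e.sign : ℤ) : ℝ) = 1 := by
      rcases Int.units_eq_one_or e.sign with h | h <;> simp [h]
    rw [he, hswap]
    simp only [LinearMap.lsmul_apply, smul_smul, ContinuousAlternatingMap.ofSubsingleton_apply_apply]
    congr 1
    split_ifs
    · push_cast
      linear_combination (l (v i) * (-1 : ℝ) ^ (i : ℕ)) * h6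
    · push_cast
      linear_combination (l (v i) * (-1 : ℝ) ^ (i : ℕ)) * h6
  rw [Finset.sum_congr rfl fun e _ => hterm e, Finset.sum_const, Finset.card_univ,
    Fintype.card_perm, Fintype.card_fin, Nat.factorial_one, one_mul, Nat.cast_smul_eq_nsmul]

/-- The alternation of a linear family of forms, as a sum of wedge products. -/
def alternateAt {n : ℕ} (b : Module.Basis (Fin n) ℝ E) {p r : ℕ} (h : 1 + p = r)
    (f : E → E [⋀^Fin p]→L[ℝ] V) : E [⋀^Fin r]→L[ℝ] V :=
  ∑ j, wedgeAt (LinearMap.lsmul ℝ V) h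
    (oneForm (LinearMap.toContinuousLinearMap (b.coord j))) (f (b j))

/-- Writing `f(vᵢ)` in coordinates identifies the alternation with `∑ dxʲ ∧ f(eⱼ)`. In this form the
Leibniz rule is a consequence of associativity and graded commutativity. -/
theorem alternatizeUncurryFin_eq_alternateAt {n : ℕ} (b : Module.Basis (Fin n) ℝ E) {p : ℕ}
    (h : 1 + p = p + 1) (f : E →L[ℝ] E [⋀^Fin p]→L[ℝ] V) :
    ContinuousAlternatingMap.alternatizeUncurryFin f = alternateAt b h f := by
  ext v
  rw [alternateAt, ContinuousAlternatingMap.sum_apply,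
    ContinuousAlternatingMap.alternatizeUncurryFin_apply]
  simp only [wedgeAt_oneForm_apply]
  rw [Finset.sum_comm]
  refine Finset.sum_congr rfl fun i _ => ?_
  rw [← Finset.smul_sum]
  have : f (v i) = ∑ j, b.coord j (v i) • f (b j) := by
    conv_lhs => rw [← b.sum_repr (v i)]
    simp only [map_sum, map_smul]
    rfl
  rw [this, ContinuousAlternatingMap.sum_apply]
  rcases Nat.even_or_odd (i : ℕ) with hi | hi <;> simp [hi.neg_one_pow]

theorem alternateAt_add {n : ℕ} (b : Module.Basis (Fin n) ℝ E) {p r : ℕ} (h : 1 + p = r)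
    (f f' : E → E [⋀^Fin p]→L[ℝ] V) :
    alternateAt b h (fun v => f v + f' v) = alternateAt b h f + alternateAt b h f' := by
  simp only [alternateAt, wedgeAt_add_right, Finset.sum_add_distrib]

theorem wedgeAt_sum_left {ι : Type*} (B : V →ₗ[𝕜] W →ₗ[𝕜] U) {p q r : ℕ} (h : p + q = r)
    (s : Finset ι) (a : ι → E [⋀^Fin p]→L[ℝ] V) (b : E [⋀^Fin q]→L[ℝ] W) :
    wedgeAt B h (∑ i ∈ s, a i) b = ∑ i ∈ s, wedgeAt B h (a i) b :=
  map_sum (AddMonoidHom.mk' (fun a => wedgeAt B h a b) fun a a' => wedgeAt_add_left B h a a' b) _ _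

theorem wedgeAt_sum_right {ι : Type*} (B : V →ₗ[𝕜] W →ₗ[𝕜] U) {p q r : ℕ} (h : p + q = r)
    (s : Finset ι) (a : E [⋀^Fin p]→L[ℝ] V) (b : ι → E [⋀^Fin q]→L[ℝ] W) :
    wedgeAt B h a (∑ i ∈ s, b i) = ∑ i ∈ s, wedgeAt B h a (b i) :=
  map_sum (AddMonoidHom.mk' (wedgeAt B h a) (wedgeAt_add_right B h a)) _ _

/-- This is `dxʲ ∧ (f ∧ b) = (dxʲ ∧ f) ∧ b`, summed over `j`. -/
theorem alternateAt_wedgeAt_left {n : ℕ} (e : Module.Basis (Fin n) ℝ E)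
    (B : V →ₗ[𝕜] W →ₗ[𝕜] U) {p q r p' r' : ℕ} (h : p + q = r) (hr : 1 + r = r') (hp : 1 + p = p')
    (h' : p' + q = r') (f : E → E [⋀^Fin p]→L[ℝ] V) (b : E [⋀^Fin q]→L[ℝ] W) :
    alternateAt e hr (fun v => wedgeAt B h (f v) b) = wedgeAt B h' (alternateAt e hp f) b := by
  rw [alternateAt, alternateAt, wedgeAt_sum_left]
  refine Finset.sum_congr rfl fun j _ => ?_
  -- The coordinate forms are real, so `B` is regarded as real bilinear in order to associate both
  -- products over one field.
  rw [← wedgeAt_restrictScalars B, ← wedgeAt_restrictScalars B]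
  exact (wedgeAt_assoc (LinearMap.lsmul ℝ V) (B.restrictScalars₁₂ ℝ ℝ) (B.restrictScalars₁₂ ℝ ℝ)
    (LinearMap.lsmul ℝ U) (fun x y z => by simp) hp h' h hr _ _ _).symm

/-- The one-form `dxʲ` has to pass the `p`-form `a`, whence the factor `(-1)^p`. -/
theorem alternateAt_wedgeAt_right {n : ℕ} (e : Module.Basis (Fin n) ℝ E)
    (B : V →ₗ[𝕜] W →ₗ[𝕜] U) {p q r q' r' : ℕ} (h : p + q = r) (hr : 1 + r = r') (hq : 1 + q = q')
    (h' : p + q' = r') (a : E [⋀^Fin p]→L[ℝ] V) (f : E → E [⋀^Fin q]→L[ℝ] W) :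
    alternateAt e hr (fun v => wedgeAt B h a (f v)) =
      (-1 : ℝ) ^ p • wedgeAt B h' a (alternateAt e hq f) := by
  rw [alternateAt, alternateAt, wedgeAt_sum_right, Finset.smul_sum]
  refine Finset.sum_congr rfl fun j _ => ?_
  rw [← wedgeAt_restrictScalars B, ← wedgeAt_restrictScalars B,
    ← wedgeAt_assoc (LinearMap.lsmul ℝ V) (B.restrictScalars₁₂ ℝ ℝ) (B.restrictScalars₁₂ ℝ ℝ)
      (LinearMap.lsmul ℝ U) (fun x y z => by simp) rfl (by omega) h hr,
    ← wedgeAt_assoc (LinearMap.lsmul ℝ V).flip (B.restrictScalars₁₂ ℝ ℝ) (LinearMap.lsmul ℝ W)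
      (B.restrictScalars₁₂ ℝ ℝ) (fun x y z => by simp) (Nat.add_comm p 1) (by omega) hq h',
    wedgeAt_comm (LinearMap.lsmul ℝ V) (LinearMap.lsmul ℝ V).flip (fun _ _ => rfl) rfl
      (Nat.add_comm p 1), wedgeAt_real_smul_left, one_mul]

/-- The exterior derivative within a set, as a sum of wedge products. -/
theorem extDerivWithin_eq_alternateAt {n : ℕ} (e : Module.Basis (Fin n) ℝ E) {p : ℕ}
    (h : 1 + p = p + 1) (θ : E → E [⋀^Fin p]→L[ℝ] V) (s : Set E) (y : E) :
    extDerivWithin θ s y = alternateAt e h (fderivWithin ℝ θ s y) :=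
  alternatizeUncurryFin_eq_alternateAt e h _

/-- The Leibniz rule for the local exterior derivative. -/
theorem alternateAt_fderivWithin_wedgeAt [FiniteDimensional ℝ V] [FiniteDimensional ℝ W] {n : ℕ}
    (e : Module.Basis (Fin n) ℝ E)
    (B : V →ₗ[𝕜] W →ₗ[𝕜] U) {p q r p' q' r' : ℕ} (h : p + q = r) (hr : 1 + r = r')
    (hp : 1 + p = p') (hq : 1 + q = q') (h₁ : p' + q = r') (h₂ : p + q' = r')
    {s : Set E} {y : E} (hs : UniqueDiffWithinAt ℝ s y)
    {a : E → E [⋀^Fin p]→L[ℝ] V} {b : E → E [⋀^Fin q]→L[ℝ] W}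
    (ha : DifferentiableWithinAt ℝ a s y) (hb : DifferentiableWithinAt ℝ b s y) :
    alternateAt e hr (fderivWithin ℝ (fun z => wedgeAt B h (a z) (b z)) s y) =
      wedgeAt B h₁ (alternateAt e hp (fderivWithin ℝ a s y)) (b y) +
        (-1 : ℝ) ^ p • wedgeAt B h₂ (a y) (alternateAt e hq (fderivWithin ℝ b s y)) := by
  have := (wedgeCLM (E := E) B h).fderivWithin_of_bilinear ha hb hs
  have h1 : (fderivWithin ℝ (fun z => wedgeAt B h (a z) (b z)) s y : E → _) = fun v =>
      wedgeAt B h (fderivWithin ℝ a s y v) (b y) + wedgeAt B h (a y) (fderivWithin ℝ b s y v) := by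
    funext v
    have := congrArg (fun f => f v) this
    refine this.trans ?_
    rw [add_comm]
    rfl
  rw [h1, alternateAt_add, alternateAt_wedgeAt_left e B h hr hp h₁,
    alternateAt_wedgeAt_right e B h hr hq h₂]

end Calculus

/-! ### Smooth dependence of the Hodge star on metric, orientation and form. -/

section Calculus

variable {E V : Type*} {X : Type*} [NormedAddCommGroup X] [NormedSpace ℝ X]
  [NormedAddCommGroup E] [NormedSpace ℝ E] [FiniteDimensional ℝ E]
  [NormedAddCommGroup V] [NormedSpace ℝ V]

/-- Expresses the dual basis through the inverse Gram matrix, whose entries are smooth in the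
metric. -/
theorem dualBasis_eq_sum {n : ℕ} (b : Module.Basis (Fin n) ℝ E) (g : LinearMap.BilinForm ℝ E)
    (hg : g.Nondegenerate) (i : Fin n) :
    g.dualBasis hg b i = ∑ j, (Matrix.of fun i j => g (b i) (b j))⁻¹ i j • b j := by
  have hM : LinearMap.BilinForm.toMatrix b g = Matrix.of fun i j => g (b i) (b j) := by
    ext i j; simp
  have hdet := (LinearMap.BilinForm.nondegenerate_iff_det_ne_zero b).1 hg
  rw [hM] at hdet
  have hinv := Matrix.nonsing_inv_mul _ (isUnit_iff_ne_zero.2 hdet)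
  rw [← sum_dualBasis_smul b g hg (∑ j, (Matrix.of fun i j => g (b i) (b j))⁻¹ i j • b j)]
  have hk : ∀ k, g (∑ j, (Matrix.of fun i j => g (b i) (b j))⁻¹ i j • b j) (b k) =
      (1 : Matrix (Fin n) (Fin n) ℝ) i k := by
    intro k
    rw [← hinv, Matrix.mul_apply, map_sum, LinearMap.sum_apply]
    simp
  simp only [hk, Matrix.one_apply, ite_smul, one_smul, zero_smul, Finset.sum_ite_eq,
    Finset.mem_univ, if_true]

theorem contDiffOn_det {n : ℕ} {N : ℕ∞ω} {s : Set X} {A : X → Matrix (Fin n) (Fin n) ℝ}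
    (hA : ∀ i j, ContDiffOn ℝ N (fun y => A y i j) s) : ContDiffOn ℝ N (fun y => (A y).det) s := by
  simp only [Matrix.det_apply]
  refine ContDiffOn.sum fun σ _ => ?_
  simp only [Units.smul_def, ← Int.cast_smul_eq_zsmul ℝ]
  exact ContDiffOn.const_smul _ (contDiffOn_prod fun i _ => hA _ _)

theorem contDiffOn_inv_apply {n : ℕ} {N : ℕ∞ω} {s : Set X} {A : X → Matrix (Fin n) (Fin n) ℝ}
    (hA : ∀ i j, ContDiffOn ℝ N (fun y => A y i j) s) (h0 : ∀ y ∈ s, (A y).det ≠ 0)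
    (i j : Fin n) : ContDiffOn ℝ N (fun y => (A y)⁻¹ i j) s := by
  simp only [Matrix.inv_def, Matrix.smul_apply, Ring.inverse_eq_inv', smul_eq_mul]
  refine ((contDiffOn_det hA).inv h0).mul ?_
  simp only [Matrix.adjugate_apply]
  refine contDiffOn_det fun k l => ?_
  simp only [Matrix.updateRow_apply]
  split_ifs
  · exact contDiffOn_const
  · exact hA _ _

/-- The sign of a non-vanishing continuous function is smooth. -/
theorem contDiffOn_sign {N : ℕ∞ω} {s : Set X} {f : X → ℝ} (hf : ContinuousOn f s)
    (h0 : ∀ y ∈ s, f y ≠ 0) : ContDiffOn ℝ N (fun y => (SignType.sign (f y) : ℝ)) s := by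
  intro y hy
  have : ∀ᶠ z in nhdsWithin y s, (SignType.sign (f z) : ℝ) = SignType.sign (f y) := by
    rcases lt_or_gt_of_ne (h0 y hy) with h | h
    · filter_upwards [(hf y hy).eventually (gt_mem_nhds h)] with z hz
      rw [sign_neg hz, sign_neg h]
    · filter_upwards [(hf y hy).eventually (lt_mem_nhds h)] with z hz
      rw [sign_pos hz, sign_pos h]
  exact contDiffWithinAt_const.congr_of_eventuallyEq this rfl

/-- In a fixed basis the values of the star are polynomial in the inverse Gram matrix, `√|det|`, the
sign of `τ` and the values of `θ`. The Gram determinant has no zero and the sign is locally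
constant, so all of these are smooth. Non-degeneracy is quantified pointwise in `hf` because the
star takes its proof as an argument. -/
theorem contDiffOn_hodgeAt [FiniteDimensional ℝ V] {p r n : ℕ} (h : p + r = n)
    (b : Module.Basis (Fin n) ℝ E) {s : Set X} {G : X → LinearMap.BilinForm ℝ E}
    (hG : ∀ i j, ContDiffOn ℝ ∞ (fun y => G y (b i) (b j)) s)
    {τ : X → E [⋀^Fin n]→L[ℝ] ℝ} (hτ : ContDiffOn ℝ ∞ τ s) (hτ0 : ∀ y ∈ s, τ y ≠ 0)
    {θ : X → E [⋀^Fin p]→L[ℝ] V} (hθ : ContDiffOn ℝ ∞ θ s) {f : X → E [⋀^Fin r]→L[ℝ] V}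
    (hf : ∀ y ∈ s, ∃ hg : (G y).Nondegenerate, f y = hodgeAt h b (G y) hg (τ y) (θ y)) :
    ContDiffOn ℝ ∞ f s := by
  refine contDiffOn_of_evalBasis b fun t => ?_
  set M : X → Matrix (Fin n) (Fin n) ℝ := fun y => Matrix.of fun i j => G y (b i) (b j) with hM
  have hMs : ∀ i j, ContDiffOn ℝ ∞ (fun y => M y i j) s := hG
  have hM0 : ∀ y ∈ s, (M y).det ≠ 0 := by
    intro y hy
    obtain ⟨hg, -⟩ := hf y hy
    have := (LinearMap.BilinForm.nondegenerate_iff_det_ne_zero b).1 hg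
    rwa [show LinearMap.BilinForm.toMatrix b (G y) = M y from by ext i j; simp [hM]] at this
  have key : ∀ y ∈ s, f y (fun i => b (t i)) = ((p.factorial : ℝ)⁻¹) • ∑ σ : Fin p → Fin n,
      (((SignType.sign (τ y b) : ℝ) * √|(M y).det|) *
        contractAt h b.det (fun i => b (σ i)) (fun i => b (t i))) •
        ∑ ρ : Fin p → Fin n, (∏ i, (M y)⁻¹ (σ i) (ρ i)) • θ y (fun i => b (ρ i)) := by
    intro y hy
    obtain ⟨hg, hfy⟩ := hf y hy
    rw [hfy, hodgeAt_apply]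
    congr 1
    refine Finset.sum_congr rfl fun σ _ => ?_
    congr 1
    simp only [dualBasis_eq_sum]
    change (θ y).toMultilinearMap _ = _
    rw [MultilinearMap.map_sum]
    refine Finset.sum_congr rfl fun ρ _ => ?_
    rw [MultilinearMap.map_smul_univ]
    rfl
  refine ContDiffOn.congr ?_ key
  have hτb : ContDiffOn ℝ ∞ (fun y => τ y b) s := contDiffOn_eval hτ b
  have hτb0 : ∀ y ∈ s, τ y b ≠ 0 := fun y hy h => hτ0 y hy (ext_top b (by simpa using h))
  have hdet : ContDiffOn ℝ ∞ (fun y => √|(M y).det|) s :=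
    ((contDiffOn_det hMs).abs hM0).sqrt fun y hy => abs_ne_zero.2 (hM0 y hy)
  refine ContDiffOn.const_smul _ (ContDiffOn.sum fun σ _ => ContDiffOn.smul ?_
    (ContDiffOn.sum fun ρ _ => ContDiffOn.smul
      (contDiffOn_prod fun i _ => contDiffOn_inv_apply hMs hM0 _ _) (contDiffOn_eval hθ _)))
  exact ((contDiffOn_sign hτb.continuousOn hτb0).mul hdet).mul contDiffOn_const

end Calculus

/-! ### Coordinate expressions of forms, exterior derivative, wedge product and star. -/

section Charts

variable {n : ℕ} {H : Type*} [TopologicalSpace H]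
  {I : ModelWithCorners ℝ (EuclideanSpace ℝ (Fin n)) H}
  {M : Type*} [TopologicalSpace M] [ChartedSpace H M] [IsManifold I ∞ M]
  {V W U : Type*} [NormedAddCommGroup V] [NormedSpace ℝ V]
  [NormedAddCommGroup W] [NormedSpace ℝ W] [NormedAddCommGroup U] [NormedSpace ℝ U]

/-- The standard basis of the model space. -/
abbrev stdBasis (n : ℕ) : Module.Basis (Fin n) ℝ (EuclideanSpace ℝ (Fin n)) :=
  (EuclideanSpace.basisFun (Fin n) ℝ).toBasis

theorem uniqueDiffWithinAt_of_mem_target {x₀ : M} {y : EuclideanSpace ℝ (Fin n)}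
    (hy : y ∈ (extChartAt I x₀).target) : UniqueDiffWithinAt ℝ (Set.range I) y :=
  I.uniqueDiffOn y (extChartAt_target_subset_range x₀ hy)

theorem exists_equiv_eq_mfderivWithin {x₀ : M} {y : EuclideanSpace ℝ (Fin n)}
    (hy : y ∈ (extChartAt I x₀).target) :
    ∃ L : EuclideanSpace ℝ (Fin n) ≃L[ℝ] TangentSpace I ((extChartAt I x₀).symm y),
      (L : EuclideanSpace ℝ (Fin n) →L[ℝ] TangentSpace I ((extChartAt I x₀).symm y)) =
        mfderivWithin 𝓘(ℝ, EuclideanSpace ℝ (Fin n)) I (extChartAt I x₀).symm (Set.range I) y :=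
  isInvertible_mfderivWithin_extChartAt_symm hy

/-- A form is recovered from its coordinate expression. -/
theorem inChart_comp_mfderiv {m : ℕ} (θ : NForm I M V m) {x₀ : M} {y : EuclideanSpace ℝ (Fin n)}
    (hy : y ∈ (extChartAt I x₀).target) :
    (inChart θ x₀ y).compContinuousLinearMap
      (mfderiv I 𝓘(ℝ, EuclideanSpace ℝ (Fin n)) (extChartAt I x₀) ((extChartAt I x₀).symm y)) =
    θ ((extChartAt I x₀).symm y) := by
  have := mfderivWithin_extChartAt_symm_comp_mfderiv_extChartAt hy
  refine ContinuousAlternatingMap.ext fun v => ?_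
  change (θ ((extChartAt I x₀).symm y)) _ = (θ ((extChartAt I x₀).symm y)) v
  congr 1
  funext i
  exact congrArg (fun f => f (v i)) this

theorem mfderiv_comp_mfderivWithin_symm (x₀ : M) {x₁ : M} {y : EuclideanSpace ℝ (Fin n)}
    (hy : y ∈ (extChartAt I x₁).target)
    (hy' : (extChartAt I x₁).symm y ∈ (extChartAt I x₀).source) :
    (mfderiv I 𝓘(ℝ, EuclideanSpace ℝ (Fin n)) (extChartAt I x₀) ((extChartAt I x₁).symm y)).comp
      (mfderivWithin 𝓘(ℝ, EuclideanSpace ℝ (Fin n)) I (extChartAt I x₁).symm (Set.range I) y) =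
    fderivWithin ℝ (extChartAt I x₀ ∘ (extChartAt I x₁).symm) (Set.range I) y := by
  rw [← mfderivWithin_eq_fderivWithin]
  refine (mfderiv_comp_mfderivWithin (I' := I) y ?_ ?_ ?_).symm
  · exact mdifferentiableAt_extChartAt ((extChartAt_source I x₀) ▸ hy')
  · exact mdifferentiableWithinAt_extChartAt_symm (I := I) (M := M) hy
  · exact (uniqueDiffWithinAt_of_mem_target (I := I) (M := M) hy).uniqueMDiffWithinAt

theorem eq_inChart_comp_mfderiv {m : ℕ} (θ : NForm I M V m) {x₀ x : M}
    (hx : x ∈ (extChartAt I x₀).source) :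
    θ x = (inChart θ x₀ (extChartAt I x₀ x)).compContinuousLinearMap
      (mfderiv I 𝓘(ℝ, EuclideanSpace ℝ (Fin n)) (extChartAt I x₀) x) := by
  obtain ⟨z, hz, rfl⟩ : ∃ z ∈ (extChartAt I x₀).target, (extChartAt I x₀).symm z = x :=
    ⟨_, (extChartAt I x₀).map_source hx, (extChartAt I x₀).left_inv hx⟩
  rw [(extChartAt I x₀).right_inv hz, inChart_comp_mfderiv θ hz]

/-- Change of coordinates. -/
theorem inChart_eq_comp {m : ℕ} (θ : NForm I M V m) (x₀ : M) {x₁ : M}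
    {y : EuclideanSpace ℝ (Fin n)} (hy : y ∈ (extChartAt I x₁).target)
    (hy' : (extChartAt I x₁).symm y ∈ (extChartAt I x₀).source) :
    inChart θ x₁ y = (inChart θ x₀ (extChartAt I x₀ ((extChartAt I x₁).symm y))).compContinuousLinearMap
      (fderivWithin ℝ (extChartAt I x₀ ∘ (extChartAt I x₁).symm) (Set.range I) y) := by
  rw [← mfderiv_comp_mfderivWithin_symm x₀ hy hy', inChart, eq_inChart_comp_mfderiv θ hy']
  rfl

theorem contDiffWithinAt_coordChange (x₀ : M) {x₁ : M}
    {y : EuclideanSpace ℝ (Fin n)} (hy : y ∈ (extChartAt I x₁).target)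
    (hy' : (extChartAt I x₁).symm y ∈ (extChartAt I x₀).source) :
    ContDiffWithinAt ℝ ∞ (extChartAt I x₀ ∘ (extChartAt I x₁).symm) (Set.range I) y :=
  contDiffWithinAt_ext_coord_change x₀ x₁ ⟨hy, hy'⟩

theorem eventually_mem_target {x₁ : M} {y : EuclideanSpace ℝ (Fin n)}
    (hy : y ∈ (extChartAt I x₁).target) :
    ∀ᶠ z in nhdsWithin y (Set.range I), z ∈ (extChartAt I x₁).target :=
  extChartAt_target_mem_nhdsWithin_of_mem hy

theorem eventually_symm_mem_source (x₀ : M) {x₁ : M} {y : EuclideanSpace ℝ (Fin n)}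
    (hy : y ∈ (extChartAt I x₁).target)
    (hy' : (extChartAt I x₁).symm y ∈ (extChartAt I x₀).source) :
    ∀ᶠ z in nhdsWithin y (Set.range I), (extChartAt I x₁).symm z ∈ (extChartAt I x₀).source :=
  (continuousAt_extChartAt_symm'' hy).continuousWithinAt.preimage_mem_nhdsWithin
    ((isOpen_extChartAt_source x₀).mem_nhds hy')

theorem NSmooth.differentiableWithinAt {m : ℕ} {θ : NForm I M V m} (hθ : NSmooth θ) {x₀ : M}
    {y : EuclideanSpace ℝ (Fin n)} (hy : y ∈ (extChartAt I x₀).target) :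
    DifferentiableWithinAt ℝ (inChart θ x₀) (Set.range I) y :=
  ((hθ x₀ y hy).differentiableWithinAt (by simp)).mono_of_mem_nhdsWithin
    (extChartAt_target_mem_nhdsWithin_of_mem hy)

/-- The coordinate expression of the exterior derivative. -/
theorem inChart_nd_eq_extDerivWithin {m : ℕ} {θ : NForm I M V m} (hθ : NSmooth θ) {x₀ : M}
    {y : EuclideanSpace ℝ (Fin n)} (hy : y ∈ (extChartAt I x₀).target) :
    inChart (nd θ) x₀ y = extDerivWithin (inChart θ x₀) (Set.range I) y := by
  -- `nd` at `x` is defined in the preferred chart at `x`, not the one at `x₀`. The two are compared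
  -- through the transition map, with whose pullback the exterior derivative commutes.
  set x := (extChartAt I x₀).symm y with hx
  have hyx : (extChartAt I x₀).symm y ∈ (extChartAt I x).source := mem_extChartAt_source x
  have h2 := mfderiv_comp_mfderivWithin_symm x hy hyx
  have hpull := extDerivWithin_pullback (s := Set.range I) (t := Set.range I)
    (f := extChartAt I x ∘ (extChartAt I x₀).symm) (x := y) (r := ∞)
    (hθ.differentiableWithinAt ((extChartAt I x).map_source hyx))
    (contDiffWithinAt_coordChange x hy hyx) (by simpa using WithTop.coe_le_coe.2 (le_top : (2 : ℕ∞) ≤ ⊤)) I.uniqueDiffOn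
    (I.range_subset_closure_interior (extChartAt_target_subset_range x₀ hy))
    (extChartAt_target_subset_range x₀ hy)
    (fun z _ => by simp [extChartAt, OpenPartialHomeomorph.extend])
  have hev : (fun z => (inChart θ x ((extChartAt I x ∘ (extChartAt I x₀).symm)
      z)).compContinuousLinearMap (fderivWithin ℝ (extChartAt I x ∘ (extChartAt I x₀).symm)
      (Set.range I) z)) =ᶠ[nhdsWithin y (Set.range I)] inChart θ x₀ := by
    filter_upwards [eventually_mem_target hy, eventually_symm_mem_source x hy hyx] with z hz hz'
    exact (inChart_eq_comp θ x hz hz').symm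
  rw [← hev.extDerivWithin_eq_of_mem (extChartAt_target_subset_range x₀ hy), hpull, ← h2]
  rfl

theorem inChart_nd {m m' : ℕ} (h : 1 + m = m') (h' : m + 1 = m') {θ : NForm I M V m}
    (hθ : NSmooth θ) {x₀ : M}
    {y : EuclideanSpace ℝ (Fin n)} (hy : y ∈ (extChartAt I x₀).target) :
    inChart (h' ▸ nd θ) x₀ y =
      alternateAt (stdBasis n) h (fderivWithin ℝ (inChart θ x₀) (Set.range I) y) := by
  subst h'
  rw [inChart_nd_eq_extDerivWithin hθ hy, extDerivWithin_eq_alternateAt (stdBasis n) h]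

theorem inChart_wedgeAt {𝕜 : Type*} [RCLike 𝕜] [Module 𝕜 V] [Module 𝕜 W] [Module 𝕜 U]
    [IsScalarTower ℝ 𝕜 V] [IsScalarTower ℝ 𝕜 W] [IsScalarTower ℝ 𝕜 U]
    (B : V →ₗ[𝕜] W →ₗ[𝕜] U) {p q r : ℕ} (h : p + q = r) (a : NForm I M V p) (b : NForm I M W q)
    (x₀ : M) (y : EuclideanSpace ℝ (Fin n)) :
    inChart (fun x => wedgeAt B h (a x) (b x)) x₀ y =
      wedgeAt B h (inChart a x₀ y) (inChart b x₀ y) :=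
  wedgeAt_comp B h _ _ _

/-- The metric in coordinates. -/
def chartMetric (g : PseudoRiemannianMetric I M) (x₀ : M) (y : EuclideanSpace ℝ (Fin n)) :
    LinearMap.BilinForm ℝ (EuclideanSpace ℝ (Fin n)) :=
  let A : EuclideanSpace ℝ (Fin n) →L[ℝ] TangentSpace I ((extChartAt I x₀).symm y) :=
    mfderivWithin 𝓘(ℝ, EuclideanSpace ℝ (Fin n)) I (extChartAt I x₀).symm (Set.range I) y
  (g.val ((extChartAt I x₀).symm y)).compl₁₂ (A : _ →ₗ[ℝ] _) (A : _ →ₗ[ℝ] _)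

theorem nondegenerate_compl₁₂ {T T' : Type*} [AddCommGroup T] [Module ℝ T] [AddCommGroup T']
    [Module ℝ T'] (g : LinearMap.BilinForm ℝ T) (hg : g.Nondegenerate) (L : T' ≃ₗ[ℝ] T) :
    LinearMap.BilinForm.Nondegenerate
      (g.compl₁₂ (L : T' →ₗ[ℝ] T) (L : T' →ₗ[ℝ] T) : LinearMap.BilinForm ℝ T') := by
  constructor
  · intro x hx
    have := hg.1 (L x) fun z => by simpa using hx (L.symm z)
    simpa using this
  · intro x hx
    have := hg.2 (L x) fun z => by simpa using hx (L.symm z)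
    simpa using this

/-- The derivative of the inverse chart is a linear isomorphism, so naturality of the star applies.
The existential supplies the non-degeneracy of the coordinate metric together with the identity that
mentions it. -/
theorem inChart_hodgeAt (g : PseudoRiemannianMetric I M) (τ : NForm I M ℝ n) {p r : ℕ}
    (h : p + r = n) (θ : NForm I M V p) (x₀ : M) {y : EuclideanSpace ℝ (Fin n)}
    (hy : y ∈ (extChartAt I x₀).target) :
    ∃ hg : (chartMetric g x₀ y).Nondegenerate,
      inChart (fun x => hodgeAt h (coordBasis x) (g.val x) (g.nondegenerate x) (τ x) (θ x)) x₀ y =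
        hodgeAt h (stdBasis n) (chartMetric g x₀ y) hg (inChart τ x₀ y) (inChart θ x₀ y) := by
  obtain ⟨L, hL⟩ := exists_equiv_eq_mfderivWithin (I := I) hy
  have hg' := nondegenerate_compl₁₂ (g.val ((extChartAt I x₀).symm y))
    (g.nondegenerate _) L.toLinearEquiv
  have key := hodgeAt_comp h (coordBasis ((extChartAt I x₀).symm y)) (stdBasis n) (g.val _)
    (g.nondegenerate _) (g.symm _) (τ _) (θ _) L hg'
  have hm : chartMetric g x₀ y = (g.val ((extChartAt I x₀).symm y)).compl₁₂
      (L.toLinearEquiv : EuclideanSpace ℝ (Fin n) →ₗ[ℝ] _)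
      (L.toLinearEquiv : EuclideanSpace ℝ (Fin n) →ₗ[ℝ] _) := by
    rw [chartMetric, ← hL]
    rfl
  refine ⟨hm ▸ hg', ?_⟩
  simp only [inChart, ← hL, hm]
  exact key

end Charts

/-! ### Algebra of forms of integer degree. -/

section FormAlgebra

variable {𝕜 : Type*} [RCLike 𝕜] {n : ℕ} {H : Type*} [TopologicalSpace H]
  {I : ModelWithCorners ℝ (EuclideanSpace ℝ (Fin n)) H}
  {M : Type*} [TopologicalSpace M] [ChartedSpace H M]
  {V W U V' W' : Type*} [NormedAddCommGroup V] [NormedSpace ℝ V]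
  [NormedAddCommGroup W] [NormedSpace ℝ W] [NormedAddCommGroup U] [NormedSpace ℝ U]
  [NormedAddCommGroup V'] [NormedSpace ℝ V'] [NormedAddCommGroup W'] [NormedSpace ℝ W']
  [Module 𝕜 V] [Module 𝕜 W] [Module 𝕜 U] [Module 𝕜 V'] [Module 𝕜 W']
  [IsScalarTower ℝ 𝕜 V] [IsScalarTower ℝ 𝕜 W] [IsScalarTower ℝ 𝕜 U]
  [IsScalarTower ℝ 𝕜 V'] [IsScalarTower ℝ 𝕜 W']
  {p q r s pq qs : ℤ}

theorem Form.ext {a b : Form I M V p} (h : ∀ (m : ℕ) (hm : (m : ℤ) = p) x, a ⟨m, hm⟩ x = b ⟨m, hm⟩ x) :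
    a = b := funext fun m => funext fun x => h m.1 m.2 x

theorem Form.eq_zero_of_neg (a : Form I M V p) (hp : p < 0) : a = 0 :=
  Form.ext fun m hm _ => absurd hm (by omega)

/-- Frees the product from `Int.toNat`: any natural representatives of the degrees may be used.
Identities of forms thus reduce to pointwise ones once the negative degrees, where the product is
zero, are set aside. -/
theorem wedge_apply (B : V →ₗ[𝕜] W →ₗ[𝕜] U) (a : Form I M V p) (b : Form I M W q) (h : p + q = r)
    {i j m : ℕ} (hi : (i : ℤ) = p) (hj : (j : ℤ) = q) (hm : (m : ℤ) = r) (hij : i + j = m) (x : M) :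
    wedge B a b h ⟨m, hm⟩ x = wedgeAt B hij (a ⟨i, hi⟩ x) (b ⟨j, hj⟩ x) := by
  subst hi hj
  have : (0 : ℤ) ≤ i ∧ (0 : ℤ) ≤ j := by omega
  unfold wedge
  rw [dif_pos this]
  rfl

theorem wedge_eq_zero_of_neg_left (B : V →ₗ[𝕜] W →ₗ[𝕜] U) (a : Form I M V p) (b : Form I M W q)
    (h : p + q = r) (hp : p < 0) : wedge B a b h = 0 := by
  funext m
  unfold wedge
  rw [dif_neg (by omega)]
  rfl

theorem wedge_eq_zero_of_neg_right (B : V →ₗ[𝕜] W →ₗ[𝕜] U) (a : Form I M V p) (b : Form I M W q)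
    (h : p + q = r) (hq : q < 0) : wedge B a b h = 0 := by
  funext m
  unfold wedge
  rw [dif_neg (by omega)]
  rfl

/-- Reduction of an identity for wedge products to natural degrees. -/
theorem exists_nat_degrees (hp : 0 ≤ p) (hq : 0 ≤ q) :
    ∃ i j : ℕ, (i : ℤ) = p ∧ (j : ℤ) = q :=
  ⟨p.toNat, q.toNat, by omega, by omega⟩

theorem wedge_congr (B : V →ₗ[𝕜] W →ₗ[𝕜] U) (B' : V' →ₗ[𝕜] W' →ₗ[𝕜] U) (h : p + q = r)
    {a : Form I M V p} {b : Form I M W q} {a' : Form I M V' p} {b' : Form I M W' q}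
    (hab : ∀ m m' x u w, B (a m x u) (b m' x w) = B' (a' m x u) (b' m' x w)) :
    wedge B a b h = wedge B' a' b' h := by
  rcases lt_or_ge p 0 with hp | hp
  · simp only [wedge_eq_zero_of_neg_left _ _ _ _ hp]
  rcases lt_or_ge q 0 with hq | hq
  · simp only [wedge_eq_zero_of_neg_right _ _ _ _ hq]
  obtain ⟨i, j, hi, hj⟩ := exists_nat_degrees hp hq
  refine Form.ext fun m hm x => ?_
  rw [wedge_apply B a b h hi hj hm (by omega), wedge_apply B' a' b' h hi hj hm (by omega)]
  exact wedgeAt_congr B B' _ fun u w => hab _ _ _ _ _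

theorem wedge_add_left (B : V →ₗ[𝕜] W →ₗ[𝕜] U) (a a' : Form I M V p) (b : Form I M W q)
    (h : p + q = r) : wedge B (a + a') b h = wedge B a b h + wedge B a' b h := by
  rcases lt_or_ge p 0 with hp | hp
  · simp only [wedge_eq_zero_of_neg_left _ _ _ _ hp, add_zero]
  rcases lt_or_ge q 0 with hq | hq
  · simp only [wedge_eq_zero_of_neg_right _ _ _ _ hq, add_zero]
  obtain ⟨i, j, hi, hj⟩ := exists_nat_degrees hp hq
  refine Form.ext fun m hm x => ?_
  simp only [Pi.add_apply]
  simp only [wedge_apply B _ _ h hi hj hm (show i + j = m by omega)]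
  exact wedgeAt_add_left B _ _ _ _

theorem wedge_add_right (B : V →ₗ[𝕜] W →ₗ[𝕜] U) (a : Form I M V p) (b b' : Form I M W q)
    (h : p + q = r) : wedge B a (b + b') h = wedge B a b h + wedge B a b' h := by
  rcases lt_or_ge p 0 with hp | hp
  · simp only [wedge_eq_zero_of_neg_left _ _ _ _ hp, add_zero]
  rcases lt_or_ge q 0 with hq | hq
  · simp only [wedge_eq_zero_of_neg_right _ _ _ _ hq, add_zero]
  obtain ⟨i, j, hi, hj⟩ := exists_nat_degrees hp hq
  refine Form.ext fun m hm x => ?_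
  simp only [Pi.add_apply]
  simp only [wedge_apply B _ _ h hi hj hm (show i + j = m by omega)]
  exact wedgeAt_add_right B _ _ _ _

theorem wedge_real_smul_left (B : V →ₗ[𝕜] W →ₗ[𝕜] U) (c : ℝ) (a : Form I M V p) (b : Form I M W q)
    (h : p + q = r) : wedge B (c • a) b h = c • wedge B a b h := by
  rcases lt_or_ge p 0 with hp | hp
  · simp only [wedge_eq_zero_of_neg_left _ _ _ _ hp, smul_zero]
  rcases lt_or_ge q 0 with hq | hq
  · simp only [wedge_eq_zero_of_neg_right _ _ _ _ hq, smul_zero]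
  obtain ⟨i, j, hi, hj⟩ := exists_nat_degrees hp hq
  refine Form.ext fun m hm x => ?_
  simp only [Pi.smul_apply]
  simp only [wedge_apply B _ _ h hi hj hm (show i + j = m by omega)]
  exact wedgeAt_real_smul_left B _ _ _ _

theorem wedge_real_smul_right (B : V →ₗ[𝕜] W →ₗ[𝕜] U) (c : ℝ) (a : Form I M V p) (b : Form I M W q)
    (h : p + q = r) : wedge B a (c • b) h = c • wedge B a b h := by
  rcases lt_or_ge p 0 with hp | hp
  · simp only [wedge_eq_zero_of_neg_left _ _ _ _ hp, smul_zero]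
  rcases lt_or_ge q 0 with hq | hq
  · simp only [wedge_eq_zero_of_neg_right _ _ _ _ hq, smul_zero]
  obtain ⟨i, j, hi, hj⟩ := exists_nat_degrees hp hq
  refine Form.ext fun m hm x => ?_
  simp only [Pi.smul_apply]
  simp only [wedge_apply B _ _ h hi hj hm (show i + j = m by omega)]
  exact wedgeAt_real_smul_right B _ _ _ _

theorem wedge_zero_left (B : V →ₗ[𝕜] W →ₗ[𝕜] U) (b : Form I M W q) (h : p + q = r) :
    wedge B (0 : Form I M V p) b h = 0 := by
  simpa using wedge_real_smul_left B 0 (0 : Form I M V p) b h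

theorem wedge_zero_right (B : V →ₗ[𝕜] W →ₗ[𝕜] U) (a : Form I M V p) (h : p + q = r) :
    wedge B a (0 : Form I M W q) h = 0 := by
  simpa using wedge_real_smul_right B 0 a (0 : Form I M W q) h

theorem wedge_neg_left (B : V →ₗ[𝕜] W →ₗ[𝕜] U) (a : Form I M V p) (b : Form I M W q)
    (h : p + q = r) : wedge B (-a) b h = -wedge B a b h := by
  simpa using wedge_real_smul_left B (-1) a b h

theorem wedge_neg_right (B : V →ₗ[𝕜] W →ₗ[𝕜] U) (a : Form I M V p) (b : Form I M W q)
    (h : p + q = r) : wedge B a (-b) h = -wedge B a b h := by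
  simpa using wedge_real_smul_right B (-1) a b h

theorem wedge_sub_left (B : V →ₗ[𝕜] W →ₗ[𝕜] U) (a a' : Form I M V p) (b : Form I M W q)
    (h : p + q = r) : wedge B (a - a') b h = wedge B a b h - wedge B a' b h := by
  rw [sub_eq_add_neg, wedge_add_left, wedge_neg_left, sub_eq_add_neg]

theorem wedge_sub_right (B : V →ₗ[𝕜] W →ₗ[𝕜] U) (a : Form I M V p) (b b' : Form I M W q)
    (h : p + q = r) : wedge B a (b - b') h = wedge B a b h - wedge B a b' h := by
  rw [sub_eq_add_neg, wedge_add_right, wedge_neg_right, sub_eq_add_neg]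

theorem wedge_smul_left [ContinuousConstSMul 𝕜 V] [SMulCommClass ℝ 𝕜 V]
    [ContinuousConstSMul 𝕜 W] [SMulCommClass ℝ 𝕜 W] (B : V →ₗ[𝕜] W →ₗ[𝕜] U) (c : 𝕜) (a : Form I M V p) (b : Form I M W q)
    (h : p + q = r) : wedge B (c • a) b h = wedge B a (c • b) h :=
  wedge_congr B B h fun m m' x u w => by
    change B (c • a m x u) (b m' x w) = B (a m x u) (c • b m' x w)
    simp

theorem wedge_mapForm_left (B : V →ₗ[𝕜] W →ₗ[𝕜] U) (B' : V' →ₗ[𝕜] W' →ₗ[𝕜] U) (f : V' →ₗ[𝕜] V)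
    (f' : W →ₗ[𝕜] W') (hf : ∀ v w, B (f v) w = B' v (f' w)) (a : Form I M V' p) (b : Form I M W q)
    (h : p + q = r) : wedge B (mapForm f a) b h = wedge B' a (mapForm f' b) h :=
  wedge_congr B B' h fun m m' x u w => hf _ _

theorem wedge_comm (B : V →ₗ[𝕜] W →ₗ[𝕜] U) (B' : W →ₗ[𝕜] V →ₗ[𝕜] U) (hB : ∀ v w, B v w = B' w v)
    (a : Form I M V p) (b : Form I M W q) (h : p + q = r) :
    wedge B a b h = (-1 : ℝ) ^ (p * q) • wedge B' b a (by omega) := by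
  rcases lt_or_ge p 0 with hp | hp
  · rw [wedge_eq_zero_of_neg_left _ _ _ _ hp, wedge_eq_zero_of_neg_right _ _ _ _ hp, smul_zero]
  rcases lt_or_ge q 0 with hq | hq
  · rw [wedge_eq_zero_of_neg_left _ _ _ _ hq, wedge_eq_zero_of_neg_right _ _ _ _ hq, smul_zero]
  obtain ⟨i, j, hi, hj⟩ := exists_nat_degrees hp hq
  refine Form.ext fun m hm x => ?_
  simp only [Pi.smul_apply]
  rw [wedge_apply B a b h hi hj hm (by omega), wedge_apply B' b a _ hj hi hm (by omega),
    wedgeAt_comm B B' hB _ (by omega)]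
  have : (-1 : ℝ) ^ (i * j) = (-1) ^ (p * q) := by
    rw [← hi, ← hj]
    norm_cast
  rw [this]

theorem wedge_assoc {V₁ V₂ V₃ V₁₂ V₂₃ : Type*}
    [NormedAddCommGroup V₁] [NormedSpace ℝ V₁] [NormedAddCommGroup V₂] [NormedSpace ℝ V₂]
    [NormedAddCommGroup V₃] [NormedSpace ℝ V₃] [NormedAddCommGroup V₁₂] [NormedSpace ℝ V₁₂]
    [NormedAddCommGroup V₂₃] [NormedSpace ℝ V₂₃]
    [Module 𝕜 V₁] [Module 𝕜 V₂] [Module 𝕜 V₃] [Module 𝕜 V₁₂] [Module 𝕜 V₂₃]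
    [IsScalarTower ℝ 𝕜 V₁] [IsScalarTower ℝ 𝕜 V₂] [IsScalarTower ℝ 𝕜 V₃] [IsScalarTower ℝ 𝕜 V₁₂]
    [IsScalarTower ℝ 𝕜 V₂₃]
    (B₁ : V₁ →ₗ[𝕜] V₂ →ₗ[𝕜] V₁₂) (B₂ : V₁₂ →ₗ[𝕜] V₃ →ₗ[𝕜] U)
    (C₁ : V₂ →ₗ[𝕜] V₃ →ₗ[𝕜] V₂₃) (C₂ : V₁ →ₗ[𝕜] V₂₃ →ₗ[𝕜] U)
    (hB : ∀ x y z, B₂ (B₁ x y) z = C₂ x (C₁ y z))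
    (a : Form I M V₁ p) (b : Form I M V₂ q) (c : Form I M V₃ s)
    (h₁ : p + q = pq) (h₂ : pq + s = r) (h₃ : q + s = qs) (h₄ : p + qs = r) :
    wedge B₂ (wedge B₁ a b h₁) c h₂ = wedge C₂ a (wedge C₁ b c h₃) h₄ := by
  rcases lt_or_ge p 0 with hp | hp
  · rw [wedge_eq_zero_of_neg_left _ _ _ h₁ hp, wedge_zero_left, wedge_eq_zero_of_neg_left _ _ _ _ hp]
  rcases lt_or_ge q 0 with hq | hq
  · rw [wedge_eq_zero_of_neg_right _ _ _ h₁ hq, wedge_zero_left,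
      wedge_eq_zero_of_neg_left _ _ _ h₃ hq, wedge_zero_right]
  rcases lt_or_ge s 0 with hs | hs
  · rw [wedge_eq_zero_of_neg_right _ _ _ _ hs, wedge_eq_zero_of_neg_right _ _ _ h₃ hs,
      wedge_zero_right]
  obtain ⟨i, j, hi, hj⟩ := exists_nat_degrees hp hq
  obtain ⟨l, -, hl, -⟩ := exists_nat_degrees hs hs
  refine Form.ext fun m hm x => ?_
  have e1 : ((i + j : ℕ) : ℤ) = pq := by push_cast; omega
  have e2 : ((j + l : ℕ) : ℤ) = qs := by push_cast; omega
  rw [wedge_apply B₂ _ c h₂ e1 hl hm (by omega), wedge_apply B₁ a b h₁ hi hj e1 rfl,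
    wedge_apply C₂ a _ h₄ hi e2 hm (by omega), wedge_apply C₁ b c h₃ hj hl e2 rfl]
  exact wedgeAt_assoc B₁ B₂ C₁ C₂ hB _ _ _ _ _ _ _

/-! ### The Hodge star -/

variable (g : PseudoRiemannianMetric I M) (o : OrientationForm I M)

theorem star_apply (a : Form I M V p) (h : p + r = n) {i m : ℕ} (hi : (i : ℤ) = p) (hm : (m : ℤ) = r)
    (him : i + m = n) (x : M) :
    star g o a h ⟨m, hm⟩ x = hodgeAt him (coordBasis x) (g.val x) (g.nondegenerate x) (o.τ x)
      (a ⟨i, hi⟩ x) := by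
  subst hi
  have : (0 : ℤ) ≤ i := by omega
  unfold star
  rw [dif_pos this]
  rfl

theorem star_eq_zero_of_neg (a : Form I M V p) (h : p + r = n) (hp : p < 0) :
    star g o a h = 0 := by
  funext m
  unfold star
  rw [dif_neg (by omega)]
  rfl

theorem star_add (a b : Form I M V p) (h : p + r = n) :
    star g o (a + b) h = star g o a h + star g o b h := by
  rcases lt_or_ge p 0 with hp | hp
  · simp only [star_eq_zero_of_neg g o _ h hp, add_zero]
  obtain ⟨i, -, hi, -⟩ := exists_nat_degrees hp hp
  refine Form.ext fun m hm x => ?_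
  simp only [Pi.add_apply]
  simp only [star_apply g o _ h hi hm (by omega)]
  exact hodgeAt_add _ _ _ _ _ _ _

theorem star_real_smul (c : ℝ) (a : Form I M V p) (h : p + r = n) :
    star g o (c • a) h = c • star g o a h := by
  rcases lt_or_ge p 0 with hp | hp
  · simp only [star_eq_zero_of_neg g o _ h hp, smul_zero]
  obtain ⟨i, -, hi, -⟩ := exists_nat_degrees hp hp
  refine Form.ext fun m hm x => ?_
  simp only [Pi.smul_apply]
  simp only [star_apply g o _ h hi hm (by omega)]
  exact hodgeAt_smul _ _ _ _ _ _ _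

theorem star_zero (h : p + r = n) : star g o (0 : Form I M V p) h = 0 := by
  simpa using star_real_smul g o 0 (0 : Form I M V p) h

theorem wedge_star_comm (B : V →ₗ[𝕜] V →ₗ[𝕜] U) (hB : ∀ x y, B x y = B y x) (a b : Form I M V p)
    (h : p + r = n) (h' : p + r = s) :
    wedge B a (star g o b h) h' = wedge B b (star g o a h) h' := by
  rcases lt_or_ge p 0 with hp | hp
  · simp only [wedge_eq_zero_of_neg_left _ _ _ _ hp]
  rcases lt_or_ge r 0 with hr | hr
  · simp only [wedge_eq_zero_of_neg_right _ _ _ _ hr]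
  obtain ⟨i, j, hi, hj⟩ := exists_nat_degrees hp hr
  have hij : i + j = n := by omega
  refine Form.ext fun m hm x => ?_
  obtain rfl : m = n := by omega
  rw [wedge_apply B _ _ h' hi hj hm hij, wedge_apply B _ _ h' hi hj hm hij,
    star_apply g o _ h hi hj hij, star_apply g o _ h hi hj hij]
  exact wedgeAt_hodgeAt_comm B hB _ _ _ _ (g.symm x) _ _ _

theorem eq_zero_of_finrank_lt {T : Type*} [AddCommGroup T] [Module ℝ T] [TopologicalSpace T]
    [FiniteDimensional ℝ T] {m : ℕ} (hm : Module.finrank ℝ T < m) (f : T [⋀^Fin m]→L[ℝ] V) :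
    f = 0 := by
  ext v
  refine f.toAlternatingMap.map_linearDependent v fun hv => ?_
  have := hv.fintype_card_le_finrank
  simp at this
  omega

theorem star_eq_zero_iff [FiniteDimensional ℝ V] (a : Form I M V p) (h : p + r = n) :
    star g o a h = 0 ↔ a = 0 := by
  refine ⟨fun ha => Form.ext fun i hi x => ?_, fun ha => by rw [ha, star_zero]⟩
  -- In degree above `n` the star lands in negative degree and carries no information, but there the
  -- form vanishes for dimension reasons. In degree at most `n` the pointwise star is injective.
  rcases lt_or_ge n i with hn | hn
  · refine eq_zero_of_finrank_lt ?_ _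
    rwa [show Module.finrank ℝ (TangentSpace I x) = n from finrank_euclideanSpace_fin]
  · have hm : ((n - i : ℕ) : ℤ) = r := by omega
    have := congrFun (congrFun ha ⟨n - i, hm⟩) x
    rw [star_apply g o a h hi hm (by omega)] at this
    exact hodgeAt_eq_zero _ _ _ _ (o.ne_zero x) _ this

end FormAlgebra

theorem alternateAt_smul {E V : Type*} [NormedAddCommGroup E] [NormedSpace ℝ E]
    [FiniteDimensional ℝ E] [NormedAddCommGroup V] [NormedSpace ℝ V] {n : ℕ}
    (b : Module.Basis (Fin n) ℝ E) {p r : ℕ} (h : 1 + p = r) (c : ℝ)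
    (f : E → E [⋀^Fin p]→L[ℝ] V) :
    alternateAt b h (fun v => c • f v) = c • alternateAt b h f := by
  simp only [alternateAt, wedgeAt_real_smul_right, Finset.smul_sum]

/-! ### Smooth forms on the manifold, linearity of `d` and the Leibniz rule. -/

section FormCalculus

variable {𝕜 : Type*} [RCLike 𝕜] {n : ℕ} {H : Type*} [TopologicalSpace H]
  {I : ModelWithCorners ℝ (EuclideanSpace ℝ (Fin n)) H}
  {M : Type*} [TopologicalSpace M] [ChartedSpace H M] [IsManifold I ∞ M]
  {V W U : Type*} [NormedAddCommGroup V] [NormedSpace ℝ V]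
  [NormedAddCommGroup W] [NormedSpace ℝ W] [NormedAddCommGroup U] [NormedSpace ℝ U]
  [Module 𝕜 V] [Module 𝕜 W] [Module 𝕜 U]
  [IsScalarTower ℝ 𝕜 V] [IsScalarTower ℝ 𝕜 W] [IsScalarTower ℝ 𝕜 U]
  [FiniteDimensional ℝ V] [FiniteDimensional ℝ W] [FiniteDimensional ℝ U]
  {p q r s : ℤ} {m : ℕ}

theorem nform_eq_of_inChart {a b : NForm I M V m}
    (h : ∀ x₀, ∀ y ∈ (extChartAt I x₀).target, inChart a x₀ y = inChart b x₀ y) : a = b := by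
  funext x
  have hx := mem_extChartAt_source (I := I) x
  rw [eq_inChart_comp_mfderiv a hx, eq_inChart_comp_mfderiv b hx,
    h x _ ((extChartAt I x).map_source hx)]

theorem inChart_add (a b : NForm I M V m) (x₀ : M) (y : EuclideanSpace ℝ (Fin n)) :
    inChart (a + b) x₀ y = inChart a x₀ y + inChart b x₀ y := rfl

theorem inChart_real_smul (c : ℝ) (a : NForm I M V m) (x₀ : M) (y : EuclideanSpace ℝ (Fin n)) :
    inChart (c • a) x₀ y = c • inChart a x₀ y := rfl

theorem NSmooth.add {a b : NForm I M V m} (ha : NSmooth a) (hb : NSmooth b) : NSmooth (a + b) :=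
  fun x₀ => (ha x₀).add (hb x₀)

theorem NSmooth.real_smul (c : ℝ) {a : NForm I M V m} (ha : NSmooth a) : NSmooth (c • a) :=
  fun x₀ => (ha x₀).const_smul c

theorem Smooth.add {a b : Form I M V p} (ha : Smooth a) (hb : Smooth b) : Smooth (a + b) :=
  fun m => (ha m).add (hb m)

theorem Smooth.real_smul (c : ℝ) {a : Form I M V p} (ha : Smooth a) : Smooth (c • a) :=
  fun m => (ha m).real_smul c

theorem Smooth.zero : Smooth (0 : Form I M V p) := fun m x₀ => contDiffOn_const (c := 0)

theorem Smooth.neg {a : Form I M V p} (ha : Smooth a) : Smooth (-a) := by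
  simpa using ha.real_smul (-1)

theorem Smooth.sub {a b : Form I M V p} (ha : Smooth a) (hb : Smooth b) : Smooth (a - b) := by
  simpa [sub_eq_add_neg] using ha.add hb.neg

theorem Smooth.mapForm (f : V →ₗ[𝕜] W) {a : Form I M V p} (ha : Smooth a) :
    Smooth (mapForm f a) := fun m x₀ =>
  contDiffOn_of_evalBasis (stdBasis n) fun t =>
    (LinearMap.toContinuousLinearMap (f.restrictScalars ℝ)).contDiff.comp_contDiffOn
      (contDiffOn_eval (ha m x₀) fun i => stdBasis n (t i))

theorem Smooth.smul [ContinuousConstSMul 𝕜 V] [SMulCommClass ℝ 𝕜 V] (c : 𝕜) {a : Form I M V p}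
    (ha : Smooth a) : Smooth (c • a) := by
  have : c • a = GYM.mapForm (c • LinearMap.id : V →ₗ[𝕜] V) a := by
    refine Form.ext fun m hm x => ContinuousAlternatingMap.ext fun v => ?_
    rfl
  rw [this]
  exact ha.mapForm _

theorem Smooth.wedge (B : V →ₗ[𝕜] W →ₗ[𝕜] U) {a : Form I M V p} {b : Form I M W q}
    (ha : Smooth a) (hb : Smooth b) (h : p + q = r) : Smooth (wedge B a b h) := by
  rcases lt_or_ge p 0 with hp | hp
  · rw [wedge_eq_zero_of_neg_left _ _ _ _ hp]
    exact Smooth.zero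
  rcases lt_or_ge q 0 with hq | hq
  · rw [wedge_eq_zero_of_neg_right _ _ _ _ hq]
    exact Smooth.zero
  obtain ⟨i, j, hi, hj⟩ := exists_nat_degrees hp hq
  rintro ⟨m, hm⟩ x₀
  have : GYM.wedge B a b h ⟨m, hm⟩ = fun x => wedgeAt B (show i + j = m by omega)
    (a ⟨i, hi⟩ x) (b ⟨j, hj⟩ x) := funext fun x => wedge_apply B a b h hi hj hm _ x
  rw [this]
  exact (contDiffOn_wedgeAt B _ (ha _ x₀) (hb _ x₀)).congr fun y _ => inChart_wedgeAt B _ _ _ _ _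

/-- The coordinate expression of the exterior derivative. -/
theorem inChart_d {a : Form I M V p} (ha : Smooth a) (h : p + 1 = r) {i m : ℕ} (hi : (i : ℤ) = p)
    (hm : (m : ℤ) = r) (him : 1 + i = m) {x₀ : M} {y : EuclideanSpace ℝ (Fin n)}
    (hy : y ∈ (extChartAt I x₀).target) :
    inChart (d a h ⟨m, hm⟩) x₀ y =
      alternateAt (stdBasis n) him (fderivWithin ℝ (inChart (a ⟨i, hi⟩) x₀) (Set.range I) y) := by
  obtain rfl : m = i + 1 := by omega
  exact inChart_nd him rfl (ha ⟨i, hi⟩) hy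

theorem contDiffOn_fderivWithin_inChart {a : NForm I M V m} (ha : NSmooth a) (x₀ : M) :
    ContDiffOn ℝ ∞ (fderivWithin ℝ (inChart a x₀) (Set.range I)) (extChartAt I x₀).target := by
  intro y hy
  have h1 : ContDiffWithinAt ℝ ∞ (inChart a x₀) (Set.range I) y :=
    (ha x₀ y hy).mono_of_mem_nhdsWithin (extChartAt_target_mem_nhdsWithin_of_mem hy)
  exact (h1.fderivWithin_right I.uniqueDiffOn (by simp)
    (extChartAt_target_subset_range x₀ hy)).mono (extChartAt_target_subset_range x₀)

theorem Smooth.d {a : Form I M V p} (ha : Smooth a) (h : p + 1 = r) : Smooth (d a h) := by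
  rintro ⟨m, hm⟩ x₀
  rcases m with - | i
  · exact contDiffOn_const (c := 0)
  · have hi : (i : ℤ) = p := by push_cast at hm; omega
    refine ContDiffOn.congr ?_ fun y hy =>
      inChart_d ha h hi hm (Nat.add_comm 1 i) hy
    refine ContDiffOn.sum fun j _ => contDiffOn_wedgeAt _ _ contDiffOn_const ?_
    exact (contDiffOn_fderivWithin_inChart (ha ⟨i, hi⟩) x₀).clm_apply contDiffOn_const

theorem Smooth.star (g : PseudoRiemannianMetric I M) (o : OrientationForm I M) {a : Form I M V p}
    (ha : Smooth a) (h : p + r = n) : Smooth (star g o a h) := by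
  rcases lt_or_ge p 0 with hp | hp
  · rw [star_eq_zero_of_neg _ _ _ _ hp]
    exact Smooth.zero
  obtain ⟨i, -, hi, -⟩ := exists_nat_degrees hp hp
  rintro ⟨m, hm⟩ x₀
  have him : i + m = n := by omega
  have : GYM.star g o a h ⟨m, hm⟩ = fun x => hodgeAt him (coordBasis x) (g.val x)
      (g.nondegenerate x) (o.τ x) (a ⟨i, hi⟩ x) := funext fun x => star_apply g o a h hi hm _ x
  rw [this]
  refine contDiffOn_hodgeAt him (stdBasis n) (fun i j => g.smooth x₀ _ _) (o.smooth x₀) ?_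
    (ha ⟨i, hi⟩ x₀) fun y hy => inChart_hodgeAt g o.τ him _ x₀ hy
  intro y hy h0
  have := inChart_comp_mfderiv o.τ hy
  rw [h0] at this
  exact o.ne_zero _ this.symm

theorem d_add {a b : Form I M V p} (ha : Smooth a) (hb : Smooth b) (h : p + 1 = r) :
    d (a + b) h = d a h + d b h := by
  funext ⟨m, hm⟩
  -- A derivative of degree zero comes from a form of degree `-1` and is zero by definition.
  rcases m with - | i
  · exact (add_zero (0 : NForm I M V 0)).symm
  · have hi : (i : ℤ) = p := by push_cast at hm; omega
    refine nform_eq_of_inChart fun x₀ y hy => ?_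
    rw [Pi.add_apply, inChart_add]
    rw [inChart_d (ha.add hb) h hi hm (Nat.add_comm 1 i) hy,
      inChart_d ha h hi hm (Nat.add_comm 1 i) hy, inChart_d hb h hi hm (Nat.add_comm 1 i) hy,
      ← alternateAt_add]
    congr 1
    have hu := uniqueDiffWithinAt_of_mem_target (I := I) (M := M) hy
    have := fderivWithin_add hu ((ha ⟨i, hi⟩).differentiableWithinAt hy)
      ((hb ⟨i, hi⟩).differentiableWithinAt hy)
    exact congrArg DFunLike.coe this

theorem d_real_smul (c : ℝ) {a : Form I M V p} (ha : Smooth a) (h : p + 1 = r) :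
    d (c • a) h = c • d a h := by
  funext ⟨m, hm⟩
  rcases m with - | i
  · exact (smul_zero (A := NForm I M V 0) c).symm
  · have hi : (i : ℤ) = p := by push_cast at hm; omega
    refine nform_eq_of_inChart fun x₀ y hy => ?_
    rw [Pi.smul_apply, inChart_real_smul]
    rw [inChart_d (ha.real_smul c) h hi hm (Nat.add_comm 1 i) hy,
      inChart_d ha h hi hm (Nat.add_comm 1 i) hy, ← alternateAt_smul]
    congr 1
    have hu := uniqueDiffWithinAt_of_mem_target (I := I) (M := M) hy
    have := fderivWithin_const_smul hu ((ha ⟨i, hi⟩).differentiableWithinAt hy) c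
    exact congrArg DFunLike.coe this

theorem d_zero (h : p + 1 = r) : d (0 : Form I M V p) h = 0 := by
  simpa using d_real_smul 0 (Smooth.zero (I := I) (M := M) (V := V)) h

theorem d_neg {a : Form I M V p} (ha : Smooth a) (h : p + 1 = r) : d (-a) h = -d a h := by
  simpa using d_real_smul (-1) ha h

/-- The Leibniz rule. -/
theorem d_wedge (B : V →ₗ[𝕜] W →ₗ[𝕜] U) {a : Form I M V p} {b : Form I M W q}
    (ha : Smooth a) (hb : Smooth b) {p' q' r' : ℤ} (h : p + q = r) (hr : r + 1 = r')
    (hp' : p + 1 = p') (hq' : q + 1 = q') (h₁ : p' + q = r') (h₂ : p + q' = r') :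
    d (wedge B a b h) hr = wedge B (d a hp') b h₁ + (-1 : ℝ) ^ p • wedge B a (d b hq') h₂ := by
  rcases lt_or_ge p 0 with hp | hp
  · obtain rfl := a.eq_zero_of_neg hp
    simp only [d_zero, wedge_zero_left, smul_zero, add_zero]
  rcases lt_or_ge q 0 with hq | hq
  · obtain rfl := b.eq_zero_of_neg hq
    simp only [d_zero, wedge_zero_right, smul_zero, add_zero]
  obtain ⟨i, j, hi, hj⟩ := exists_nat_degrees hp hq
  funext ⟨m, hm⟩
  obtain ⟨l, rfl⟩ : ∃ l, m = l + 1 := ⟨m - 1, by omega⟩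
  have hl : (l : ℤ) = r := by push_cast at hm; omega
  have hi' : ((i + 1 : ℕ) : ℤ) = p' := by push_cast; omega
  have hj' : ((j + 1 : ℕ) : ℤ) = q' := by push_cast; omega
  refine nform_eq_of_inChart fun x₀ y hy => ?_
  have e0 : wedge B a b h ⟨l, hl⟩ = fun x => wedgeAt B (show i + j = l by omega)
    (a ⟨i, hi⟩ x) (b ⟨j, hj⟩ x) := funext fun x => wedge_apply B a b h hi hj hl _ x
  have e1 : wedge B (d a hp') b h₁ ⟨l + 1, hm⟩ = fun x => wedgeAt B (show i + 1 + j = l + 1 by omega)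
    (d a hp' ⟨i + 1, hi'⟩ x) (b ⟨j, hj⟩ x) := funext fun x => wedge_apply B _ b h₁ hi' hj hm _ x
  have e2 : wedge B a (d b hq') h₂ ⟨l + 1, hm⟩ = fun x =>
    wedgeAt B (show i + (j + 1) = l + 1 by omega) (a ⟨i, hi⟩ x) (d b hq' ⟨j + 1, hj'⟩ x) :=
    funext fun x => wedge_apply B a _ h₂ hi hj' hm _ x
  have e3 : inChart (wedge B a b h ⟨l, hl⟩) x₀ = fun z => wedgeAt B (show i + j = l by omega)
      (inChart (a ⟨i, hi⟩) x₀ z) (inChart (b ⟨j, hj⟩) x₀ z) := by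
    rw [e0]
    exact funext fun z => inChart_wedgeAt B _ _ _ _ _
  rw [Pi.add_apply, Pi.smul_apply, inChart_add, inChart_real_smul, e1, e2, inChart_wedgeAt,
    inChart_wedgeAt, inChart_d (ha.wedge B hb h) hr hl hm (Nat.add_comm 1 l) hy,
    inChart_d ha hp' hi hi' (Nat.add_comm 1 i) hy, inChart_d hb hq' hj hj' (Nat.add_comm 1 j) hy,
    e3, show (-1 : ℝ) ^ p = (-1 : ℝ) ^ i by rw [← hi, zpow_natCast]]
  exact alternateAt_fderivWithin_wedgeAt (stdBasis n) B _ _ _ _ _ _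
    (uniqueDiffWithinAt_of_mem_target (I := I) (M := M) hy)
    ((ha ⟨i, hi⟩).differentiableWithinAt hy) ((hb ⟨j, hj⟩).differentiableWithinAt hy)

end FormCalculus

/-- A top form is its value on the basis times the determinant form. This produces the Jacobian in
the change of variables. -/
theorem comp_basis_eq_det_smul {T V : Type*} [NormedAddCommGroup T] [NormedSpace ℝ T]
    [NormedAddCommGroup V] [NormedSpace ℝ V] {n : ℕ} (b : Module.Basis (Fin n) ℝ T)
    (f : T [⋀^Fin n]→L[ℝ] V) (L : T →L[ℝ] T) :
    f.compContinuousLinearMap L b = L.det • f b := by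
  have : FiniteDimensional ℝ T := b.finiteDimensional_of_finite
  have h1 : f = toCAM ((LinearMap.toSpanSingleton ℝ V (f b)).compAlternatingMap b.det) := by
    refine ext_top b ?_
    simp [b.det_self]
  have h2 : f.compContinuousLinearMap L b = b.det ((L : T →ₗ[ℝ] T) ∘ b) • f b := by
    conv_lhs => rw [h1]
    rfl
  rw [h2, Module.Basis.det_comp, b.det_self, mul_one]

/-! ### Densities in charts and independence of the chart. -/

section Integration

open MeasureTheory

variable {n : ℕ} {H : Type*} [TopologicalSpace H]
  {I : ModelWithCorners ℝ (EuclideanSpace ℝ (Fin n)) H}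
  {M : Type*} [TopologicalSpace M] [ChartedSpace H M] [IsManifold I ∞ M]
  {V : Type*} [NormedAddCommGroup V] [NormedSpace ℝ V] [FiniteDimensional ℝ V]
  {m : ℕ}

/-- The form vanishes outside the set `K`. -/
def NSupp (K : Set M) (θ : NForm I M V m) : Prop := ∀ x ∉ K, θ x = 0

/-- The product of a function and a form. -/
def fmul (f : M → ℝ) (θ : NForm I M V m) : NForm I M V m := fun x => f x • θ x

theorem inChart_fmul (f : M → ℝ) (θ : NForm I M V m) (x₀ : M) (y : EuclideanSpace ℝ (Fin n)) :
    inChart (fmul f θ) x₀ y = f ((extChartAt I x₀).symm y) • inChart θ x₀ y := rfl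

theorem NSupp.inChart_eq_zero {K : Set M} {θ : NForm I M V m} (hθ : NSupp K θ) (x₀ : M)
    {y : EuclideanSpace ℝ (Fin n)} (hy : (extChartAt I x₀).symm y ∉ K) : inChart θ x₀ y = 0 := by
  rw [inChart, hθ _ hy]
  rfl

theorem NSmooth.fmul {f : M → ℝ} (hf : ContMDiff I 𝓘(ℝ) ∞ f) {θ : NForm I M V m}
    (hθ : NSmooth θ) : NSmooth (fmul f θ) := fun x₀ =>
  ((hf.comp_contMDiffOn (contMDiffOn_extChartAt_symm x₀)).contDiffOn).smul (hθ x₀)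

theorem measurableSet_extChartAt_target (x₀ : M) : MeasurableSet (extChartAt I x₀).target := by
  rw [extChartAt_target]
  exact ((chartAt H x₀).open_target.preimage I.continuous_symm).measurableSet.inter
    I.isClosed_range.measurableSet

/-- The density `± θ(e₁, …, e_n)` of a form of top degree in the chart at `x₀`. -/
def chartDensity (o : OrientationForm I M) (θ : NForm I M V n) (x₀ : M)
    (y : EuclideanSpace ℝ (Fin n)) : V :=
  (SignType.sign (inChart o.τ x₀ y (stdBasis n)) : ℝ) • inChart θ x₀ y (stdBasis n)

theorem chartDensity_fmul (o : OrientationForm I M) (f : M → ℝ) (θ : NForm I M V n) (x₀ : M)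
    (y : EuclideanSpace ℝ (Fin n)) :
    chartDensity o (fmul f θ) x₀ y = f ((extChartAt I x₀).symm y) • chartDensity o θ x₀ y := by
  rw [chartDensity, inChart_fmul, ContinuousAlternatingMap.smul_apply, smul_comm, chartDensity]

theorem chartDensity_add (o : OrientationForm I M) (θ θ' : NForm I M V n) (x₀ : M)
    (y : EuclideanSpace ℝ (Fin n)) :
    chartDensity o (θ + θ') x₀ y = chartDensity o θ x₀ y + chartDensity o θ' x₀ y := by
  rw [chartDensity, inChart_add, ContinuousAlternatingMap.add_apply, smul_add]
  rfl

theorem NSupp.chartDensity_eq_zero {K : Set M} (o : OrientationForm I M) {θ : NForm I M V n}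
    (hθ : NSupp K θ) (x₀ : M)
    {y : EuclideanSpace ℝ (Fin n)} (hy : (extChartAt I x₀).symm y ∉ K) :
    chartDensity o θ x₀ y = 0 := by
  rw [chartDensity, hθ.inChart_eq_zero x₀ hy]
  exact smul_zero _

theorem contDiffOn_sign_inChart (o : OrientationForm I M) (x₀ : M) :
    ContDiffOn ℝ ∞ (fun y => (SignType.sign (inChart o.τ x₀ y (stdBasis n)) : ℝ))
      (extChartAt I x₀).target := by
  refine contDiffOn_sign (contDiffOn_eval (o.smooth x₀) _).continuousOn fun y hy h => ?_
  have h0 : inChart o.τ x₀ y = 0 := ext_top (stdBasis n) (by simpa using h)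
  have := inChart_comp_mfderiv o.τ hy
  rw [h0] at this
  exact o.ne_zero _ this.symm

theorem contDiffOn_chartDensity (o : OrientationForm I M) {θ : NForm I M V n} (hθ : NSmooth θ)
    (x₀ : M) : ContDiffOn ℝ ∞ (chartDensity o θ x₀) (extChartAt I x₀).target :=
  (contDiffOn_sign_inChart o x₀).smul (contDiffOn_eval (hθ x₀) _)

/-- The density is continuous on the compact image of `K` and zero on the rest of the chart target.
-/
theorem integrableOn_chartDensity (o : OrientationForm I M) {θ : NForm I M V n} (hθ : NSmooth θ)
    {K : Set M} (hK : IsCompact K) (hs : NSupp K θ) {x₀ : M} (hx₀ : K ⊆ (extChartAt I x₀).source) :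
    IntegrableOn (chartDensity o θ x₀) (extChartAt I x₀).target := by
  have hC : IsCompact (extChartAt I x₀ '' K) :=
    hK.image_of_continuousOn ((continuousOn_extChartAt x₀).mono hx₀)
  have hCt : extChartAt I x₀ '' K ⊆ (extChartAt I x₀).target := by
    rintro _ ⟨x, hx, rfl⟩
    exact (extChartAt I x₀).map_source (hx₀ hx)
  refine IntegrableOn.of_forall_sdiff_eq_zero
    (((contDiffOn_chartDensity o hθ x₀).continuousOn.mono hCt).integrableOn_compact hC)
    (measurableSet_extChartAt_target x₀) fun y hy => hs.chartDensity_eq_zero o x₀ fun hyK => hy.2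
      ⟨_, hyK, (extChartAt I x₀).right_inv hy.1⟩

/-- Densities of a form in two charts. -/
theorem chartDensity_eq_abs_det_smul (o : OrientationForm I M) (θ : NForm I M V n) (x₀ : M) {x₁ : M}
    {y : EuclideanSpace ℝ (Fin n)} (hy : y ∈ (extChartAt I x₁).target)
    (hy' : (extChartAt I x₁).symm y ∈ (extChartAt I x₀).source) :
    chartDensity o θ x₁ y =
      |(fderivWithin ℝ (extChartAt I x₀ ∘ (extChartAt I x₁).symm) (Set.range I) y).det| •
        chartDensity o θ x₀ (extChartAt I x₀ ((extChartAt I x₁).symm y)) := by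
  rw [chartDensity, inChart_eq_comp θ x₀ hy hy', inChart_eq_comp o.τ x₀ hy hy', comp_basis_eq_det_smul,
    comp_basis_eq_det_smul,    smul_eq_mul, sign_mul, chartDensity, smul_smul, smul_smul]
  congr 1
  push_cast
  -- The orientation form contributes the sign of the Jacobian, which turns the Jacobian of the top
  -- form into its absolute value.
  rw [mul_right_comm, sign_mul_self]

theorem mem_interior_target_of_mem_interior {x₀ x : M} (hx : x ∈ (extChartAt I x₀).source)
    (hi : x ∈ I.interior M) : extChartAt I x₀ x ∈ interior (extChartAt I x₀).target :=
  (I.isInteriorPoint_iff_of_mem_atlas (n := ∞) (by simp) (chart_mem_atlas H x₀)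
    (extChartAt_source I x₀ ▸ hx)).1 hi

theorem mem_interior_of_mem_interior_target {x₀ : M} {y : EuclideanSpace ℝ (Fin n)}
    (hy : y ∈ interior (extChartAt I x₀).target) : (extChartAt I x₀).symm y ∈ I.interior M := by
  have hy' := interior_subset hy
  refine (I.isInteriorPoint_iff_of_mem_atlas (n := ∞) (by simp) (chart_mem_atlas H x₀)
    (extChartAt_source I x₀ ▸ (extChartAt I x₀).map_target hy')).2 ?_
  change extChartAt I x₀ _ ∈ interior (extChartAt I x₀).target
  rwa [(extChartAt I x₀).right_inv hy']

/-- The part of the chart at `x₁` in the interior of the manifold and in the chart at `x₀`. -/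
def overlap (I : ModelWithCorners ℝ (EuclideanSpace ℝ (Fin n)) H) (x₀ x₁ : M) :
    Set (EuclideanSpace ℝ (Fin n)) :=
  interior (extChartAt I x₁).target ∩ (extChartAt I x₁).symm ⁻¹' (extChartAt I x₀).source

theorem isOpen_overlap (x₀ x₁ : M) : IsOpen (overlap I x₀ x₁) :=
  ((continuousOn_extChartAt_symm x₁).mono interior_subset).isOpen_inter_preimage isOpen_interior
    (isOpen_extChartAt_source x₀)

theorem image_overlap (x₀ x₁ : M) :
    (extChartAt I x₀ ∘ (extChartAt I x₁).symm) '' overlap I x₀ x₁ = overlap I x₁ x₀ := by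
  have key : ∀ (x₀ x₁ : M), ∀ y ∈ overlap I x₀ x₁,
      extChartAt I x₀ ((extChartAt I x₁).symm y) ∈ overlap I x₁ x₀ := by
    intro x₀ x₁ y hy
    refine ⟨mem_interior_target_of_mem_interior hy.2 (mem_interior_of_mem_interior_target hy.1), ?_⟩
    rw [Set.mem_preimage, (extChartAt I x₀).left_inv hy.2]
    exact (extChartAt I x₁).map_target (interior_subset hy.1)
  refine Set.Subset.antisymm (Set.image_subset_iff.2 (key x₀ x₁)) fun y hy => ⟨_, key x₁ x₀ y hy, ?_⟩
  rw [Function.comp_apply, (extChartAt I x₁).left_inv hy.2,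
    (extChartAt I x₀).right_inv (interior_subset hy.1)]

theorem injOn_overlap (x₀ x₁ : M) :
    Set.InjOn (extChartAt I x₀ ∘ (extChartAt I x₁).symm) (overlap I x₀ x₁) := by
  intro y hy z hz h
  have h1 := (extChartAt I x₀).injOn hy.2 hz.2 h
  exact (extChartAt I x₁).symm.injOn (interior_subset hy.1) (interior_subset hz.1) h1

/-- Independence of the chart of the integral of a form supported in a chart. -/
theorem setIntegral_chartDensity_eq (o : OrientationForm I M) {θ : NForm I M V n} {K : Set M}
    (hθ : NSupp K θ) {x₀ x₁ : M} (h₀ : K ⊆ (extChartAt I x₀).source)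
    (h₁ : K ⊆ (extChartAt I x₁).source) (hK : K ⊆ I.interior M) :
    ∫ y in (extChartAt I x₁).target, chartDensity o θ x₁ y =
      ∫ y in (extChartAt I x₀).target, chartDensity o θ x₀ y := by
  -- As `K` lies in the interior and in both charts, the integral may be restricted to the open set
  -- `overlap`. Between these open sets the transition map is an injective map with known
  -- derivative, so the change of variables formula applies and the boundary plays no role.
  have hsub : ∀ (x₀ x₁ : M), K ⊆ (extChartAt I x₀).source → K ⊆ (extChartAt I x₁).source →
      ∫ y in (extChartAt I x₁).target, chartDensity o θ x₁ y =
        ∫ y in overlap I x₀ x₁, chartDensity o θ x₁ y := by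
    intro x₀ x₁ h₀ h₁
    refine setIntegral_eq_of_subset_of_forall_sdiff_eq_zero (measurableSet_extChartAt_target x₁)
      (fun y hy => interior_subset hy.1) fun y hy => hθ.chartDensity_eq_zero o x₁ fun hyK => hy.2 ?_
    refine ⟨?_, h₀ hyK⟩
    have := mem_interior_target_of_mem_interior (h₁ hyK) (hK hyK)
    rwa [(extChartAt I x₁).right_inv hy.1] at this
  rw [hsub x₀ x₁ h₀ h₁, hsub x₁ x₀ h₁ h₀, ← image_overlap x₀ x₁,
    integral_image_eq_integral_abs_det_fderiv_smul volume (isOpen_overlap x₀ x₁).measurableSet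
      (f' := fderivWithin ℝ (extChartAt I x₀ ∘ (extChartAt I x₁).symm) (Set.range I)) ?_
      (injOn_overlap x₀ x₁)]
  · refine setIntegral_congr_fun (isOpen_overlap x₀ x₁).measurableSet fun y hy => ?_
    exact chartDensity_eq_abs_det_smul o θ x₀ (interior_subset hy.1) hy.2
  · intro y hy
    have hy1 := interior_subset hy.1
    exact (((contDiffWithinAt_coordChange x₀ hy1 hy.2).differentiableWithinAt
      (by simp)).hasFDerivWithinAt).mono
        fun z hz => extChartAt_target_subset_range x₁ (interior_subset hz.1)

end Integration

/-! ### Partition of unity, linearity of the integral, Stokes' theorem. -/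

section Stokes

open MeasureTheory

variable {n : ℕ} {H : Type*} [TopologicalSpace H]
  {I : ModelWithCorners ℝ (EuclideanSpace ℝ (Fin n)) H}
  {M : Type*} [TopologicalSpace M] [ChartedSpace H M] [IsManifold I ∞ M]
  [T2Space M] [SigmaCompactSpace M]
  {V : Type*} [NormedAddCommGroup V] [NormedSpace ℝ V] [FiniteDimensional ℝ V]
  {m : ℕ}

theorem nIntegral_eq_finsum (o : OrientationForm I M) (θ : NForm I M V n) :
    nIntegral o θ = ∑ᶠ i : M, ∫ y in (extChartAt I i).target,
      chartDensity o (fmul (chartPartition I M i) θ) i y := by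
  refine finsum_congr fun i => ?_
  congr 1
  funext y
  rw [chartDensity_fmul, chartDensity, smul_smul]
  simp [stdBasis]

/-- The support of the `i`-th term of the partition of unity, within `K`. -/
abbrev partSupp (I : ModelWithCorners ℝ (EuclideanSpace ℝ (Fin n)) H) {M : Type*}
    [TopologicalSpace M] [ChartedSpace H M] [IsManifold I ∞ M] [T2Space M] [SigmaCompactSpace M]
    (K : Set M) (i : M) : Set M :=
  K ∩ tsupport (chartPartition I M i)

theorem partSupp_subset_source (K : Set M) (i : M) :
    partSupp I K i ⊆ (extChartAt I i).source := fun x hx => by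
  rw [extChartAt_source]
  exact chartPartition_isSubordinate I M i hx.2

theorem isCompact_partSupp {K : Set M} (hK : IsCompact K) (i : M) : IsCompact (partSupp I K i) :=
  hK.inter_right (isClosed_tsupport _)

theorem NSupp.fmul_partition {K : Set M} {θ : NForm I M V m} (hθ : NSupp K θ) (i : M) :
    NSupp (partSupp I K i) (fmul (chartPartition I M i) θ) := fun x hx => by
  by_cases hxK : x ∈ K
  · have : chartPartition I M i x = 0 := image_eq_zero_of_notMem_tsupport fun h => hx ⟨hxK, h⟩
    rw [fmul, this, zero_smul]
  · rw [fmul, hθ x hxK, smul_zero]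

theorem NSupp.fmul {K : Set M} {θ : NForm I M V m} (hθ : NSupp K θ) (f : M → ℝ) :
    NSupp K (fmul f θ) := fun x hx => by rw [GYM.fmul, hθ x hx, smul_zero]

theorem NSmooth.fmul_partition {θ : NForm I M V m} (hθ : NSmooth θ) (i : M) :
    NSmooth (GYM.fmul (chartPartition I M i) θ) :=
  NSmooth.fmul (chartPartition I M i).contMDiff hθ

variable (I) in
/-- The finitely many indices of the partition of unity relevant on a compact set. -/
theorem exists_finset_partition {K : Set M} (hK : IsCompact K) :
    ∃ s : Finset M, ∀ i ∉ s, ∀ x ∈ K, chartPartition I M i x = 0 := by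
  have hf := (chartPartition I M).locallyFinite.finite_nonempty_inter_compact hK
  refine ⟨hf.toFinset, fun i hi x hx => ?_⟩
  by_contra h
  exact hi (hf.mem_toFinset.2 ⟨x, h, hx⟩)

theorem fmul_partition_eq_zero {K : Set M} {s : Finset M}
    (hs : ∀ i ∉ s, ∀ x ∈ K, chartPartition I M i x = 0) {θ : NForm I M V m} (hθ : NSupp K θ)
    {i : M} (hi : i ∉ s) : fmul (chartPartition I M i) θ = 0 := by
  funext x
  by_cases hx : x ∈ K
  · rw [fmul, hs i hi x hx, zero_smul]; rfl
  · rw [fmul, hθ x hx, smul_zero]; rfl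

theorem sum_fmul_partition {K : Set M} {s : Finset M}
    (hs : ∀ i ∉ s, ∀ x ∈ K, chartPartition I M i x = 0) {θ : NForm I M V m} (hθ : NSupp K θ) :
    ∑ i ∈ s, fmul (chartPartition I M i) θ = θ := by
  funext x
  rw [Finset.sum_apply]
  by_cases hx : x ∈ K
  · simp only [fmul]
    rw [← Finset.sum_smul]
    have h1 := (chartPartition I M).sum_eq_one (Set.mem_univ x)
    rw [finsum_eq_sum_of_support_subset (s := s) _ fun i hi => by
      by_contra h
      exact hi (hs i h x hx)] at h1
    rw [h1, one_smul]
  · simp [fmul, hθ x hx]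

/-- Replaces the `finsum` by a finite sum whose index set depends on `K` alone, so that several
forms supported in `K` can be treated over the same indices. -/
theorem nIntegral_eq_sum (o : OrientationForm I M) {K : Set M} {s : Finset M}
    (hs : ∀ i ∉ s, ∀ x ∈ K, chartPartition I M i x = 0) {θ : NForm I M V n} (hθ : NSupp K θ) :
    nIntegral o θ = ∑ i ∈ s, ∫ y in (extChartAt I i).target,
      chartDensity o (fmul (chartPartition I M i) θ) i y := by
  rw [nIntegral_eq_finsum]
  refine finsum_eq_sum_of_support_subset _ fun i hi => ?_
  by_contra h
  refine hi ?_
  simp only [fmul_partition_eq_zero hs hθ h]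
  refine (integral_congr_ae (Filter.Eventually.of_forall fun y => ?_)).trans (integral_zero' _ _)
  exact smul_zero _

theorem fmul_add (f : M → ℝ) (θ θ' : NForm I M V m) : fmul f (θ + θ') = fmul f θ + fmul f θ' :=
  funext fun x => smul_add _ _ _

theorem fmul_smul (f : M → ℝ) (c : ℝ) (θ : NForm I M V m) : fmul f (c • θ) = c • fmul f θ :=
  funext fun x => smul_comm (f x) c (θ x)

theorem NSupp.add {K : Set M} {θ θ' : NForm I M V m} (hθ : NSupp K θ) (hθ' : NSupp K θ') :
    NSupp K (θ + θ') := fun x hx => by rw [Pi.add_apply, hθ x hx, hθ' x hx, add_zero]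

theorem nIntegral_add (o : OrientationForm I M) {K : Set M} (hK : IsCompact K)
    {θ θ' : NForm I M V n} (h1 : NSmooth θ) (h2 : NSmooth θ') (hθ : NSupp K θ) (hθ' : NSupp K θ') :
    nIntegral o (θ + θ') = nIntegral o θ + nIntegral o θ' := by
  obtain ⟨s, hs⟩ := exists_finset_partition I hK
  rw [nIntegral_eq_sum o hs hθ, nIntegral_eq_sum o hs hθ', nIntegral_eq_sum o hs (hθ.add hθ'),
    ← Finset.sum_add_distrib]
  refine Finset.sum_congr rfl fun i _ => ?_
  rw [← integral_add]
  · simp only [fmul_add, chartDensity_add]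
  · exact integrableOn_chartDensity o (h1.fmul_partition i) (isCompact_partSupp hK i)
      (hθ.fmul_partition i) (partSupp_subset_source K i)
  · exact integrableOn_chartDensity o (h2.fmul_partition i) (isCompact_partSupp hK i)
      (hθ'.fmul_partition i) (partSupp_subset_source K i)

theorem nIntegral_smul (o : OrientationForm I M) (c : ℝ) (θ : NForm I M V n) :
    nIntegral o (c • θ) = c • nIntegral o θ := by
  rw [nIntegral_eq_finsum, nIntegral_eq_finsum, smul_finsum]
  refine finsum_congr fun i => ?_
  rw [← MeasureTheory.integral_smul]
  congr 1
  funext y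
  rw [fmul_smul, chartDensity, inChart_real_smul, ContinuousAlternatingMap.smul_apply, smul_comm]
  rfl

/-- The integral of a form supported in the interior and in one chart. -/
theorem nIntegral_eq_setIntegral (o : OrientationForm I M) {K : Set M} (hK : IsCompact K)
    (hKi : K ⊆ I.interior M) {x₀ : M} (hx₀ : K ⊆ (extChartAt I x₀).source)
    {θ : NForm I M V n} (h1 : NSmooth θ) (hθ : NSupp K θ) :
    nIntegral o θ = ∫ y in (extChartAt I x₀).target, chartDensity o θ x₀ y := by
  obtain ⟨s, hs⟩ := exists_finset_partition I hK
  -- Each piece is supported both in its own chart and in that of `x₀`, so its integral can be moved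
  -- to the latter and the pieces recombined there.
  have h2 : ∀ i ∈ s, ∫ y in (extChartAt I i).target,
      chartDensity o (fmul (chartPartition I M i) θ) i y =
      ∫ y in (extChartAt I x₀).target, chartDensity o (fmul (chartPartition I M i) θ) x₀ y :=
    fun i _ => setIntegral_chartDensity_eq o (hθ.fmul_partition i)
      (fun x hx => hx₀ hx.1) (partSupp_subset_source K i) fun x hx => hKi hx.1
  rw [nIntegral_eq_sum o hs hθ, Finset.sum_congr rfl h2, ← integral_finsetSum]
  · congr 1
    funext y
    conv_rhs => rw [← sum_fmul_partition hs hθ]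
    simp only [chartDensity, ← Finset.smul_sum]
    congr 1
    have : inChart (∑ i ∈ s, fmul (chartPartition I M i) θ) x₀ y =
        ∑ i ∈ s, inChart (fmul (chartPartition I M i) θ) x₀ y :=
      map_sum (AddMonoidHom.mk' (fun θ : NForm I M V n => inChart θ x₀ y)
        fun a b => inChart_add a b x₀ y) _ _
    rw [this, ContinuousAlternatingMap.sum_apply]
  · exact fun i _ => integrableOn_chartDensity o (h1.fmul_partition i) hK (hθ.fmul _) hx₀

/-- The divergence theorem for a compactly supported function. -/
theorem integral_fderiv_eq_zero {E : Type*} [NormedAddCommGroup E] [NormedSpace ℝ E]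
    [FiniteDimensional ℝ E] [MeasurableSpace E] [BorelSpace E] (μ : Measure E)
    [μ.IsAddHaarMeasure] {G : E → V} (hG : ContDiff ℝ ∞ G) (hc : HasCompactSupport G) (v : E) :
    ∫ y, fderiv ℝ G y v ∂μ = 0 := by
  -- Integration by parts against the constant function `1`, whose derivative is zero.
  have h := integral_smul_fderiv_eq_neg_fderiv_smul_of_integrable (μ := μ) (f := fun _ => (1 : ℝ))
    (g := G) (v := v) ?_ ?_ ?_ (fun x _ => differentiableAt_const _)
    (fun x _ => (hG.differentiable (by simp)) x)
  · simpa using h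
  · simp
  · simp only [one_smul]
    refine Continuous.integrable_of_hasCompactSupport ?_ (hc.fderiv_apply (𝕜 := ℝ) v)
    exact (hG.continuous_fderiv (by simp)).clm_apply continuous_const
  · simpa using hG.continuous.integrable_of_hasCompactSupport hc

/-- A linear functional of the alternation of the derivative of a compactly supported form-valued
function integrates to zero. -/
theorem integral_alternateAt_fderiv_eq_zero {E : Type*} [NormedAddCommGroup E] [NormedSpace ℝ E]
    [FiniteDimensional ℝ E] [MeasurableSpace E] [BorelSpace E] (μ : Measure E)
    [μ.IsAddHaarMeasure] (b : Module.Basis (Fin n) ℝ E) {p r : ℕ} (h : 1 + p = r)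
    {F : E → E [⋀^Fin p]→L[ℝ] V} (hF : ContDiff ℝ ∞ F) (hc : HasCompactSupport F)
    (v : Fin r → E) : ∫ y, alternateAt b h (fderiv ℝ F y) v ∂μ = 0 := by
  let l : Fin n → (E [⋀^Fin p]→L[ℝ] V) →L[ℝ] V := fun j => LinearMap.toContinuousLinearMap
    { toFun := fun f => wedgeAt (LinearMap.lsmul ℝ V) h
        (oneForm (LinearMap.toContinuousLinearMap (b.coord j))) f v
      map_add' := fun f f' => by rw [wedgeAt_add_right]; rfl
      map_smul' := fun c f => by rw [wedgeAt_real_smul_right]; rfl }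
  have hl : ∀ j, ContDiff ℝ ∞ (l j ∘ F) := fun j => (l j).contDiff.comp hF
  have hlc : ∀ j, HasCompactSupport (l j ∘ F) := fun j => hc.comp_left (map_zero (l j))
  have key : ∀ y, alternateAt b h (fderiv ℝ F y) v = ∑ j, fderiv ℝ (l j ∘ F) y (b j) := by
    intro y
    rw [alternateAt, ContinuousAlternatingMap.sum_apply]
    refine Finset.sum_congr rfl fun j _ => ?_
    have h1 := ((l j).hasFDerivAt.comp y (hF.differentiable (by simp) y).hasFDerivAt).fderiv
    rw [h1]
    rfl
  simp only [key]
  rw [integral_finsetSum]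
  · exact Finset.sum_eq_zero fun j _ => integral_fderiv_eq_zero μ (hl j) (hlc j) _
  · intro j _
    refine Continuous.integrable_of_hasCompactSupport ?_ ((hlc j).fderiv_apply (𝕜 := ℝ) _)
    exact ((hl j).continuous_fderiv (by simp)).clm_apply continuous_const

/-- Extension by zero of a function smooth on an open set, of compact support there. -/
theorem contDiff_extend {X Y : Type*} [NormedAddCommGroup X] [NormedSpace ℝ X]
    [NormedAddCommGroup Y] [NormedSpace ℝ Y] {t C : Set X} (hC : IsClosed C)
    (hCt : C ⊆ interior t) {f : X → Y} (hf : ContDiffOn ℝ ∞ f (interior t))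
    (h0 : ∀ y ∈ t, y ∉ C → f y = 0) [DecidablePred (· ∈ t)] :
    ContDiff ℝ ∞ (fun y => if y ∈ t then f y else 0) := by
  rw [contDiff_iff_contDiffAt]
  intro y
  by_cases hy : y ∈ interior t
  · refine (hf.contDiffAt (isOpen_interior.mem_nhds hy)).congr_of_eventuallyEq ?_
    filter_upwards [isOpen_interior.mem_nhds hy] with z hz
    rw [if_pos (interior_subset hz)]
  · refine (contDiffAt_const (c := (0 : Y))).congr_of_eventuallyEq ?_
    filter_upwards [hC.isOpen_compl.mem_nhds fun h => hy (hCt h)] with z hz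
    split_ifs with h
    exacts [h0 z h hz, rfl]

theorem eventually_sign_eq {X : Type*} [TopologicalSpace X] {s : Set X} {f : X → ℝ}
    (hf : ContinuousOn f s) {y : X} (hy : y ∈ s) (h0 : f y ≠ 0) :
    ∀ᶠ z in nhdsWithin y s, SignType.sign (f z) = SignType.sign (f y) := by
  rcases lt_or_gt_of_ne h0 with h | h
  · filter_upwards [(hf y hy).eventually (gt_mem_nhds h)] with z hz
    rw [sign_neg hz, sign_neg h]
  · filter_upwards [(hf y hy).eventually (lt_mem_nhds h)] with z hz
    rw [sign_pos hz, sign_pos h]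

theorem inChart_orientation_ne_zero (o : OrientationForm I M) {x₀ : M}
    {y : EuclideanSpace ℝ (Fin n)} (hy : y ∈ (extChartAt I x₀).target) :
    inChart o.τ x₀ y (stdBasis n) ≠ 0 := fun h => by
  have h0 : inChart o.τ x₀ y = 0 := ext_top (stdBasis n) (by simpa using h)
  have := inChart_comp_mfderiv o.τ hy
  rw [h0] at this
  exact o.ne_zero _ this.symm

/-- Since `K` is closed, the form vanishes near each point outside `K`, hence so does its
derivative. -/
theorem NSupp.nd {K : Set M} (hK : IsClosed K) {θ : NForm I M V m} (hθ : NSupp K θ) :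
    NSupp K (nd θ) := by
  intro x hx
  have hev : inChart θ x =ᶠ[nhdsWithin (extChartAt I x x) (Set.range I)] fun _ => 0 := by
    have := (continuousAt_extChartAt_symm (I := I) x).preimage_mem_nhds
      (t := Kᶜ) (hK.isOpen_compl.mem_nhds (by rwa [extChartAt_to_inv]))
    filter_upwards [nhdsWithin_le_nhds this] with y hy
    exact hθ.inChart_eq_zero x hy
  rw [GYM.nd, hev.extDerivWithin_eq_of_mem (Set.mem_range_self _), extDerivWithin,
    fderivWithin_fun_const]
  have h0 : ContinuousAlternatingMap.alternatizeUncurryFin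
      (0 : EuclideanSpace ℝ (Fin n) →L[ℝ] EuclideanSpace ℝ (Fin n) [⋀^Fin m]→L[ℝ] V) = 0 := by
    ext v
    simp [ContinuousAlternatingMap.alternatizeUncurryFin_apply]
  change (ContinuousAlternatingMap.alternatizeUncurryFin 0).compContinuousLinearMap _ = 0
  rw [h0]
  rfl

variable {p r : ℤ}

/-- The form vanishes outside the set `K`. -/
def Supp (K : Set M) (θ : Form I M V p) : Prop := ∀ m, NSupp K (θ m)

theorem Supp.d {K : Set M} (hK : IsClosed K) {θ : Form I M V p} (hθ : Supp K θ) (h : p + 1 = r) :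
    Supp K (d θ h) := by
  rintro ⟨m, hm⟩
  rcases m with - | i
  · exact fun _ _ => rfl
  · exact (hθ _).nd hK

/-- Stokes' theorem for a form supported in the interior and in one chart. -/
theorem nIntegral_d_eq_zero_of_subset_source (o : OrientationForm I M) {K : Set M}
    (hK : IsCompact K) (hKi : K ⊆ I.interior M) {x₀ : M} (hx₀ : K ⊆ (extChartAt I x₀).source)
    {θ : Form I M V p} (hθ : Smooth θ) (hs : Supp K θ) (h : p + 1 = n) :
    nIntegral o (d θ h ⟨n, rfl⟩) = 0 := by
  classical
  -- In dimension zero the form has degree `-1`, and its derivative is zero by definition.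
  rcases Nat.eq_zero_or_pos n with hn | hn
  · have : ∀ (m : ℕ) (hm : (m : ℤ) = n), m = 0 → d θ h ⟨m, hm⟩ = 0 := by
      rintro _ _ rfl
      rfl
    rw [this n rfl hn]
    simpa using nIntegral_smul o 0 (0 : NForm I M V n)
  obtain ⟨i, hi, him⟩ : ∃ i : ℕ, (i : ℤ) = p ∧ 1 + i = n := ⟨n - 1, by omega, by omega⟩
  rw [nIntegral_eq_setIntegral o hK hKi hx₀ (hθ.d h _) (hs.d hK.isClosed h _)]
  set t := (extChartAt I x₀).target with ht
  set C := extChartAt I x₀ '' K with hCdef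
  have hC : IsCompact C := hK.image_of_continuousOn ((continuousOn_extChartAt x₀).mono hx₀)
  have hCt : C ⊆ interior t := by
    rintro _ ⟨x, hx, rfl⟩
    exact mem_interior_target_of_mem_interior (hx₀ hx) (hKi hx)
  have hout : ∀ y ∈ t, y ∉ C → (extChartAt I x₀).symm y ∉ K := fun y hy hyC hyK =>
    hyC ⟨_, hyK, (extChartAt I x₀).right_inv hy⟩
  -- The orientation sign is included in the form, because it need not be constant on a disconnected
  -- chart target. The product is extended by zero to the whole space, which is smooth because the
  -- image of `K` is compact in the interior of the target.
  set f : EuclideanSpace ℝ (Fin n) → EuclideanSpace ℝ (Fin n) [⋀^Fin i]→L[ℝ] V := fun y =>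
    (SignType.sign (inChart o.τ x₀ y (stdBasis n)) : ℝ) • inChart (θ ⟨i, hi⟩) x₀ y with hf
  have hf0 : ∀ y ∈ t, y ∉ C → f y = 0 := fun y hy hyC => by
    simp only [hf]
    rw [(hs ⟨i, hi⟩).inChart_eq_zero x₀ (hout y hy hyC), smul_zero]
  have hF : ContDiff ℝ ∞ (fun y => if y ∈ t then f y else 0) := contDiff_extend hC.isClosed hCt
    (((contDiffOn_sign_inChart o x₀).smul (hθ ⟨i, hi⟩ x₀)).mono interior_subset) hf0
  set F := fun y => if y ∈ t then f y else 0 with hFdef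
  have hF0 : ∀ y ∉ C, F y = 0 := fun y hy => by
    simp only [hFdef]
    split_ifs with hyt
    exacts [hf0 y hyt hy, rfl]
  have hFc : HasCompactSupport F := HasCompactSupport.intro hC hF0
  have hF' : ∀ y ∉ C, fderiv ℝ F y = 0 := fun y hy => by
    have : F =ᶠ[nhds y] fun _ => 0 := by
      filter_upwards [hC.isClosed.isOpen_compl.mem_nhds hy] with z hz using hF0 z hz
    rw [this.fderiv_eq, fderiv_fun_const]
    rfl
  have hz : alternateAt (stdBasis n) him
      (fun _ : EuclideanSpace ℝ (Fin n) => (0 : EuclideanSpace ℝ (Fin n) [⋀^Fin i]→L[ℝ] V)) = 0 := by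
    simpa using alternateAt_smul (stdBasis n) him 0
      (fun _ : EuclideanSpace ℝ (Fin n) => (0 : EuclideanSpace ℝ (Fin n) [⋀^Fin i]→L[ℝ] V))
  have hz' : ∀ y ∉ C, alternateAt (stdBasis n) him (fderiv ℝ F y) (stdBasis n) = 0 :=
    fun y hy => by
      rw [hF' y hy]
      exact congrArg (fun a => a (stdBasis n)) hz
  rw [← integral_alternateAt_fderiv_eq_zero volume (stdBasis n) him hF hFc (stdBasis n),
    ← setIntegral_eq_integral_of_forall_compl_eq_zero (s := t) fun y hy =>
      hz' y fun h => hy (interior_subset (hCt h))]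
  refine setIntegral_congr_fun (measurableSet_extChartAt_target x₀) fun y hy => ?_
  by_cases hyC : y ∈ C
  · have hyU := isOpen_interior.mem_nhds (hCt hyC)
    have htn : t ∈ nhds y := Filter.mem_of_superset hyU interior_subset
    -- Near `y` the orientation sign is constant and passes through the derivative.
    have hev : F =ᶠ[nhds y] fun z =>
        (SignType.sign (inChart o.τ x₀ y (stdBasis n)) : ℝ) • inChart (θ ⟨i, hi⟩) x₀ z := by
      have hsg := eventually_sign_eq (contDiffOn_eval (o.smooth x₀) (stdBasis n)).continuousOn hy
        (inChart_orientation_ne_zero o hy)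
      rw [nhdsWithin_eq_nhds.2 htn] at hsg
      filter_upwards [hsg, htn] with z hz hzt
      simp only [hFdef, if_pos hzt, hf, hz]
    have hd : DifferentiableAt ℝ (inChart (θ ⟨i, hi⟩) x₀) y :=
      ((hθ ⟨i, hi⟩ x₀).contDiffAt htn).differentiableAt (by simp)
    have h1 : (fderiv ℝ F y : EuclideanSpace ℝ (Fin n) → _) = fun v =>
        (SignType.sign (inChart o.τ x₀ y (stdBasis n)) : ℝ) •
          fderivWithin ℝ (inChart (θ ⟨i, hi⟩) x₀) (Set.range I) y v := by
      rw [hev.fderiv_eq, fderiv_fun_const_smul hd, fderivWithin_of_mem_nhds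
        (Filter.mem_of_superset htn (extChartAt_target_subset_range x₀))]
      rfl
    simp only [h1, alternateAt_smul, ContinuousAlternatingMap.smul_apply]
    rw [chartDensity, inChart_d hθ h hi rfl him hy]
  · simp only [hz' y hyC]
    exact (hs.d hK.isClosed h _).chartDensity_eq_zero o x₀ (hout y hy hyC)

/-- Smooth forms vanishing outside `K`. -/
def SmoothSupp (K : Set M) (θ : Form I M V p) : Prop := Smooth θ ∧ Supp K θ

namespace SmoothSupp

variable {K : Set M} {a b : Form I M V p}

theorem add (ha : SmoothSupp K a) (hb : SmoothSupp K b) : SmoothSupp K (a + b) :=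
  ⟨ha.1.add hb.1, fun m => (ha.2 m).add (hb.2 m)⟩

theorem real_smul (c : ℝ) (ha : SmoothSupp K a) : SmoothSupp K (c • a) :=
  ⟨ha.1.real_smul c, fun m x hx => by rw [Pi.smul_apply, Pi.smul_apply, ha.2 m x hx, smul_zero]⟩

theorem zero : SmoothSupp K (0 : Form I M V p) := ⟨Smooth.zero, fun _ _ _ => rfl⟩

theorem neg (ha : SmoothSupp K a) : SmoothSupp K (-a) := by simpa using ha.real_smul (-1)

theorem sub (ha : SmoothSupp K a) (hb : SmoothSupp K b) : SmoothSupp K (a - b) := by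
  simpa [sub_eq_add_neg] using ha.add hb.neg

theorem d (hK : IsClosed K) (ha : SmoothSupp K a) (h : p + 1 = r) : SmoothSupp K (d a h) :=
  ⟨ha.1.d h, ha.2.d hK h⟩

theorem sum {ι : Type*} (s : Finset ι) {a : ι → Form I M V p}
    (ha : ∀ i, SmoothSupp K (a i)) : SmoothSupp K (∑ i ∈ s, a i) := by
  classical
  induction s using Finset.induction_on with
  | empty => exact zero
  | insert i s hi ih =>
    rw [Finset.sum_insert hi]
    exact (ha i).add ih

end SmoothSupp

theorem d_sum {ι : Type*} (s : Finset ι) {a : ι → Form I M V p} (ha : ∀ i, Smooth (a i))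
    (h : p + 1 = r) : GYM.d (∑ i ∈ s, a i) h = ∑ i ∈ s, GYM.d (a i) h := by
  classical
  induction s using Finset.induction_on with
  | empty => exact d_zero h
  | insert i s hi ih =>
    have hs : Smooth (∑ i ∈ s, a i) := (SmoothSupp.sum (K := Set.univ) s
      fun i => ⟨ha i, fun m x hx => absurd (Set.mem_univ x) hx⟩).1
    rw [Finset.sum_insert hi, Finset.sum_insert hi, d_add (ha i) hs, ih]

theorem integral_add (o : OrientationForm I M) {K : Set M} (hK : IsCompact K) {a b : Form I M V p}
    (ha : SmoothSupp K a) (hb : SmoothSupp K b) (h : p = n) :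
    integral o (a + b) h = integral o a h + integral o b h :=
  nIntegral_add o hK (ha.1 _) (hb.1 _) (ha.2 _) (hb.2 _)

theorem integral_real_smul (o : OrientationForm I M) (c : ℝ) (a : Form I M V p) (h : p = n) :
    integral o (c • a) h = c • integral o a h :=
  nIntegral_smul o c _

theorem integral_zero (o : OrientationForm I M) (h : p = n) :
    integral o (0 : Form I M V p) h = 0 := by
  simpa using integral_real_smul o 0 (0 : Form I M V p) h

theorem integral_neg (o : OrientationForm I M) (a : Form I M V p) (h : p = n) :
    integral o (-a) h = -integral o a h := by
  simpa using integral_real_smul o (-1) a h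

theorem integral_sub (o : OrientationForm I M) {K : Set M} (hK : IsCompact K) {a b : Form I M V p}
    (ha : SmoothSupp K a) (hb : SmoothSupp K b) (h : p = n) :
    integral o (a - b) h = integral o a h - integral o b h := by
  rw [sub_eq_add_neg, integral_add o hK ha hb.neg, integral_neg, sub_eq_add_neg]

theorem integral_sum (o : OrientationForm I M) {K : Set M} (hK : IsCompact K) {ι : Type*}
    (s : Finset ι) {a : ι → Form I M V p} (ha : ∀ i, SmoothSupp K (a i)) (h : p = n) :
    integral o (∑ i ∈ s, a i) h = ∑ i ∈ s, integral o (a i) h := by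
  classical
  induction s using Finset.induction_on with
  | empty => exact integral_zero o h
  | insert i s hi ih =>
    rw [Finset.sum_insert hi, Finset.sum_insert hi,
      integral_add o hK (ha i) (SmoothSupp.sum s ha), ih]

/-- Stokes' theorem for a form of compact support in the interior. -/
theorem integral_d_eq_zero (o : OrientationForm I M) {K : Set M} (hK : IsCompact K)
    (hKi : K ⊆ I.interior M) {a : Form I M V p} (ha : SmoothSupp K a) (h : p + 1 = n) :
    integral o (d a h) = 0 := by
  obtain ⟨s, hs⟩ := exists_finset_partition I hK
  -- Cutting with the partition of unity before differentiating gives finitely many pieces, each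
  -- supported in one chart.
  let c : M → Form I M V p := fun i m => fmul (chartPartition I M i) (a m)
  have hc : ∀ i, SmoothSupp (partSupp I K i) (c i) := fun i =>
    ⟨fun m => (ha.1 m).fmul_partition i, fun m => (ha.2 m).fmul_partition i⟩
  have hc' : ∀ i, SmoothSupp K (c i) := fun i => ⟨(hc i).1, fun m => (ha.2 m).fmul _⟩
  have hsum : ∑ i ∈ s, c i = a := funext fun m => by
    rw [Finset.sum_apply]
    exact sum_fmul_partition hs (ha.2 m)
  rw [← hsum, d_sum s (fun i => (hc i).1), integral_sum o hK s fun i => (hc' i).d hK.isClosed h]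
  exact Finset.sum_eq_zero fun i _ => nIntegral_d_eq_zero_of_subset_source o
    (isCompact_partSupp hK i) (fun x hx => hKi hx.1) (partSupp_subset_source K i) (hc i).1 (hc i).2 h

end Stokes

/-! ### Smoothness of pullbacks by variable linear maps. -/

section Comp

variable {E V X : Type*} [NormedAddCommGroup X] [NormedSpace ℝ X]
  [NormedAddCommGroup E] [NormedSpace ℝ E] [FiniteDimensional ℝ E]
  [NormedAddCommGroup V] [NormedSpace ℝ V] [FiniteDimensional ℝ V]

theorem contDiffWithinAt_of_evalBasis {n m : ℕ} (b : Module.Basis (Fin n) ℝ E)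
    {f : X → E [⋀^Fin m]→L[ℝ] V} {s : Set X} {N : ℕ∞ω} {x : X}
    (hf : ∀ t : Fin m → Fin n, ContDiffWithinAt ℝ N (fun y => f y fun i => b (t i)) s x) :
    ContDiffWithinAt ℝ N f s x := by
  obtain ⟨l, hl⟩ := LinearMap.exists_leftInverse_of_injective (evalBasis (V := V) (m := m) b)
    (LinearMap.ker_eq_bot.2 (evalBasis_injective b))
  have h1 : ContDiffWithinAt ℝ N (fun y => evalBasis b (f y)) s x := contDiffWithinAt_pi.2 hf
  have h2 := (LinearMap.toContinuousLinearMap l).contDiff.comp_contDiffWithinAt h1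
  refine h2.congr (fun y _ => ?_) ?_
  exacts [(LinearMap.congr_fun hl (f y)).symm, (LinearMap.congr_fun hl (f x)).symm]

/-- The values of the pullback on basis vectors are polynomial in the entries of `L` and linear in
the values of `f`. It is needed for the Jacobian of a change of charts. -/
theorem contDiffWithinAt_compContinuousLinearMap {m : ℕ}
    {f : X → E [⋀^Fin m]→L[ℝ] V} {L : X → E →L[ℝ] E} {s : Set X} {N : ℕ∞ω} {x : X}
    (hf : ContDiffWithinAt ℝ N f s x) (hL : ContDiffWithinAt ℝ N L s x) :
    ContDiffWithinAt ℝ N (fun y => (f y).compContinuousLinearMap (L y)) s x := by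
  let b := Module.finBasis ℝ E
  refine contDiffWithinAt_of_evalBasis b fun t => ?_
  have key : ∀ y, (f y).compContinuousLinearMap (L y) (fun i => b (t i)) =
      ∑ σ : Fin m → Fin (Module.finrank ℝ E),
        (∏ i, b.coord (σ i) (L y (b (t i)))) • f y fun i => b (σ i) := by
    intro y
    change (f y).toMultilinearMap (fun i => L y (b (t i))) = _
    conv_lhs => rw [show (fun i => L y (b (t i))) = fun i => ∑ j, b.coord j (L y (b (t i))) • b j
      from funext fun i => (b.sum_repr _).symm]
    rw [MultilinearMap.map_sum]
    refine Finset.sum_congr rfl fun σ _ => ?_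
    rw [MultilinearMap.map_smul_univ]
    rfl
  simp only [key]
  have hev : ∀ v, ContDiffWithinAt ℝ N (fun y => f y v) s x := fun v =>
    (ContinuousAlternatingMap.apply ℝ E V v).contDiff.comp_contDiffWithinAt hf
  refine ContDiffWithinAt.sum fun σ _ => ContDiffWithinAt.smul (contDiffWithinAt_prod fun i _ => ?_)
    (hev _)
  exact (LinearMap.toContinuousLinearMap (b.coord (σ i))).contDiff.comp_contDiffWithinAt
    (hL.clm_apply contDiffWithinAt_const)

end Comp

/-! ### Test forms with support in a chart and the fundamental lemma of the calculus of variations.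
-/

section TestForms

open MeasureTheory

variable {𝕜 : Type*} [RCLike 𝕜] {n : ℕ} {H : Type*} [TopologicalSpace H]
  {I : ModelWithCorners ℝ (EuclideanSpace ℝ (Fin n)) H}
  {M : Type*} [TopologicalSpace M] [ChartedSpace H M] [IsManifold I ∞ M]
  [T2Space M] [SigmaCompactSpace M]
  {V W U : Type*} [NormedAddCommGroup V] [NormedSpace ℝ V]
  [NormedAddCommGroup W] [NormedSpace ℝ W] [NormedAddCommGroup U] [NormedSpace ℝ U]
  [Module 𝕜 V] [Module 𝕜 W] [Module 𝕜 U]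
  [IsScalarTower ℝ 𝕜 V] [IsScalarTower ℝ 𝕜 W] [IsScalarTower ℝ 𝕜 U]
  [FiniteDimensional ℝ V] [FiniteDimensional ℝ W] [FiniteDimensional ℝ U]
  {p q r : ℤ} {m : ℕ}

theorem IsTest.exists_smoothSupp {a : Form I M V p} (ha : IsTest a) :
    ∃ K : Set M, IsCompact K ∧ K ⊆ I.interior M ∧ SmoothSupp K a := by
  rcases lt_or_ge p 0 with hp | hp
  · exact ⟨∅, isCompact_empty, Set.empty_subset _, ha.1, fun m => absurd m.2 (by omega)⟩
  obtain ⟨i, -, hi, -⟩ := exists_nat_degrees hp hp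
  refine ⟨_, (ha.2 ⟨i, hi⟩).1, (ha.2 ⟨i, hi⟩).2, ha.1, ?_⟩
  rintro ⟨m, hm⟩ x hx
  obtain rfl : m = i := by omega
  by_contra h
  exact hx (subset_closure h)

theorem SmoothSupp.isTest {K : Set M} (hK : IsCompact K) (hKi : K ⊆ I.interior M)
    {a : Form I M V p} (ha : SmoothSupp K a) : IsTest a := by
  refine ⟨ha.1, fun m => ?_⟩
  have hsub : closure {x : M | a m x ≠ 0} ⊆ K := by
    refine closure_minimal (fun x hx => ?_) hK.isClosed
    by_contra h
    exact hx (ha.2 m x h)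
  exact ⟨hK.of_isClosed_subset isClosed_closure hsub, hsub.trans hKi⟩

theorem SmoothSupp.mono {K K' : Set M} (h : K ⊆ K') {a : Form I M V p} (ha : SmoothSupp K a) :
    SmoothSupp K' a := ⟨ha.1, fun m x hx => ha.2 m x fun hxK => hx (h hxK)⟩

theorem SmoothSupp.wedge_left {K : Set M} (B : V →ₗ[𝕜] W →ₗ[𝕜] U) {a : Form I M V p}
    {b : Form I M W q} (ha : SmoothSupp K a) (hb : Smooth b) (h : p + q = r) :
    SmoothSupp K (wedge B a b h) := by
  refine ⟨ha.1.wedge B hb h, ?_⟩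
  rintro ⟨m, hm⟩ x hx
  rcases lt_or_ge p 0 with hp | hp
  · rw [wedge_eq_zero_of_neg_left _ _ _ _ hp]; rfl
  rcases lt_or_ge q 0 with hq | hq
  · rw [wedge_eq_zero_of_neg_right _ _ _ _ hq]; rfl
  obtain ⟨i, j, hi, hj⟩ := exists_nat_degrees hp hq
  rw [wedge_apply B a b h hi hj hm (by omega), ha.2 _ x hx]
  simpa using wedgeAt_real_smul_left B (show i + j = m by omega) 0 (a ⟨i, hi⟩ x) (b ⟨j, hj⟩ x)

theorem SmoothSupp.wedge_right {K : Set M} (B : V →ₗ[𝕜] W →ₗ[𝕜] U) {a : Form I M V p}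
    {b : Form I M W q} (ha : Smooth a) (hb : SmoothSupp K b) (h : p + q = r) :
    SmoothSupp K (wedge B a b h) := by
  rw [wedge_comm B B.flip (fun _ _ => rfl)]
  exact (hb.wedge_left B.flip ha _).real_smul _

theorem SmoothSupp.mapForm {K : Set M} (f : V →ₗ[𝕜] W) {a : Form I M V p} (ha : SmoothSupp K a) :
    SmoothSupp K (mapForm f a) := by
  refine ⟨ha.1.mapForm f, fun m x hx => ContinuousAlternatingMap.ext fun v => ?_⟩
  change f (a m x v) = 0
  rw [ha.2 m x hx]
  exact map_zero f

theorem SmoothSupp.smul [ContinuousConstSMul 𝕜 V] [SMulCommClass ℝ 𝕜 V] {K : Set M} (c : 𝕜)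
    {a : Form I M V p} (ha : SmoothSupp K a) : SmoothSupp K (c • a) :=
  ⟨ha.1.smul c, fun m x hx => by rw [Pi.smul_apply, Pi.smul_apply, ha.2 m x hx, smul_zero]⟩

/-! ### Test forms in a chart -/

/-- Smoothness may be checked near each point in one chart containing it; every other expression is
obtained by composing with a smooth transition map and pulling back by its derivative. -/
theorem nsmooth_of_charts {a : NForm I M V m}
    (h : ∀ x, ∃ x₀, x ∈ (extChartAt I x₀).source ∧
      ContDiffWithinAt ℝ ∞ (inChart a x₀) (Set.range I) (extChartAt I x₀ x)) : NSmooth a := by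
  intro x₁ y hy
  obtain ⟨x₀, hx, hs⟩ := h ((extChartAt I x₁).symm y)
  refine ContDiffWithinAt.mono ?_ (extChartAt_target_subset_range x₁)
  set ψ := extChartAt I x₀ ∘ (extChartAt I x₁).symm with hψ
  have hψs : ContDiffWithinAt ℝ ∞ ψ (Set.range I) y := contDiffWithinAt_coordChange x₀ hy hx
  have hyr := extChartAt_target_subset_range x₁ hy
  have hev : inChart a x₁ =ᶠ[nhdsWithin y (Set.range I)] fun z =>
      (inChart a x₀ (ψ z)).compContinuousLinearMap (fderivWithin ℝ ψ (Set.range I) z) := by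
    filter_upwards [eventually_mem_target hy, eventually_symm_mem_source x₀ hy hx] with z hz hz'
    exact inChart_eq_comp a x₀ hz hz'
  refine ContDiffWithinAt.congr_of_eventuallyEq_of_mem ?_ hev hyr
  have h1 : ContDiffWithinAt ℝ ∞ (fun z => inChart a x₀ (ψ z)) (Set.range I) y :=
    ContDiffWithinAt.comp (g := inChart a x₀) y hs hψs fun z _ => by simp [hψ, extChartAt, OpenPartialHomeomorph.extend]
  have h2 : ContDiffWithinAt ℝ ∞ (fderivWithin ℝ ψ (Set.range I)) (Set.range I) y :=
    hψs.fderivWithin_right I.uniqueDiffOn (by simp) hyr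
  exact contDiffWithinAt_compContinuousLinearMap h1 h2

/-- The form with constant coefficients `α` in the chart at `x₀`, multiplied by the bump
function `χ`. -/
def chartForm (I : ModelWithCorners ℝ (EuclideanSpace ℝ (Fin n)) H) {M : Type*}
    [TopologicalSpace M] [ChartedSpace H M] (x₀ : M) (χ : EuclideanSpace ℝ (Fin n) → ℝ)
    (α : EuclideanSpace ℝ (Fin n) [⋀^Fin m]→L[ℝ] V) : NForm I M V m := fun x =>
  open Classical in if x ∈ (extChartAt I x₀).source then
    χ (extChartAt I x₀ x) • α.compContinuousLinearMap
      (mfderiv I 𝓘(ℝ, EuclideanSpace ℝ (Fin n)) (extChartAt I x₀) x) else 0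

theorem inChart_chartForm (x₀ : M) (χ : EuclideanSpace ℝ (Fin n) → ℝ)
    (α : EuclideanSpace ℝ (Fin n) [⋀^Fin m]→L[ℝ] V) {y : EuclideanSpace ℝ (Fin n)}
    (hy : y ∈ (extChartAt I x₀).target) :
    inChart (chartForm I x₀ χ α) x₀ y = χ y • α := by
  have h1 := mfderiv_extChartAt_comp_mfderivWithin_extChartAt_symm hy
  rw [inChart, chartForm, if_pos ((extChartAt I x₀).map_target hy), (extChartAt I x₀).right_inv hy]
  refine ContinuousAlternatingMap.ext fun v => ?_
  change χ y • α _ = χ y • α v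
  congr 2
  funext i
  exact congrArg (fun f => f (v i)) h1

theorem nsupp_chartForm (x₀ : M) {χ : EuclideanSpace ℝ (Fin n) → ℝ}
    (α : EuclideanSpace ℝ (Fin n) [⋀^Fin m]→L[ℝ] V) :
    NSupp ((extChartAt I x₀).symm '' tsupport χ) (chartForm I x₀ χ α) := by
  intro x hx
  rw [chartForm]
  split_ifs with h
  · have : χ (extChartAt I x₀ x) = 0 := image_eq_zero_of_notMem_tsupport fun hχ =>
      hx ⟨_, hχ, (extChartAt I x₀).left_inv h⟩
    rw [this, zero_smul]
  · rfl

theorem nsmooth_chartForm (x₀ : M) {χ : EuclideanSpace ℝ (Fin n) → ℝ} (hχ : ContDiff ℝ ∞ χ)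
    (hK : IsCompact ((extChartAt I x₀).symm '' tsupport χ))
    (hs : (extChartAt I x₀).symm '' tsupport χ ⊆ (extChartAt I x₀).source)
    (α : EuclideanSpace ℝ (Fin n) [⋀^Fin m]→L[ℝ] V) :
    NSmooth (chartForm I x₀ χ α) := by
  refine nsmooth_of_charts fun x => ?_
  by_cases hx : x ∈ (extChartAt I x₀).source
  · refine ⟨x₀, hx, ?_⟩
    have hy := (extChartAt I x₀).map_source hx
    refine ContDiffWithinAt.congr_of_eventuallyEq_of_mem (f := fun y => χ y • α)
      ((hχ.smul contDiff_const).contDiffWithinAt) ?_ (extChartAt_target_subset_range x₀ hy)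
    filter_upwards [eventually_mem_target hy] with z hz using inChart_chartForm x₀ χ α hz
  -- Outside the chart domain the form vanishes in a neighbourhood: the image of the support of `χ`
  -- is compact, hence closed in a Hausdorff manifold, and lies in the chart domain.
  · refine ⟨x, mem_extChartAt_source x, ?_⟩
    refine ContDiffWithinAt.congr_of_eventuallyEq_of_mem (f := fun y => 0)
      contDiffWithinAt_const ?_ (Set.mem_range_self _)
    have := (continuousAt_extChartAt_symm (I := I) x).preimage_mem_nhds
      (t := ((extChartAt I x₀).symm '' tsupport χ)ᶜ) (hK.isClosed.isOpen_compl.mem_nhds (by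
        rw [extChartAt_to_inv]
        exact fun h => hx (hs h)))
    filter_upwards [nhdsWithin_le_nhds this] with z hz
    exact (nsupp_chartForm x₀ α).inChart_eq_zero x hz

/-- The fundamental lemma of the calculus of variations. -/
theorem eq_zero_of_integral_wedge_eq_zero (o : OrientationForm I M) (B : V →ₗ[𝕜] W →ₗ[𝕜] U)
    (hB : ∀ w, (∀ v, B v w = 0) → w = 0) {E : Form I M W q} (hE : Smooth E) (h : p + q = n)
    (H : ∀ a : Form I M V p, IsTest a → integral o (wedge B a E h) = 0) : E = 0 := by
  rcases lt_or_ge q 0 with hq | hq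
  · exact E.eq_zero_of_neg hq
  rcases lt_or_ge p 0 with hp | hp
  -- Negative `p` means `q > n`. There are no test forms of degree `p`, but `E` vanishes for
  -- dimension reasons.
  · refine Form.ext fun m hm x => eq_zero_of_finrank_lt ?_ _
    rw [show Module.finrank ℝ (TangentSpace I x) = n from finrank_euclideanSpace_fin]
    change n < m
    omega
  obtain ⟨i, j, hi, hj⟩ := exists_nat_degrees hp hq
  have hij : i + j = n := by omega
  subst hi hj
  funext ⟨j', hj'⟩
  obtain rfl : j' = j := by omega
  refine nform_eq_of_inChart fun x₀ y hy => ?_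
  change inChart (E ⟨j', rfl⟩) x₀ y = 0
  set t := (extChartAt I x₀).target with ht
  refine eq_zero_of_wedgeAt_eq_zero B hB hij (stdBasis n) _ fun α => ?_
  -- The density of `α ∧ E` with constant coefficients `α`; its vanishing for every `α` determines
  -- `E` at `y`, the pairing being non-degenerate.
  set f : EuclideanSpace ℝ (Fin n) → U := fun y =>
    (SignType.sign (inChart o.τ x₀ y (stdBasis n)) : ℝ) •
      wedgeAt B hij α (inChart (E ⟨j', rfl⟩) x₀ y) (stdBasis n) with hf
  have hfs : ContinuousOn f t := ((contDiffOn_sign_inChart o x₀).smul (contDiffOn_eval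
    (contDiffOn_wedgeAt B hij contDiffOn_const (hE ⟨j', rfl⟩ x₀)) _)).continuousOn
  suffices hfy : f y = 0 by
    refine (smul_eq_zero_iff_right ?_).1 hfy
    have := inChart_orientation_ne_zero o hy
    rcases lt_or_gt_of_ne this with h | h
    · rw [sign_neg h]
      norm_num
    · rw [sign_pos h]
      norm_num
  -- Only the interior of the target is available for test functions, since variations must vanish
  -- near the boundary of `M`.
  have hae : ∀ᵐ z, z ∈ interior t → f z = 0 := by
    refine isOpen_interior.ae_eq_zero_of_integral_contDiff_smul_eq_zero
      ((hfs.mono interior_subset).locallyIntegrableOn isOpen_interior.measurableSet) ?_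
    intro χ hχ hχc hχs
    have hts : tsupport χ ⊆ t := hχs.trans interior_subset
    have hK : IsCompact ((extChartAt I x₀).symm '' tsupport χ) :=
      hχc.image_of_continuousOn ((continuousOn_extChartAt_symm x₀).mono hts)
    have hsrc : (extChartAt I x₀).symm '' tsupport χ ⊆ (extChartAt I x₀).source := by
      rintro _ ⟨z, hz, rfl⟩
      exact (extChartAt I x₀).map_target (hts hz)
    have hint : (extChartAt I x₀).symm '' tsupport χ ⊆ I.interior M := by
      rintro _ ⟨z, hz, rfl⟩
      exact mem_interior_of_mem_interior_target (hχs hz)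
    -- The index `m` of a component equals `i` only propositionally, so `α` is transported to that
    -- degree.
    let a : Form I M V i := fun m => chartForm I x₀ χ ((Nat.cast_injective (R := ℤ) m.2).symm ▸ α)
    have ha : SmoothSupp ((extChartAt I x₀).symm '' tsupport χ) a :=
      ⟨fun m => nsmooth_chartForm x₀ hχ hK hsrc _, fun m => nsupp_chartForm x₀ _⟩
    have haE := ha.wedge_left B hE h
    have h0 := H a (ha.isTest hK hint)
    rw [integral, nIntegral_eq_setIntegral o hK hint hsrc (haE.1 _) (haE.2 _)] at h0
    have hw : wedge B a E h ⟨n, rfl⟩ = fun x => wedgeAt B hij (a ⟨i, rfl⟩ x) (E ⟨j', rfl⟩ x) :=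
      funext fun x => wedge_apply B a E h rfl rfl rfl hij x
    rw [← h0, ← setIntegral_eq_integral_of_forall_compl_eq_zero (s := t) fun z hz => by
      rw [image_eq_zero_of_notMem_tsupport fun h => hz (hts h), zero_smul]]
    refine setIntegral_congr_fun (measurableSet_extChartAt_target x₀) fun z hz => ?_
    change χ z • f z = chartDensity o (wedge B a E h ⟨n, rfl⟩) x₀ z
    rw [hw, chartDensity, inChart_wedgeAt, show inChart (a ⟨i, rfl⟩) x₀ z = χ z • α from
      inChart_chartForm x₀ χ α hz, wedgeAt_real_smul_left, ContinuousAlternatingMap.smul_apply,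
      smul_comm]
  -- Continuity extends the vanishing from the interior to boundary points, which lie in the closure
  -- of the interior.
  have heq : Set.EqOn f (fun _ => 0) t := by
    have h1 := Measure.eqOn_open_of_ae_eq (μ := volume)
      ((ae_restrict_iff' isOpen_interior.measurableSet).2 hae) isOpen_interior
      (hfs.mono interior_subset) continuousOn_const
    exact h1.of_subset_closure hfs continuousOn_const interior_subset
      extChartAt_target_subset_closure_interior
  exact heq hy

end TestForms

/-! ### Moving maps and covariant derivatives across pairings. -/

section Variation

variable {𝕜 : Type*} [RCLike 𝕜] {n : ℕ} {H : Type*} [TopologicalSpace H]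
  {I : ModelWithCorners ℝ (EuclideanSpace ℝ (Fin n)) H}
  {M : Type*} [TopologicalSpace M] [ChartedSpace H M]
  {V W U T : Type*} [NormedAddCommGroup V] [NormedSpace ℝ V]
  [NormedAddCommGroup W] [NormedSpace ℝ W] [NormedAddCommGroup U] [NormedSpace ℝ U]
  [NormedAddCommGroup T] [NormedSpace ℝ T]
  [Module 𝕜 V] [Module 𝕜 W] [Module 𝕜 U] [Module 𝕜 T]
  [IsScalarTower ℝ 𝕜 V] [IsScalarTower ℝ 𝕜 W] [IsScalarTower ℝ 𝕜 U] [IsScalarTower ℝ 𝕜 T]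
  {p q r s pq qs : ℤ}

theorem wedge_neg_bilin (B : V →ₗ[𝕜] W →ₗ[𝕜] U) (a : Form I M V p) (b : Form I M W q)
    (h : p + q = r) : wedge (-B) a b h = -wedge B a b h := by
  rw [← wedge_neg_left]
  refine wedge_congr _ _ _ fun m m' x u w => ?_
  change -(B (a m x u) (b m' x w)) = B (-(a m x u)) (b m' x w)
  simp

/-- Transfer of an invariant action across a pairing. -/
theorem wedge_act_left (B : V →ₗ[𝕜] V →ₗ[𝕜] U) (act : T →ₗ[𝕜] V →ₗ[𝕜] V)
    (hB : ∀ x y z, B (act x y) z = -B y (act x z)) (A : Form I M T p) (a : Form I M V q)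
    (E : Form I M V s) {ps : ℤ} (h₁ : p + q = pq) (h₂ : pq + s = r) (h₃ : p + s = ps)
    (h₄ : q + ps = r) :
    wedge B (wedge act A a h₁) E h₂ = -((-1 : ℝ) ^ (p * q) • wedge B a (wedge act A E h₃) h₄) := by
  rw [wedge_comm act act.flip (fun _ _ => rfl), wedge_real_smul_left,
    wedge_assoc act.flip B act (-B) (fun x y z => by simpa using hB y x z) a A E _ h₂ h₃ h₄,
    wedge_neg_bilin, smul_neg]

/-- Transfer of a bilinear map across a pairing. -/
theorem wedge_wedge_eq_neg (B : V →ₗ[𝕜] V →ₗ[𝕜] U) (C : W →ₗ[𝕜] W →ₗ[𝕜] U)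
    (b : W →ₗ[𝕜] T →ₗ[𝕜] V) (c : V →ₗ[𝕜] T →ₗ[𝕜] W)
    (hB : ∀ x y z, B (b x y) z = -C x (c z y)) (a : Form I M W p) (Y : Form I M T q)
    (E : Form I M V s) {sq : ℤ} (h₁ : p + q = pq) (h₂ : pq + s = r) (h₃ : s + q = sq)
    (h₄ : p + sq = r) :
    wedge B (wedge b a Y h₁) E h₂ = -((-1 : ℝ) ^ (q * s) • wedge C a (wedge c E Y h₃) h₄) := by
  rw [wedge_assoc b B c.flip (-C) (fun x y z => by simpa using hB x y z) a Y E h₁ h₂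
    (show q + s = sq by omega) h₄, wedge_neg_bilin, wedge_comm c.flip c (fun _ _ => rfl),
    wedge_real_smul_right]

/-- Transfer of a bilinear map across a pairing, in the second variable. -/
theorem wedge_wedge_eq_neg' (B : V →ₗ[𝕜] V →ₗ[𝕜] U) (C : W →ₗ[𝕜] W →ₗ[𝕜] U)
    (b : T →ₗ[𝕜] W →ₗ[𝕜] V) (c : V →ₗ[𝕜] T →ₗ[𝕜] W)
    (hB : ∀ x y z, B (b y x) z = -C x (c z y)) (Y : Form I M T q) (a : Form I M W p)
    (E : Form I M V s) {sq : ℤ} (h₁ : q + p = pq) (h₂ : pq + s = r) (h₃ : s + q = sq)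
    (h₄ : p + sq = r) :
    wedge B (wedge b Y a h₁) E h₂ =
      -((-1 : ℝ) ^ (q * p) • (-1 : ℝ) ^ (q * s) • wedge C a (wedge c E Y h₃) h₄) := by
  rw [wedge_comm b b.flip (fun _ _ => rfl), wedge_real_smul_left,
    wedge_wedge_eq_neg B C b.flip c (fun x y z => hB x y z) a Y E _ h₂ h₃ h₄, smul_neg]

variable [IsManifold I ∞ M] [FiniteDimensional ℝ V] [FiniteDimensional ℝ U] [FiniteDimensional ℝ T]

/-- The Leibniz rule for the covariant derivative and an invariant pairing. -/
theorem wedge_covariant_left (B : V →ₗ[𝕜] V →ₗ[𝕜] U) (act : T →ₗ[𝕜] V →ₗ[𝕜] V)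
    (hB : ∀ x y z, B (act x y) z = -B y (act x z)) (A : Form I M T 1) {a : Form I M V p}
    {E : Form I M V s} (ha : Smooth a) (hE : Smooth E) {p' s' ps : ℤ} (hp : p + 1 = p')
    (hp' : 1 + p = p') (hs : s + 1 = s') (hs' : 1 + s = s') (h : p + s = ps) (hps : ps + 1 = r)
    (h₂ : p' + s = r) (h₄ : p + s' = r) :
    wedge B (d a hp + wedge act A a hp') E h₂ =
      d (wedge B a E h) hps - (-1 : ℝ) ^ p • wedge B a (d E hs + wedge act A E hs') h₄ := by
  -- Invariance and graded commutativity give the connection term the sign `-(-1)^p`, the same as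
  -- the Leibniz rule gives to `d E`; together they form the covariant derivative of `E`.
  rw [d_wedge B ha hE h hps hp hs h₂ h₄, wedge_add_left, wedge_add_right,
    wedge_act_left B act hB A a E hp' h₂ hs' h₄, one_mul]
  module

variable [T2Space M] [SigmaCompactSpace M]

/-- The expansion of the Yang–Mills density along a quadratic variation. -/
theorem exists_wedge_star_expansion {K : Set M} (g : PseudoRiemannianMetric I M)
    (o : OrientationForm I M)
    (B : V →ₗ[𝕜] V →ₗ[𝕜] U) (hB : ∀ x y, B x y = B y x) {X X' X'' : Form I M V p}
    (hX : Smooth X) (hX' : SmoothSupp K X') (hX'' : SmoothSupp K X'') (h : p + r = n) :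
    ∃ P₂ P₃ P₄ : Form I M U n, SmoothSupp K P₂ ∧ SmoothSupp K P₃ ∧ SmoothSupp K P₄ ∧ ∀ t : ℝ,
      wedge B (X + t • X' + t ^ 2 • X'') (star g o (X + t • X' + t ^ 2 • X'') h) =
        wedge B X (star g o X h) + t • (2 : ℝ) • wedge B X' (star g o X h) + t ^ 2 • P₂ +
          t ^ 3 • P₃ + t ^ 4 • P₄ := by
  refine ⟨wedge B X' (star g o X' h) + (2 : ℝ) • wedge B X'' (star g o X h),
    (2 : ℝ) • wedge B X'' (star g o X' h), wedge B X'' (star g o X'' h), ?_, ?_, ?_, fun t => ?_⟩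
  · exact (hX'.wedge_left B (hX'.1.star g o h) h).add
      ((hX''.wedge_left B (hX.star g o h) h).real_smul _)
  · exact (hX''.wedge_left B (hX'.1.star g o h) h).real_smul _
  · exact hX''.wedge_left B (hX''.1.star g o h) h
  · simp only [star_add, star_real_smul, wedge_add_left, wedge_add_right, wedge_real_smul_left,
      wedge_real_smul_right]
    -- The symmetry of `a ∧ ∗b` merges the mixed terms in pairs; this is the source of the factor
    -- two.
    rw [wedge_star_comm g o B hB X X' h, wedge_star_comm g o B hB X X'' h,
      wedge_star_comm g o B hB X' X'' h]
    module

end Variation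

/-! ### Components of the generalized curvatures and of the Lagrangian. -/

section YangMills

variable {𝕜 : Type*} [RCLike 𝕜] {𝔤 𝔥 𝔩 : Type*}
  [NormedLieRing 𝔤] [NormedLieAlgebra 𝕜 𝔤] [NormedSpace ℝ 𝔤] [IsScalarTower ℝ 𝕜 𝔤]
  [NormedLieRing 𝔥] [NormedLieAlgebra 𝕜 𝔥] [NormedSpace ℝ 𝔥] [IsScalarTower ℝ 𝕜 𝔥]
  [NormedLieRing 𝔩] [NormedLieAlgebra 𝕜 𝔩] [NormedSpace ℝ 𝔩] [IsScalarTower ℝ 𝕜 𝔩]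
  [FiniteDimensional 𝕜 𝔤] [FiniteDimensional 𝕜 𝔥] [FiniteDimensional 𝕜 𝔩]
  {n : ℕ} {H : Type*} [TopologicalSpace H]
  {I : ModelWithCorners ℝ (EuclideanSpace ℝ (Fin n)) H}
  {M : Type*} [TopologicalSpace M] [ChartedSpace H M]

theorem mapForm_add {V W : Type*} [NormedAddCommGroup V] [NormedSpace ℝ V]
    [NormedAddCommGroup W] [NormedSpace ℝ W] [Module 𝕜 V] [Module 𝕜 W]
    [IsScalarTower ℝ 𝕜 V] [IsScalarTower ℝ 𝕜 W] (f : V →ₗ[𝕜] W) {p : ℤ} (a b : Form I M V p) :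
    mapForm f (a + b) = mapForm f a + mapForm f b :=
  Form.ext fun m hm x => ContinuousAlternatingMap.ext fun v => map_add f _ _

theorem mapForm_real_smul {V W : Type*} [NormedAddCommGroup V] [NormedSpace ℝ V]
    [NormedAddCommGroup W] [NormedSpace ℝ W] [Module 𝕜 V] [Module 𝕜 W]
    [IsScalarTower ℝ 𝕜 V] [IsScalarTower ℝ 𝕜 W] (f : V →ₗ[𝕜] W) {p : ℤ} (c : ℝ)
    (a : Form I M V p) : mapForm f (c • a) = c • mapForm f a :=
  Form.ext fun m hm x => ContinuousAlternatingMap.ext fun v => LinearMap.map_smul_of_tower f c _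

namespace Generalized3Connection

variable (X : Differential2CrossedModule 𝕜 𝔤 𝔥 𝔩) (P : InvariantForms X) (k : 𝕜)
  (g : PseudoRiemannianMetric I M) (o : OrientationForm I M)
  (φ δφ : Generalized3Connection 𝔤 𝔥 𝔩 I M)

/-! ### Components of the generalized curvatures -/

/-- The first component of `𝓕`. -/
def F₁ : Form I M 𝔤 2 := φ.𝔽 X + k • φ.A₂

/-- The second component of `𝓕`. -/
def F₂ : Form I M 𝔤 3 := φ.Dg 𝕜 φ.A₂ - mapForm (X.α : 𝔥 →ₗ[𝕜] 𝔤) φ.B₃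

/-- The first component of `𝓖`. -/
def G₁ : Form I M 𝔥 3 := φ.𝔾 X - k • φ.B₃

/-- The second component of `𝓖`. -/
def G₂ : Form I M 𝔥 4 :=
  φ.Dh X φ.B₃ + wedge X.actH φ.A₂ φ.B₂ - mapForm (X.β : 𝔩 →ₗ[𝕜] 𝔥) φ.C₄

/-- The first component of `𝓗`. -/
def H₁ : Form I M 𝔩 4 := φ.ℍ X + k • φ.C₄

/-- The second component of `𝓗`. -/
def H₂ : Form I M 𝔩 5 :=
  φ.Dl X φ.C₄ - wedge X.actL φ.A₂ φ.C₃ + wedge X.lift φ.B₂ φ.B₃ + wedge X.lift φ.B₃ φ.B₂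

theorem 𝓕_fst : (φ.𝓕 X k).1 = φ.F₁ X k := by
  have h : (φ.𝓕 X k).1 = d φ.A₁ + (-1 : ℝ) ^ ((1 : ℤ) + 1) • k • φ.A₂ +
      (1 / 2 : ℝ) • wedge (bracket 𝕜 𝔤) φ.A₁ φ.A₁ - mapForm (X.α : 𝔥 →ₗ[𝕜] 𝔤) φ.B₂ := rfl
  rw [h, F₁, 𝔽, show (-1 : ℝ) ^ ((1 : ℤ) + 1) = 1 by norm_num, one_smul]
  abel

theorem wedge_bracket_comm {p q r : ℤ} (a : Form I M 𝔤 p) (b : Form I M 𝔤 q) (h : p + q = r) :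
    wedge (bracket 𝕜 𝔤) a b h = -((-1 : ℝ) ^ (p * q) • wedge (bracket 𝕜 𝔤) b a (by omega)) := by
  rw [wedge_comm (bracket 𝕜 𝔤) (-bracket 𝕜 𝔤) (fun v w => by
    change ⁅v, w⁆ = -⁅w, v⁆
    rw [lie_skew]), wedge_neg_bilin, smul_neg]

/-- The two mixed terms of `½ 𝒜 ∧ 𝒜` are equal: the antisymmetry of the bracket cancels the sign
`(-1)^1` of the generalized product. Hence the coefficient of `A₁ ∧ A₂` is one. -/
theorem 𝓕_snd : (φ.𝓕 X k).2 = φ.F₂ X := by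
  have h : (φ.𝓕 X k).2 = d φ.A₂ + (1 / 2 : ℝ) • (wedge (bracket 𝕜 𝔤) φ.A₁ φ.A₂ +
      (-1 : ℝ) ^ (1 : ℤ) • wedge (bracket 𝕜 𝔤) φ.A₂ φ.A₁) - mapForm (X.α : 𝔥 →ₗ[𝕜] 𝔤) φ.B₃ := rfl
  rw [h, F₂, Dg, wedge_bracket_comm φ.A₂ φ.A₁]
  norm_num
  module

theorem 𝓖_fst : (φ.𝓖 X k).1 = φ.G₁ X k := by
  have h : (φ.𝓖 X k).1 = d φ.B₂ + (-1 : ℝ) ^ ((2 : ℤ) + 1) • k • φ.B₃ +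
      wedge X.actH φ.A₁ φ.B₂ - mapForm (X.β : 𝔩 →ₗ[𝕜] 𝔥) φ.C₃ := rfl
  rw [h, G₁, 𝔾, show (-1 : ℝ) ^ ((2 : ℤ) + 1) = -1 by norm_num, neg_one_smul]
  abel

theorem 𝓖_snd : (φ.𝓖 X k).2 = φ.G₂ X := by
  have h : (φ.𝓖 X k).2 = d φ.B₃ + (wedge X.actH φ.A₁ φ.B₃ +
      (-1 : ℝ) ^ (2 : ℤ) • wedge X.actH φ.A₂ φ.B₂) - mapForm (X.β : 𝔩 →ₗ[𝕜] 𝔥) φ.C₄ := rfl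
  rw [h, G₂, Dh, show (-1 : ℝ) ^ (2 : ℤ) = 1 by norm_num, one_smul, add_assoc]

theorem 𝓗_fst : (φ.𝓗 X k).1 = φ.H₁ X k := by
  have h : (φ.𝓗 X k).1 = d φ.C₃ + (-1 : ℝ) ^ ((3 : ℤ) + 1) • k • φ.C₄ +
      wedge X.actL φ.A₁ φ.C₃ + wedge X.lift φ.B₂ φ.B₂ := rfl
  rw [h, H₁, ℍ, show (-1 : ℝ) ^ ((3 : ℤ) + 1) = 1 by norm_num, one_smul]
  abel

set_option maxRecDepth 4000 in
theorem 𝓗_snd : (φ.𝓗 X k).2 = φ.H₂ X := by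
  have h : (φ.𝓗 X k).2 = d φ.C₄ + (wedge X.actL φ.A₁ φ.C₄ +
      (-1 : ℝ) ^ (3 : ℤ) • wedge X.actL φ.A₂ φ.C₃) + (wedge X.lift φ.B₂ φ.B₃ +
      (-1 : ℝ) ^ (2 : ℤ) • wedge X.lift φ.B₃ φ.B₂) := rfl
  rw [h, H₂, Dl, show (-1 : ℝ) ^ (2 : ℤ) = 1 by norm_num, one_smul,
    show (-1 : ℝ) ^ (3 : ℤ) = -1 by norm_num]
  module

/-- The Lagrangian in terms of the components of the curvatures. -/
def density : Form I M 𝕜 n :=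
  wedge P.Bg (φ.F₁ X k) (φ.sF₁ X k g o) + wedge P.Bg (φ.F₂ X) (φ.sF₂ X g o) +
  wedge P.Bh (φ.G₁ X k) (φ.sG₁ X k g o) + wedge P.Bh (φ.G₂ X) (φ.sG₂ X g o) +
  wedge P.Bl (φ.H₁ X k) (φ.sH₁ X k g o) + wedge P.Bl (φ.H₂ X) (φ.sH₂ X g o)

end Generalized3Connection

/-- The sign `(-1)^q` of the generalized product and the sign `(-1)^{n-p-1}` of the generalized star
agree since `q = n - p - 1`, so their product is one. The degrees `r + 1` and `n` are equal only
propositionally; the identity is therefore stated for the component of natural degree `m`. -/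
theorem gwedge_gstar_snd_apply {V U : Type*} [NormedAddCommGroup V] [NormedSpace ℝ V]
    [NormedAddCommGroup U] [NormedSpace ℝ U] [Module 𝕜 V] [Module 𝕜 U]
    [IsScalarTower ℝ 𝕜 V] [IsScalarTower ℝ 𝕜 U]
    (g : PseudoRiemannianMetric I M) (o : OrientationForm I M) (B : V →ₗ[𝕜] V →ₗ[𝕜] U)
    {p p' q r s s' : ℤ} (a : GForm I M V p) (hq : p + q + 1 = n) (hr : p + q = r) {m : ℕ}
    (hm : (m : ℤ) = r + 1) (a' : Form I M V p') (ha : ∀ (m : ℕ) hm hm', a.2 ⟨m, hm⟩ = a' ⟨m, hm'⟩)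
    (hp' : p + 1 = p') (hs : p + s = n) (hs' : p' + s' = n) (hn : (m : ℤ) = n) :
    (gwedge B a (gstar g o a hq) hr).2 ⟨m, hm⟩ =
      (wedge B a.1 (star g o a.1 hs) hs + wedge B a' (star g o a' hs') hs' : Form I M U n)
        ⟨m, hn⟩ := by
  subst hp'
  obtain rfl : a' = a.2 := funext fun m => (ha _ _ _).symm
  obtain rfl : s = s' + 1 := by omega
  obtain rfl : q = s' := by omega
  have hn' : (n : ℤ) = r + 1 := by omega
  -- With the target degree a variable `N`, it can be identified with `r + 1` by substitution, which
  -- is impossible for the cast of `n`.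
  have key : ∀ {N : ℤ} (hN : N = r + 1) (hmN : (m : ℤ) = N) (h1 : p + (q + 1) = N)
      (h2 : p + 1 + q = N) (h1' : p + (q + 1) = n) (h2' : p + 1 + q = n),
      (gwedge B a (gstar g o a hq) hr).2 ⟨m, hm⟩ = (wedge B a.1 (star g o a.1 h1') h1 +
        wedge B a.2 (star g o a.2 h2') h2 : Form I M U N) ⟨m, hmN⟩ := by
    rintro N rfl hmN h1 h2 h1' h2'
    have e : (gwedge B a (gstar g o a hq) hr).2 = wedge B a.1 (star g o a.1 h1') h1 +
        (-1 : ℝ) ^ q • wedge B a.2 ((-1 : ℝ) ^ ((n : ℤ) - p - 1) • star g o a.2 h2') h2 := rfl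
    rw [e, wedge_real_smul_right, smul_smul, show (n : ℤ) - p - 1 = q by omega, ← mul_zpow]
    norm_num
  exact key hn' hn _ _ _ _

namespace Generalized3Connection

variable (X : Differential2CrossedModule 𝕜 𝔤 𝔥 𝔩) (P : InvariantForms X) (k : 𝕜)
  (g : PseudoRiemannianMetric I M) (o : OrientationForm I M)
  (φ δφ : Generalized3Connection 𝔤 𝔥 𝔩 I M)

-- Here the generalized theory becomes an ordinary one: from now on the action is the integral of
-- `density`, a sum of six terms of the form `⟨x, ∗x⟩`.
set_option maxRecDepth 10000 in
theorem lagrangian_snd_apply (h : (n : ℤ) = (n : ℤ) - 1 + 1) :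
    (φ.lagrangian X P k g o).2 ⟨n, h⟩ = φ.density X P k g o ⟨n, rfl⟩ := by
  have e1 := gwedge_gstar_snd_apply g o P.Bg (s := n - 2) (s' := n - 3) (φ.𝓕 X k)
    (show (2 : ℤ) + (n - 3) + 1 = n by omega) (show (2 : ℤ) + (n - 3) = n - 1 by omega) h
    (φ.F₂ X) (fun m hm hm' => by rw [𝓕_snd]) rfl (by omega) (by omega) rfl
  have e2 := gwedge_gstar_snd_apply g o P.Bh (s := n - 3) (s' := n - 4) (φ.𝓖 X k)
    (show (3 : ℤ) + (n - 4) + 1 = n by omega) (show (3 : ℤ) + (n - 4) = n - 1 by omega) h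
    (φ.G₂ X) (fun m hm hm' => by rw [𝓖_snd]) rfl (by omega) (by omega) rfl
  have e3 := gwedge_gstar_snd_apply g o P.Bl (s := n - 4) (s' := n - 5) (φ.𝓗 X k)
    (show (4 : ℤ) + (n - 5) + 1 = n by omega) (show (4 : ℤ) + (n - 5) = n - 1 by omega) h
    (φ.H₂ X) (fun m hm hm' => by rw [𝓗_snd]) rfl (by omega) (by omega) rfl
  rw [𝓕_fst] at e1
  rw [𝓖_fst] at e2
  rw [𝓗_fst] at e3
  have key : ∀ {G : Type _} [AddCommGroup G] (a b c d e f : G),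
      a + b + c + d + e + f = a + b + (c + d) + (e + f) := fun a b c d e f => by abel
  rw [density, key, Pi.add_apply, Pi.add_apply]
  rw [sF₁, sF₂, sG₁, sG₂, sH₁, sH₂]
  refine Eq.trans ?_ (congrArg₂ (· + ·) (congrArg₂ (· + ·) e1 e2) e3)
  rfl

end Generalized3Connection
end YangMills

/-! ### Exact quadratic expansion of the curvatures. -/

section YangMills

variable {𝕜 : Type*} [RCLike 𝕜] {𝔤 𝔥 𝔩 : Type*}
  [NormedLieRing 𝔤] [NormedLieAlgebra 𝕜 𝔤] [NormedSpace ℝ 𝔤] [IsScalarTower ℝ 𝕜 𝔤]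
  [NormedLieRing 𝔥] [NormedLieAlgebra 𝕜 𝔥] [NormedSpace ℝ 𝔥] [IsScalarTower ℝ 𝕜 𝔥]
  [NormedLieRing 𝔩] [NormedLieAlgebra 𝕜 𝔩] [NormedSpace ℝ 𝔩] [IsScalarTower ℝ 𝕜 𝔩]
  [FiniteDimensional 𝕜 𝔤] [FiniteDimensional 𝕜 𝔥] [FiniteDimensional 𝕜 𝔩]
  [FiniteDimensional ℝ 𝔤] [FiniteDimensional ℝ 𝔥] [FiniteDimensional ℝ 𝔩]
  {n : ℕ} {H : Type*} [TopologicalSpace H]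
  {I : ModelWithCorners ℝ (EuclideanSpace ℝ (Fin n)) H}
  {M : Type*} [TopologicalSpace M] [ChartedSpace H M] [IsManifold I ∞ M]

namespace Generalized3Connection

variable (X : Differential2CrossedModule 𝕜 𝔤 𝔥 𝔩) (P : InvariantForms X) (k : 𝕜)
  (g : PseudoRiemannianMetric I M) (o : OrientationForm I M)
  (φ δφ : Generalized3Connection 𝔤 𝔥 𝔩 I M)

/-! ### Linear and quadratic parts of the varied curvatures -/

/-- The first-order change of `F₁`. -/
def linF₁ : Form I M 𝔤 2 :=
  φ.Dg 𝕜 δφ.A₁ - mapForm (X.α : 𝔥 →ₗ[𝕜] 𝔤) δφ.B₂ + k • δφ.A₂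

/-- The first-order change of `F₂`. -/
def linF₂ : Form I M 𝔤 3 :=
  φ.Dg 𝕜 δφ.A₂ + wedge (bracket 𝕜 𝔤) δφ.A₁ φ.A₂ - mapForm (X.α : 𝔥 →ₗ[𝕜] 𝔤) δφ.B₃

/-- The first-order change of `G₁`. -/
def linG₁ : Form I M 𝔥 3 :=
  φ.Dh X δφ.B₂ + wedge X.actH δφ.A₁ φ.B₂ - mapForm (X.β : 𝔩 →ₗ[𝕜] 𝔥) δφ.C₃ - k • δφ.B₃

/-- The first-order change of `G₂`. -/
def linG₂ : Form I M 𝔥 4 :=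
  φ.Dh X δφ.B₃ + wedge X.actH δφ.A₁ φ.B₃ + wedge X.actH φ.A₂ δφ.B₂ + wedge X.actH δφ.A₂ φ.B₂
    - mapForm (X.β : 𝔩 →ₗ[𝕜] 𝔥) δφ.C₄

/-- The first-order change of `H₁`. -/
def linH₁ : Form I M 𝔩 4 :=
  φ.Dl X δφ.C₃ + wedge X.actL δφ.A₁ φ.C₃ + wedge X.lift φ.B₂ δφ.B₂ + wedge X.lift δφ.B₂ φ.B₂
    + k • δφ.C₄

/-- The first-order change of `H₂`. -/
def linH₂ : Form I M 𝔩 5 :=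
  φ.Dl X δφ.C₄ + wedge X.actL δφ.A₁ φ.C₄ - wedge X.actL φ.A₂ δφ.C₃ - wedge X.actL δφ.A₂ φ.C₃
    + wedge X.lift φ.B₂ δφ.B₃ + wedge X.lift δφ.B₂ φ.B₃ + wedge X.lift φ.B₃ δφ.B₂
    + wedge X.lift δφ.B₃ φ.B₂

variable (𝕜) in
/-- The second-order change of `F₁`. -/
def quadF₁ : Form I M 𝔤 2 := (1 / 2 : ℝ) • wedge (bracket 𝕜 𝔤) δφ.A₁ δφ.A₁

variable (𝕜) in
/-- The second-order change of `F₂`. -/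
def quadF₂ : Form I M 𝔤 3 := wedge (bracket 𝕜 𝔤) δφ.A₁ δφ.A₂

/-- The second-order change of `G₁`. -/
def quadG₁ : Form I M 𝔥 3 := wedge X.actH δφ.A₁ δφ.B₂

/-- The second-order change of `G₂`. -/
def quadG₂ : Form I M 𝔥 4 := wedge X.actH δφ.A₁ δφ.B₃ + wedge X.actH δφ.A₂ δφ.B₂

/-- The second-order change of `H₁`. -/
def quadH₁ : Form I M 𝔩 4 := wedge X.actL δφ.A₁ δφ.C₃ + wedge X.lift δφ.B₂ δφ.B₂

/-- The second-order change of `H₂`. -/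
def quadH₂ : Form I M 𝔩 5 :=
  wedge X.actL δφ.A₁ δφ.C₄ - wedge X.actL δφ.A₂ δφ.C₃ + wedge X.lift δφ.B₂ δφ.B₃
    + wedge X.lift δφ.B₃ δφ.B₂

variable {φ δφ}

/-- The curvature is at most quadratic in the fields, so the expansion has no remainder. The two
mixed bracket terms coincide because one-forms anticommute and the bracket is antisymmetric, which
removes the factor `½`. -/
theorem F₁_vary (hφ : φ.Smooth) (hδ : δφ.Smooth) (t : ℝ) :
    (φ.vary δφ t).F₁ X k = φ.F₁ X k + t • φ.linF₁ X k δφ + t ^ 2 • quadF₁ 𝕜 δφ := by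
  obtain ⟨h1, h2, h3, h4, h5, h6⟩ := hφ
  obtain ⟨k1, k2, k3, k4, k5, k6⟩ := hδ
  simp only [F₁, 𝔽, linF₁, quadF₁, vary, Dg, d_add h1 (k1.real_smul t), d_real_smul t k1,
    wedge_add_left, wedge_add_right, wedge_real_smul_left, wedge_real_smul_right, mapForm_add,
    mapForm_real_smul, smul_add, smul_comm k t]
  rw [wedge_bracket_comm δφ.A₁ φ.A₁]
  -- Hides the scalars in `𝕜`, so that the remaining identity is linear over `ℝ`.
  generalize k • φ.A₂ = u
  generalize k • δφ.A₂ = v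
  norm_num
  module

theorem F₂_vary (hφ : φ.Smooth) (hδ : δφ.Smooth) (t : ℝ) :
    (φ.vary δφ t).F₂ X = φ.F₂ X + t • φ.linF₂ X δφ + t ^ 2 • quadF₂ 𝕜 δφ := by
  obtain ⟨h1, h2, h3, h4, h5, h6⟩ := hφ
  obtain ⟨k1, k2, k3, k4, k5, k6⟩ := hδ
  simp only [F₂, linF₂, quadF₂, vary, Dg, d_add h2 (k2.real_smul t), d_real_smul t k2,
    wedge_add_left, wedge_add_right, wedge_real_smul_left, wedge_real_smul_right, mapForm_add,
    mapForm_real_smul]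
  module

theorem G₁_vary (hφ : φ.Smooth) (hδ : δφ.Smooth) (t : ℝ) :
    (φ.vary δφ t).G₁ X k = φ.G₁ X k + t • φ.linG₁ X k δφ + t ^ 2 • quadG₁ X δφ := by
  obtain ⟨h1, h2, h3, h4, h5, h6⟩ := hφ
  obtain ⟨k1, k2, k3, k4, k5, k6⟩ := hδ
  simp only [G₁, 𝔾, linG₁, quadG₁, vary, Dh, d_add h3 (k3.real_smul t), d_real_smul t k3,
    wedge_add_left, wedge_add_right, wedge_real_smul_left, wedge_real_smul_right, mapForm_add,
    mapForm_real_smul, smul_add k, smul_comm k t]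
  generalize k • φ.B₃ = u
  generalize k • δφ.B₃ = v
  module

theorem G₂_vary (hφ : φ.Smooth) (hδ : δφ.Smooth) (t : ℝ) :
    (φ.vary δφ t).G₂ X = φ.G₂ X + t • φ.linG₂ X δφ + t ^ 2 • quadG₂ X δφ := by
  obtain ⟨h1, h2, h3, h4, h5, h6⟩ := hφ
  obtain ⟨k1, k2, k3, k4, k5, k6⟩ := hδ
  simp only [G₂, linG₂, quadG₂, vary, Dh, d_add h4 (k4.real_smul t), d_real_smul t k4,
    wedge_add_left, wedge_add_right, wedge_real_smul_left, wedge_real_smul_right, mapForm_add,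
    mapForm_real_smul]
  module

theorem H₁_vary (hφ : φ.Smooth) (hδ : δφ.Smooth) (t : ℝ) :
    (φ.vary δφ t).H₁ X k = φ.H₁ X k + t • φ.linH₁ X k δφ + t ^ 2 • quadH₁ X δφ := by
  obtain ⟨h1, h2, h3, h4, h5, h6⟩ := hφ
  obtain ⟨k1, k2, k3, k4, k5, k6⟩ := hδ
  simp only [H₁, ℍ, linH₁, quadH₁, vary, Dl, d_add h5 (k5.real_smul t), d_real_smul t k5,
    wedge_add_left, wedge_add_right, wedge_real_smul_left, wedge_real_smul_right,
    smul_add k, smul_comm k t]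
  generalize k • φ.C₄ = u
  generalize k • δφ.C₄ = v
  module

theorem H₂_vary (hφ : φ.Smooth) (hδ : δφ.Smooth) (t : ℝ) :
    (φ.vary δφ t).H₂ X = φ.H₂ X + t • φ.linH₂ X δφ + t ^ 2 • quadH₂ X δφ := by
  obtain ⟨h1, h2, h3, h4, h5, h6⟩ := hφ
  obtain ⟨k1, k2, k3, k4, k5, k6⟩ := hδ
  simp only [H₂, linH₂, quadH₂, vary, Dl, d_add h6 (k6.real_smul t), d_real_smul t k6,
    wedge_add_left, wedge_add_right, wedge_real_smul_left, wedge_real_smul_right]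
  module

end Generalized3Connection
end YangMills

/-! ### Expansion of the action and reduction of stationarity to its linear term. -/

section YangMills

variable {𝕜 : Type*} [RCLike 𝕜] {𝔤 𝔥 𝔩 : Type*}
  [NormedLieRing 𝔤] [NormedLieAlgebra 𝕜 𝔤] [NormedSpace ℝ 𝔤] [IsScalarTower ℝ 𝕜 𝔤]
  [NormedLieRing 𝔥] [NormedLieAlgebra 𝕜 𝔥] [NormedSpace ℝ 𝔥] [IsScalarTower ℝ 𝕜 𝔥]
  [NormedLieRing 𝔩] [NormedLieAlgebra 𝕜 𝔩] [NormedSpace ℝ 𝔩] [IsScalarTower ℝ 𝕜 𝔩]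
  [FiniteDimensional 𝕜 𝔤] [FiniteDimensional 𝕜 𝔥] [FiniteDimensional 𝕜 𝔩]
  [FiniteDimensional ℝ 𝔤] [FiniteDimensional ℝ 𝔥] [FiniteDimensional ℝ 𝔩]
  {n : ℕ} {H : Type*} [TopologicalSpace H]
  {I : ModelWithCorners ℝ (EuclideanSpace ℝ (Fin n)) H}
  {M : Type*} [TopologicalSpace M] [ChartedSpace H M] [IsManifold I ∞ M]
  [T2Space M] [SigmaCompactSpace M]

namespace Generalized3Connection

variable (X : Differential2CrossedModule 𝕜 𝔤 𝔥 𝔩) (P : InvariantForms X) (k : 𝕜)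
  (g : PseudoRiemannianMetric I M) (o : OrientationForm I M)
  (φ δφ : Generalized3Connection 𝔤 𝔥 𝔩 I M)

/-- All six component fields are smooth and vanish outside `K`. -/
def SmoothSupp (K : Set M) (φ : Generalized3Connection 𝔤 𝔥 𝔩 I M) : Prop :=
  GYM.SmoothSupp K φ.A₁ ∧ GYM.SmoothSupp K φ.A₂ ∧ GYM.SmoothSupp K φ.B₂ ∧
    GYM.SmoothSupp K φ.B₃ ∧ GYM.SmoothSupp K φ.C₃ ∧ GYM.SmoothSupp K φ.C₄

variable {φ δφ} {K : Set M}

theorem SmoothSupp.smooth (h : δφ.SmoothSupp K) : δφ.Smooth :=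
  ⟨h.1.1, h.2.1.1, h.2.2.1.1, h.2.2.2.1.1, h.2.2.2.2.1.1, h.2.2.2.2.2.1⟩

theorem IsTest.exists_smoothSupp (h : δφ.IsTest) :
    ∃ K : Set M, IsCompact K ∧ K ⊆ I.interior M ∧ δφ.SmoothSupp K := by
  obtain ⟨h1, h2, h3, h4, h5, h6⟩ := h
  obtain ⟨K1, c1, i1, s1⟩ := h1.exists_smoothSupp
  obtain ⟨K2, c2, i2, s2⟩ := h2.exists_smoothSupp
  obtain ⟨K3, c3, i3, s3⟩ := h3.exists_smoothSupp
  obtain ⟨K4, c4, i4, s4⟩ := h4.exists_smoothSupp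
  obtain ⟨K5, c5, i5, s5⟩ := h5.exists_smoothSupp
  obtain ⟨K6, c6, i6, s6⟩ := h6.exists_smoothSupp
  refine ⟨K1 ∪ K2 ∪ K3 ∪ K4 ∪ K5 ∪ K6,
    ((((c1.union c2).union c3).union c4).union c5).union c6, ?_, s1.mono ?_, s2.mono ?_, s3.mono ?_,
    s4.mono ?_, s5.mono ?_, s6.mono ?_⟩
  · simp only [Set.union_subset_iff]
    exact ⟨⟨⟨⟨⟨i1, i2⟩, i3⟩, i4⟩, i5⟩, i6⟩
  all_goals
    intro x hx
    simp only [Set.mem_union]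
    tauto

theorem Smooth.F₁ (h : φ.Smooth) : GYM.Smooth (φ.F₁ X k) :=
  (((h.1.d _).add ((h.1.wedge _ h.1 _).real_smul _)).sub (h.2.2.1.mapForm _)).add (h.2.1.smul k)

theorem Smooth.F₂ (h : φ.Smooth) : GYM.Smooth (φ.F₂ X) :=
  ((h.2.1.d _).add (h.1.wedge _ h.2.1 _)).sub (h.2.2.2.1.mapForm _)

theorem Smooth.G₁ (h : φ.Smooth) : GYM.Smooth (φ.G₁ X k) :=
  (((h.2.2.1.d _).add (h.1.wedge _ h.2.2.1 _)).sub (h.2.2.2.2.1.mapForm _)).sub (h.2.2.2.1.smul k)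

theorem Smooth.G₂ (h : φ.Smooth) : GYM.Smooth (φ.G₂ X) :=
  (((h.2.2.2.1.d _).add (h.1.wedge _ h.2.2.2.1 _)).add (h.2.1.wedge _ h.2.2.1 _)).sub
    (h.2.2.2.2.2.mapForm _)

theorem Smooth.H₁ (h : φ.Smooth) : GYM.Smooth (φ.H₁ X k) :=
  (((h.2.2.2.2.1.d _).add (h.1.wedge _ h.2.2.2.2.1 _)).add (h.2.2.1.wedge _ h.2.2.1 _)).add
    (h.2.2.2.2.2.smul k)

theorem Smooth.H₂ (h : φ.Smooth) : GYM.Smooth (φ.H₂ X) :=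
  ((((h.2.2.2.2.2.d _).add (h.1.wedge _ h.2.2.2.2.2 _)).sub (h.2.1.wedge _ h.2.2.2.2.1 _)).add
    (h.2.2.1.wedge _ h.2.2.2.1 _)).add (h.2.2.2.1.wedge _ h.2.2.1 _)

theorem Smooth.linF₁ (h : φ.Smooth) (hK : IsClosed K) (hδ : δφ.SmoothSupp K) :
    GYM.SmoothSupp K (φ.linF₁ X k δφ) := by
  obtain ⟨h1, h2, h3, h4, h5, h6⟩ := h
  obtain ⟨k1, k2, k3, k4, k5, k6⟩ := hδ
  exact (((k1.d hK _).add (.wedge_right _ h1 k1 _)).sub (k3.mapForm _)).add (k2.smul k)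

theorem Smooth.linF₂ (h : φ.Smooth) (hK : IsClosed K) (hδ : δφ.SmoothSupp K) :
    GYM.SmoothSupp K (φ.linF₂ X δφ) := by
  obtain ⟨h1, h2, h3, h4, h5, h6⟩ := h
  obtain ⟨k1, k2, k3, k4, k5, k6⟩ := hδ
  exact (((k2.d hK _).add (.wedge_right _ h1 k2 _)).add (k1.wedge_left _ h2 _)).sub (k4.mapForm _)

theorem Smooth.linG₁ (h : φ.Smooth) (hK : IsClosed K) (hδ : δφ.SmoothSupp K) :
    GYM.SmoothSupp K (φ.linG₁ X k δφ) := by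
  obtain ⟨h1, h2, h3, h4, h5, h6⟩ := h
  obtain ⟨k1, k2, k3, k4, k5, k6⟩ := hδ
  exact ((((k3.d hK _).add (.wedge_right _ h1 k3 _)).add (k1.wedge_left _ h3 _)).sub
    (k5.mapForm _)).sub (k4.smul k)

theorem Smooth.linG₂ (h : φ.Smooth) (hK : IsClosed K) (hδ : δφ.SmoothSupp K) :
    GYM.SmoothSupp K (φ.linG₂ X δφ) := by
  obtain ⟨h1, h2, h3, h4, h5, h6⟩ := h
  obtain ⟨k1, k2, k3, k4, k5, k6⟩ := hδ
  exact (((((k4.d hK _).add (.wedge_right _ h1 k4 _)).add (k1.wedge_left _ h4 _)).add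
    (.wedge_right _ h2 k3 _)).add (k2.wedge_left _ h3 _)).sub (k6.mapForm _)

theorem Smooth.linH₁ (h : φ.Smooth) (hK : IsClosed K) (hδ : δφ.SmoothSupp K) :
    GYM.SmoothSupp K (φ.linH₁ X k δφ) := by
  obtain ⟨h1, h2, h3, h4, h5, h6⟩ := h
  obtain ⟨k1, k2, k3, k4, k5, k6⟩ := hδ
  exact (((((k5.d hK _).add (.wedge_right _ h1 k5 _)).add (k1.wedge_left _ h5 _)).add
    (.wedge_right _ h3 k3 _)).add (k3.wedge_left _ h3 _)).add (k6.smul k)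

theorem Smooth.linH₂ (h : φ.Smooth) (hK : IsClosed K) (hδ : δφ.SmoothSupp K) :
    GYM.SmoothSupp K (φ.linH₂ X δφ) := by
  obtain ⟨h1, h2, h3, h4, h5, h6⟩ := h
  obtain ⟨k1, k2, k3, k4, k5, k6⟩ := hδ
  exact ((((((((k6.d hK _).add (.wedge_right _ h1 k6 _)).add (k1.wedge_left _ h6 _)).sub
    (.wedge_right _ h2 k5 _)).sub (k2.wedge_left _ h5 _)).add (.wedge_right _ h3 k4 _)).add
    (k3.wedge_left _ h4 _)).add (.wedge_right _ h4 k3 _)).add (k4.wedge_left _ h3 _)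

theorem SmoothSupp.quad (hδ : δφ.SmoothSupp K) :
    GYM.SmoothSupp K (quadF₁ 𝕜 δφ) ∧ GYM.SmoothSupp K (quadF₂ 𝕜 δφ) ∧
    GYM.SmoothSupp K (quadG₁ X δφ) ∧ GYM.SmoothSupp K (quadG₂ X δφ) ∧
    GYM.SmoothSupp K (quadH₁ X δφ) ∧ GYM.SmoothSupp K (quadH₂ X δφ) := by
  obtain ⟨k1, k2, k3, k4, k5, k6⟩ := hδ
  exact ⟨(k1.wedge_left _ k1.1 _).real_smul _, k1.wedge_left _ k2.1 _, k1.wedge_left _ k3.1 _,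
    (k1.wedge_left _ k4.1 _).add (k2.wedge_left _ k3.1 _),
    (k1.wedge_left _ k5.1 _).add (k3.wedge_left _ k3.1 _),
    (((k1.wedge_left _ k6.1 _).sub (k2.wedge_left _ k5.1 _)).add (k3.wedge_left _ k4.1 _)).add
      (k4.wedge_left _ k3.1 _)⟩

variable (φ δφ)

/-- Half of the first-order change of the Lagrangian. -/
def linDensity : Form I M 𝕜 n :=
  wedge P.Bg (φ.linF₁ X k δφ) (φ.sF₁ X k g o) + wedge P.Bg (φ.linF₂ X δφ) (φ.sF₂ X g o) +
  wedge P.Bh (φ.linG₁ X k δφ) (φ.sG₁ X k g o) + wedge P.Bh (φ.linG₂ X δφ) (φ.sG₂ X g o) +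
  wedge P.Bl (φ.linH₁ X k δφ) (φ.sH₁ X k g o) + wedge P.Bl (φ.linH₂ X δφ) (φ.sH₂ X g o)

variable {φ δφ}

set_option maxRecDepth 10000 in
theorem smoothSupp_linDensity (h : φ.Smooth) (hK : IsClosed K) (hδ : δφ.SmoothSupp K) :
    GYM.SmoothSupp K (φ.linDensity X P k g o δφ) :=
  ((((((h.linF₁ X k hK hδ).wedge_left _ ((h.F₁ X k).star g o _) _).add
    ((h.linF₂ X hK hδ).wedge_left _ ((h.F₂ X).star g o _) _)).add
    ((h.linG₁ X k hK hδ).wedge_left _ ((h.G₁ X k).star g o _) _)).add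
    ((h.linG₂ X hK hδ).wedge_left _ ((h.G₂ X).star g o _) _)).add
    ((h.linH₁ X k hK hδ).wedge_left _ ((h.H₁ X k).star g o _) _)).add
    ((h.linH₂ X hK hδ).wedge_left _ ((h.H₂ X).star g o _) _)

set_option maxRecDepth 10000 in
/-- The expansion of the Lagrangian along a variation. -/
theorem exists_density_vary (h : φ.Smooth) (hK : IsClosed K) (hδ : δφ.SmoothSupp K) :
    ∃ P₂ P₃ P₄ : Form I M 𝕜 n, GYM.SmoothSupp K P₂ ∧ GYM.SmoothSupp K P₃ ∧
      GYM.SmoothSupp K P₄ ∧ ∀ t : ℝ,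
      (φ.vary δφ t).density X P k g o - φ.density X P k g o =
        t • (2 : ℝ) • φ.linDensity X P k g o δφ + t ^ 2 • P₂ + t ^ 3 • P₃ + t ^ 4 • P₄ := by
  obtain ⟨q1, q2, q3, q4, q5, q6⟩ := hδ.quad X
  obtain ⟨a2, a3, a4, ha2, ha3, ha4, ha⟩ := exists_wedge_star_expansion g o P.Bg P.symm_g
    (h.F₁ X k) (h.linF₁ X k hK hδ) q1 (r := n - 2) (by omega)
  obtain ⟨b2, b3, b4, hb2, hb3, hb4, hb⟩ := exists_wedge_star_expansion g o P.Bg P.symm_g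
    (h.F₂ X) (h.linF₂ X hK hδ) q2 (r := n - 3) (by omega)
  obtain ⟨c2, c3, c4, hc2, hc3, hc4, hc⟩ := exists_wedge_star_expansion g o P.Bh P.symm_h
    (h.G₁ X k) (h.linG₁ X k hK hδ) q3 (r := n - 3) (by omega)
  obtain ⟨d2, d3, d4, hd2, hd3, hd4, hd⟩ := exists_wedge_star_expansion g o P.Bh P.symm_h
    (h.G₂ X) (h.linG₂ X hK hδ) q4 (r := n - 4) (by omega)
  obtain ⟨e2, e3, e4, he2, he3, he4, he⟩ := exists_wedge_star_expansion g o P.Bl P.symm_l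
    (h.H₁ X k) (h.linH₁ X k hK hδ) q5 (r := n - 4) (by omega)
  obtain ⟨f2, f3, f4, hf2, hf3, hf4, hf⟩ := exists_wedge_star_expansion g o P.Bl P.symm_l
    (h.H₂ X) (h.linH₂ X hK hδ) q6 (r := n - 5) (by omega)
  refine ⟨a2 + b2 + c2 + d2 + e2 + f2, a3 + b3 + c3 + d3 + e3 + f3, a4 + b4 + c4 + d4 + e4 + f4,
    ((((ha2.add hb2).add hc2).add hd2).add he2).add hf2,
    ((((ha3.add hb3).add hc3).add hd3).add he3).add hf3,
    ((((ha4.add hb4).add hc4).add hd4).add he4).add hf4, fun t => ?_⟩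
  have hs := hδ.smooth
  specialize ha t
  specialize hb t
  specialize hc t
  specialize hd t
  specialize he t
  specialize hf t
  rw [← F₁_vary X k h hs] at ha
  rw [← F₂_vary X h hs] at hb
  rw [← G₁_vary X k h hs] at hc
  rw [← G₂_vary X h hs] at hd
  rw [← H₁_vary X k h hs] at he
  rw [← H₂_vary X h hs] at hf
  -- The six expansions are added in an abstract module, so that the large terms need not be
  -- inspected.
  have key : ∀ {G : Type _} [AddCommGroup G] [Module ℝ G]
      {w₁ w₂ w₃ w₄ w₅ w₆ x₁ x₂ x₃ x₄ x₅ x₆ y₁ y₂ y₃ y₄ y₅ y₆ a2 a3 a4 b2 b3 b4 c2 c3 c4 d2 d3 d4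
        e2 e3 e4 f2 f3 f4 : G},
      w₁ = x₁ + t • (2 : ℝ) • y₁ + t ^ 2 • a2 + t ^ 3 • a3 + t ^ 4 • a4 →
      w₂ = x₂ + t • (2 : ℝ) • y₂ + t ^ 2 • b2 + t ^ 3 • b3 + t ^ 4 • b4 →
      w₃ = x₃ + t • (2 : ℝ) • y₃ + t ^ 2 • c2 + t ^ 3 • c3 + t ^ 4 • c4 →
      w₄ = x₄ + t • (2 : ℝ) • y₄ + t ^ 2 • d2 + t ^ 3 • d3 + t ^ 4 • d4 →
      w₅ = x₅ + t • (2 : ℝ) • y₅ + t ^ 2 • e2 + t ^ 3 • e3 + t ^ 4 • e4 →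
      w₆ = x₆ + t • (2 : ℝ) • y₆ + t ^ 2 • f2 + t ^ 3 • f3 + t ^ 4 • f4 →
      w₁ + w₂ + w₃ + w₄ + w₅ + w₆ - (x₁ + x₂ + x₃ + x₄ + x₅ + x₆) =
        t • (2 : ℝ) • (y₁ + y₂ + y₃ + y₄ + y₅ + y₆) + t ^ 2 • (a2 + b2 + c2 + d2 + e2 + f2) +
          t ^ 3 • (a3 + b3 + c3 + d3 + e3 + f3) + t ^ 4 • (a4 + b4 + c4 + d4 + e4 + f4) := by
    intro G _ _ _ _ _ _ _ _ _ _ _ _ _ _ _ _ _ _ _ _ _ _ _ _ _ _ _ _ _ _ _ _ _ _ _ _ _ _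
      h1 h2 h3 h4 h5 h6
    rw [h1, h2, h3, h4, h5, h6]
    module
  exact key ha hb hc hd he hf

theorem actionChange_eq (t : ℝ) : φ.actionChange X P k g o δφ t =
    integral o ((φ.vary δφ t).density X P k g o - φ.density X P k g o) rfl := by
  refine congrArg (nIntegral o) ?_
  exact congrArg₂ (· - ·) (lagrangian_snd_apply X P k g o (φ.vary δφ t) _)
    (lagrangian_snd_apply X P k g o φ _)

/-- Integrating the expansion makes the change of the action a polynomial in `t` without constant
term. It is differentiable with derivative `2 ∫ linDensity` at zero, and uniqueness of derivatives
gives the equivalence. Compactness of `K` is what allows the integral to be split. -/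
theorem stationary_iff (h : φ.Smooth) (hK : IsCompact K) (hδ : δφ.SmoothSupp K) :
    φ.Stationary X P k g o δφ ↔ integral o (φ.linDensity X P k g o δφ) rfl = 0 := by
  obtain ⟨P₂, P₃, P₄, h2, h3, h4, hP⟩ := exists_density_vary X P k g o h hK.isClosed hδ
  have hl := smoothSupp_linDensity X P k g o h hK.isClosed hδ
  have key : φ.actionChange X P k g o δφ = fun t : ℝ =>
      t • (2 : ℝ) • integral o (φ.linDensity X P k g o δφ) + t ^ 2 • integral o P₂ +
        t ^ 3 • integral o P₃ + t ^ 4 • integral o P₄ := by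
    funext t
    rw [actionChange_eq, hP, integral_add o hK _ (h4.real_smul _),
      integral_add o hK _ (h3.real_smul _), integral_add o hK _ (h2.real_smul _)]
    · simp only [integral_real_smul]
    · exact (hl.real_smul _).real_smul _
    · exact ((hl.real_smul _).real_smul _).add (h2.real_smul _)
    · exact (((hl.real_smul _).real_smul _).add (h2.real_smul _)).add (h3.real_smul _)
  have hd : HasDerivAt (φ.actionChange X P k g o δφ)
      ((2 : ℝ) • integral o (φ.linDensity X P k g o δφ)) (0 : ℝ) := by
    rw [key]
    have e := ((((hasDerivAt_id (0 : ℝ)).smul_const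
      ((2 : ℝ) • integral o (φ.linDensity X P k g o δφ))).add
      ((hasDerivAt_pow 2 (0 : ℝ)).smul_const (integral o P₂))).add
      ((hasDerivAt_pow 3 (0 : ℝ)).smul_const (integral o P₃))).add
      ((hasDerivAt_pow 4 (0 : ℝ)).smul_const (integral o P₄))
    refine e.congr_deriv ?_
    simp
  constructor
  · intro hs
    have := hd.unique hs
    simpa using this
  · intro h0
    rw [Stationary]
    rwa [h0, smul_zero] at hd

end Generalized3Connection
end YangMills

theorem neg_one_zpow_congr {a b : ℤ} (h : Even (a - b)) : (-1 : ℝ) ^ a = (-1 : ℝ) ^ b := by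
  rw [← sub_add_cancel a b, zpow_add₀ (by norm_num), h.neg_one_zpow, one_mul]

/-! ### Integration by parts for each curvature component. -/

section YangMills

variable {𝕜 : Type*} [RCLike 𝕜] {𝔤 𝔥 𝔩 : Type*}
  [NormedLieRing 𝔤] [NormedLieAlgebra 𝕜 𝔤] [NormedSpace ℝ 𝔤] [IsScalarTower ℝ 𝕜 𝔤]
  [NormedLieRing 𝔥] [NormedLieAlgebra 𝕜 𝔥] [NormedSpace ℝ 𝔥] [IsScalarTower ℝ 𝕜 𝔥]
  [NormedLieRing 𝔩] [NormedLieAlgebra 𝕜 𝔩] [NormedSpace ℝ 𝔩] [IsScalarTower ℝ 𝕜 𝔩]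
  [FiniteDimensional 𝕜 𝔤] [FiniteDimensional 𝕜 𝔥] [FiniteDimensional 𝕜 𝔩]
  [FiniteDimensional ℝ 𝔤] [FiniteDimensional ℝ 𝔥] [FiniteDimensional ℝ 𝔩]
  {n : ℕ} {H : Type*} [TopologicalSpace H]
  {I : ModelWithCorners ℝ (EuclideanSpace ℝ (Fin n)) H}
  {M : Type*} [TopologicalSpace M] [ChartedSpace H M] [IsManifold I ∞ M]

namespace Generalized3Connection

section

variable (X : Differential2CrossedModule 𝕜 𝔤 𝔥 𝔩) (P : InvariantForms X) (k : 𝕜)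
  {φ δφ : Generalized3Connection 𝔤 𝔥 𝔩 I M}

/-- Integration by parts at the level of forms, for an arbitrary smooth `E` that will be `∗F₁`. The
covariant derivative moves by invariance, `α` becomes `α*`, and the scalar `k` passes to `E`. The
sign of `Dg E` is plus because `δA₁` has odd degree. -/
theorem wedge_linF₁ (hδ : δφ.Smooth) {E : Form I M 𝔤 (n - 2)} (hE : GYM.Smooth E) :
    (wedge P.Bg (φ.linF₁ X k δφ) E : Form I M 𝕜 n) =
      d (wedge P.Bg δφ.A₁ E (by ring) : Form I M 𝕜 (n - 1)) +
        wedge P.Bg δφ.A₁ (φ.Dg 𝕜 E : Form I M 𝔤 (n - 1)) - wedge P.Bh δφ.B₂ (mapForm P.αs E) +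
        wedge P.Bg δφ.A₂ (k • E) := by
  rw [linF₁, Dg, wedge_add_left, wedge_sub_left,
    wedge_covariant_left P.Bg (bracket 𝕜 𝔤) P.invariant_g φ.A₁ hδ.1 hE (ps := n - 1) (s' := n - 1)
      _ _ (by omega) (by omega) (by omega) (by omega) _ (by omega),
    wedge_mapForm_left P.Bg P.Bh _ P.αs (fun v w => (P.αs_spec w v).symm), wedge_smul_left, Dg]
  norm_num

theorem wedge_linF₂ (hδ : δφ.Smooth) {E : Form I M 𝔤 (n - 3)} (hE : GYM.Smooth E) :
    (wedge P.Bg (φ.linF₂ X δφ) E : Form I M 𝕜 n) =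
      d (wedge P.Bg δφ.A₂ E : Form I M 𝕜 (n - 1)) -
        wedge P.Bg δφ.A₂ (φ.Dg 𝕜 E : Form I M 𝔤 (n - 2)) +
        wedge P.Bg δφ.A₁ (wedge (bracket 𝕜 𝔤) φ.A₂ E : Form I M 𝔤 (n - 1)) -
        wedge P.Bh δφ.B₃ (mapForm P.αs E) := by
  rw [linF₂, Dg, wedge_sub_left, wedge_add_left,
    wedge_covariant_left P.Bg (bracket 𝕜 𝔤) P.invariant_g φ.A₁ hδ.2.1 hE (ps := n - 1)
      (s' := n - 2) _ _ (by omega) (by omega) (by omega) (by omega) _ (by omega),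
    wedge_mapForm_left P.Bg P.Bh _ P.αs (fun v w => (P.αs_spec w v).symm), Dg,
    wedge_assoc (bracket 𝕜 𝔤) P.Bg (bracket 𝕜 𝔤) P.Bg (fun x y z => by
      change P.Bg ⁅x, y⁆ z = P.Bg x ⁅y, z⁆
      rw [← lie_skew, map_neg, LinearMap.neg_apply, P.invariant_g, neg_neg]) δφ.A₁ φ.A₂ E _ _
      (show 2 + ((n : ℤ) - 3) = n - 1 by omega) (by omega)]
  norm_num

/-- Moving `B₂` past `E` costs an even sign, so the only sign of the `σ`-term is the minus in the
definition of `σ`. -/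
theorem wedge_linG₁ (hδ : δφ.Smooth) {E : Form I M 𝔥 (n - 3)} (hE : GYM.Smooth E) :
    (wedge P.Bh (φ.linG₁ X k δφ) E : Form I M 𝕜 n) =
      d (wedge P.Bh δφ.B₂ E : Form I M 𝕜 (n - 1)) -
        wedge P.Bh δφ.B₂ (φ.Dh X E : Form I M 𝔥 (n - 2)) -
        wedge P.Bg δφ.A₁ (wedge P.σ E φ.B₂ : Form I M 𝔤 (n - 1)) -
        wedge P.Bl δφ.C₃ (mapForm P.βs E) - wedge P.Bh δφ.B₃ (k • E) := by
  rw [linG₁, Dh, wedge_sub_left, wedge_sub_left, wedge_add_left,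
    wedge_covariant_left P.Bh X.actH P.invariant_h φ.A₁ hδ.2.2.1 hE (ps := n - 1)
      (s' := n - 2) _ _ (by omega) (by omega) (by omega) (by omega) _ (by omega),
    wedge_mapForm_left P.Bh P.Bl _ P.βs (fun v w => (P.βs_spec w v).symm), wedge_smul_left, Dh,
    wedge_wedge_eq_neg P.Bh P.Bg X.actH P.σ (fun x y z => by
      rw [P.symm_h, P.symm_g, P.σ_spec, neg_neg]) δφ.A₁ φ.B₂ E _ _
      (show ((n : ℤ) - 3) + 2 = n - 1 by omega) (by omega),
    (even_two_mul ((n : ℤ) - 3)).neg_one_zpow]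
  norm_num
  module

theorem wedge_linG₂ (hδ : δφ.Smooth) {E : Form I M 𝔥 (n - 4)} (hE : GYM.Smooth E) :
    (wedge P.Bh (φ.linG₂ X δφ) E : Form I M 𝕜 n) =
      d (wedge P.Bh δφ.B₃ E : Form I M 𝕜 (n - 1)) +
        wedge P.Bh δφ.B₃ (φ.Dh X E : Form I M 𝔥 (n - 3)) +
        wedge P.Bg δφ.A₁ ((-1 : ℝ) ^ (n + 1) • wedge P.σ E φ.B₃ : Form I M 𝔤 (n - 1)) -
        wedge P.Bh δφ.B₂ (wedge X.actH φ.A₂ E : Form I M 𝔥 (n - 2)) -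
        wedge P.Bg δφ.A₂ (wedge P.σ E φ.B₂ : Form I M 𝔤 (n - 2)) -
        wedge P.Bl δφ.C₄ (mapForm P.βs E) := by
  rw [linG₂, Dh, wedge_sub_left, wedge_add_left, wedge_add_left, wedge_add_left,
    wedge_covariant_left P.Bh X.actH P.invariant_h φ.A₁ hδ.2.2.2.1 hE (ps := n - 1)
      (s' := n - 3) _ _ (by omega) (by omega) (by omega) (by omega) _ (by omega),
    wedge_mapForm_left P.Bh P.Bl _ P.βs (fun v w => (P.βs_spec w v).symm), Dh,
    wedge_act_left P.Bh X.actH P.invariant_h φ.A₂ δφ.B₂ E _ _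
      (show 2 + ((n : ℤ) - 4) = n - 2 by omega) (by omega),
    wedge_wedge_eq_neg P.Bh P.Bg X.actH P.σ (fun x y z => by
      rw [P.symm_h, P.symm_g, P.σ_spec, neg_neg]) δφ.A₁ φ.B₃ E _ _
      (show ((n : ℤ) - 4) + 3 = n - 1 by omega) (by omega),
    wedge_wedge_eq_neg P.Bh P.Bg X.actH P.σ (fun x y z => by
      rw [P.symm_h, P.symm_g, P.σ_spec, neg_neg]) δφ.A₂ φ.B₂ E _ _
      (show ((n : ℤ) - 4) + 2 = n - 2 by omega) (by omega),
    (even_two_mul ((n : ℤ) - 4)).neg_one_zpow, wedge_real_smul_right,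
    -- Moving `B₃` past the `(n-4)`-form `E` gives the parity of `n`; with the minus in the
    -- definition of `σ` this is the coefficient `(-1)^{n+1}` of the field equation.
    show (-1 : ℝ) ^ (3 * ((n : ℤ) - 4)) = (-1 : ℝ) ^ (n : ℤ) from
      neg_one_zpow_congr ⟨(n : ℤ) - 6, by ring⟩, zpow_natCast, pow_succ]
  norm_num
  module

/-- The lifting is not symmetric, so the variation of `B₂ ∧ B₂` has two different terms: `η₂` is the
adjoint when the variation stands in the first slot, `η₁` when it stands in the second. -/
theorem wedge_linH₁ (hδ : δφ.Smooth) {E : Form I M 𝔩 (n - 4)} (hE : GYM.Smooth E) :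
    (wedge P.Bl (φ.linH₁ X k δφ) E : Form I M 𝕜 n) =
      d (wedge P.Bl δφ.C₃ E : Form I M 𝕜 (n - 1)) +
        wedge P.Bl δφ.C₃ (φ.Dl X E : Form I M 𝔩 (n - 3)) +
        wedge P.Bg δφ.A₁ ((-1 : ℝ) ^ (n + 1) • wedge P.κ E φ.C₃ : Form I M 𝔤 (n - 1)) -
        wedge P.Bh δφ.B₂ (wedge P.η₁ E φ.B₂ : Form I M 𝔥 (n - 2)) -
        wedge P.Bh δφ.B₂ (wedge P.η₂ E φ.B₂ : Form I M 𝔥 (n - 2)) +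
        wedge P.Bl δφ.C₄ (k • E) := by
  rw [linH₁, Dl, wedge_add_left, wedge_add_left, wedge_add_left, wedge_add_left,
    wedge_covariant_left P.Bl X.actL P.invariant_l φ.A₁ hδ.2.2.2.2.1 hE (ps := n - 1)
      (s' := n - 3) _ _ (by omega) (by omega) (by omega) (by omega) _ (by omega),
    wedge_smul_left, Dl,
    wedge_wedge_eq_neg P.Bl P.Bg X.actL P.κ (fun x y z => by
      rw [P.symm_l, P.symm_g, P.κ_spec, neg_neg]) δφ.A₁ φ.C₃ E _ _
      (show ((n : ℤ) - 4) + 3 = n - 1 by omega) (by omega),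
    wedge_wedge_eq_neg P.Bl P.Bh X.lift P.η₂ (fun x y z => P.η₂_spec x y z) δφ.B₂ φ.B₂ E _ _
      (show ((n : ℤ) - 4) + 2 = n - 2 by omega) (by omega),
    wedge_wedge_eq_neg' P.Bl P.Bh X.lift P.η₁ (fun x y z => P.η₁_spec y x z) φ.B₂ δφ.B₂ E _ _
      (show ((n : ℤ) - 4) + 2 = n - 2 by omega) (by omega),
    (even_two_mul ((n : ℤ) - 4)).neg_one_zpow, wedge_real_smul_right,
    show (-1 : ℝ) ^ (3 * ((n : ℤ) - 4)) = (-1 : ℝ) ^ (n : ℤ) from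
      neg_one_zpow_congr ⟨(n : ℤ) - 6, by ring⟩, zpow_natCast, pow_succ]
  norm_num
  module

/-- Passing the `(n-5)`-form `E`, the forms of even degree `B₂` and `C₄` give no sign, while `B₃`
and `C₃` give `(-1)^{n+1}`. The minus in front of `A₂ ∧ C₃` cancels the one in the adjunction,
whence the positive `C₃` terms. -/
theorem wedge_linH₂ (hδ : δφ.Smooth) {E : Form I M 𝔩 (n - 5)} (hE : GYM.Smooth E) :
    (wedge P.Bl (φ.linH₂ X δφ) E : Form I M 𝕜 n) =
      d (wedge P.Bl δφ.C₄ E : Form I M 𝕜 (n - 1)) -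
        wedge P.Bl δφ.C₄ (φ.Dl X E : Form I M 𝔩 (n - 4)) -
        wedge P.Bg δφ.A₁ (wedge P.κ E φ.C₄ : Form I M 𝔤 (n - 1)) +
        wedge P.Bl δφ.C₃ (wedge X.actL φ.A₂ E : Form I M 𝔩 (n - 3)) +
        wedge P.Bg δφ.A₂ ((-1 : ℝ) ^ (n + 1) • wedge P.κ E φ.C₃ : Form I M 𝔤 (n - 2)) -
        wedge P.Bh δφ.B₃ (wedge P.η₁ E φ.B₂ : Form I M 𝔥 (n - 3)) -
        wedge P.Bh δφ.B₂ ((-1 : ℝ) ^ (n + 1) • wedge P.η₂ E φ.B₃ : Form I M 𝔥 (n - 2)) -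
        wedge P.Bh δφ.B₂ ((-1 : ℝ) ^ (n + 1) • wedge P.η₁ E φ.B₃ : Form I M 𝔥 (n - 2)) -
        wedge P.Bh δφ.B₃ (wedge P.η₂ E φ.B₂ : Form I M 𝔥 (n - 3)) := by
  rw [linH₂, Dl, wedge_add_left, wedge_add_left, wedge_add_left, wedge_add_left, wedge_sub_left,
    wedge_sub_left, wedge_add_left,
    wedge_covariant_left P.Bl X.actL P.invariant_l φ.A₁ hδ.2.2.2.2.2 hE (ps := n - 1)
      (s' := n - 4) _ _ (by omega) (by omega) (by omega) (by omega) _ (by omega), Dl,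
    wedge_wedge_eq_neg P.Bl P.Bg X.actL P.κ (fun x y z => by
      rw [P.symm_l, P.symm_g, P.κ_spec, neg_neg]) δφ.A₁ φ.C₄ E _ _
      (show ((n : ℤ) - 5) + 4 = n - 1 by omega) (by omega),
    wedge_act_left P.Bl X.actL P.invariant_l φ.A₂ δφ.C₃ E _ _
      (show 2 + ((n : ℤ) - 5) = n - 3 by omega) (by omega),
    wedge_wedge_eq_neg P.Bl P.Bg X.actL P.κ (fun x y z => by
      rw [P.symm_l, P.symm_g, P.κ_spec, neg_neg]) δφ.A₂ φ.C₃ E _ _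
      (show ((n : ℤ) - 5) + 3 = n - 2 by omega) (by omega),
    wedge_wedge_eq_neg' P.Bl P.Bh X.lift P.η₁ (fun x y z => P.η₁_spec y x z) φ.B₂ δφ.B₃ E _ _
      (show ((n : ℤ) - 5) + 2 = n - 3 by omega) (by omega),
    wedge_wedge_eq_neg P.Bl P.Bh X.lift P.η₂ (fun x y z => P.η₂_spec x y z) δφ.B₂ φ.B₃ E _ _
      (show ((n : ℤ) - 5) + 3 = n - 2 by omega) (by omega),
    wedge_wedge_eq_neg' P.Bl P.Bh X.lift P.η₁ (fun x y z => P.η₁_spec y x z) φ.B₃ δφ.B₂ E _ _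
      (show ((n : ℤ) - 5) + 3 = n - 2 by omega) (by omega),
    wedge_wedge_eq_neg P.Bl P.Bh X.lift P.η₂ (fun x y z => P.η₂_spec x y z) δφ.B₃ φ.B₂ E _ _
      (show ((n : ℤ) - 5) + 2 = n - 3 by omega) (by omega),
    (even_two_mul ((n : ℤ) - 5)).neg_one_zpow]
  simp only [wedge_real_smul_right]
  rw [show (-1 : ℝ) ^ (4 * ((n : ℤ) - 5)) = 1 from Even.neg_one_zpow ⟨2 * ((n : ℤ) - 5), by ring⟩,
    show (-1 : ℝ) ^ (3 * ((n : ℤ) - 5)) = (-1 : ℝ) ^ ((n : ℤ) + 1) from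
      neg_one_zpow_congr ⟨(n : ℤ) - 8, by ring⟩, ← Nat.cast_succ, zpow_natCast]
  generalize (-1 : ℝ) ^ n.succ = e
  norm_num
  module

end

end Generalized3Connection
end YangMills

/-! ### Euler–Lagrange forms and the first variation formula. -/

section YangMills

variable {𝕜 : Type*} [RCLike 𝕜] {𝔤 𝔥 𝔩 : Type*}
  [NormedLieRing 𝔤] [NormedLieAlgebra 𝕜 𝔤] [NormedSpace ℝ 𝔤] [IsScalarTower ℝ 𝕜 𝔤]
  [NormedLieRing 𝔥] [NormedLieAlgebra 𝕜 𝔥] [NormedSpace ℝ 𝔥] [IsScalarTower ℝ 𝕜 𝔥]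
  [NormedLieRing 𝔩] [NormedLieAlgebra 𝕜 𝔩] [NormedSpace ℝ 𝔩] [IsScalarTower ℝ 𝕜 𝔩]
  [FiniteDimensional 𝕜 𝔤] [FiniteDimensional 𝕜 𝔥] [FiniteDimensional 𝕜 𝔩]
  [FiniteDimensional ℝ 𝔤] [FiniteDimensional ℝ 𝔥] [FiniteDimensional ℝ 𝔩]
  {n : ℕ} {H : Type*} [TopologicalSpace H]
  {I : ModelWithCorners ℝ (EuclideanSpace ℝ (Fin n)) H}
  {M : Type*} [TopologicalSpace M] [ChartedSpace H M] [IsManifold I ∞ M]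
  [T2Space M] [SigmaCompactSpace M]

namespace Generalized3Connection

variable (X : Differential2CrossedModule 𝕜 𝔤 𝔥 𝔩) (P : InvariantForms X) (k : 𝕜)
  (g : PseudoRiemannianMetric I M) (o : OrientationForm I M)
  (φ δφ : Generalized3Connection 𝔤 𝔥 𝔩 I M)

/-! ### The Euler–Lagrange forms -/

/-- The Euler–Lagrange form of `A₁`. -/
def eulerA₁ : Form I M 𝔤 (n - 1) :=
  φ.Dg 𝕜 (φ.sF₁ X k g o) + wedge (bracket 𝕜 𝔤) φ.A₂ (φ.sF₂ X g o)
    - wedge P.σ (φ.sG₁ X k g o) φ.B₂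
    + (-1 : ℝ) ^ (n + 1) • wedge P.σ (φ.sG₂ X g o) φ.B₃
    + (-1 : ℝ) ^ (n + 1) • wedge P.κ (φ.sH₁ X k g o) φ.C₃
    - wedge P.κ (φ.sH₂ X g o) φ.C₄

/-- The Euler–Lagrange form of `A₂`. -/
def eulerA₂ : Form I M 𝔤 (n - 2) :=
  k • φ.sF₁ X k g o - φ.Dg 𝕜 (φ.sF₂ X g o) - wedge P.σ (φ.sG₂ X g o) φ.B₂
    + (-1 : ℝ) ^ (n + 1) • wedge P.κ (φ.sH₂ X g o) φ.C₃

/-- The Euler–Lagrange form of `B₂`. -/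
def eulerB₂ : Form I M 𝔥 (n - 2) :=
  mapForm P.αs (φ.sF₁ X k g o) + φ.Dh X (φ.sG₁ X k g o) + wedge X.actH φ.A₂ (φ.sG₂ X g o)
    + wedge P.η₂ (φ.sH₁ X k g o) φ.B₂ + wedge P.η₁ (φ.sH₁ X k g o) φ.B₂
    + (-1 : ℝ) ^ (n + 1) • wedge P.η₁ (φ.sH₂ X g o) φ.B₃
    + (-1 : ℝ) ^ (n + 1) • wedge P.η₂ (φ.sH₂ X g o) φ.B₃

/-- The Euler–Lagrange form of `B₃`. -/
def eulerB₃ : Form I M 𝔥 (n - 3) :=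
  mapForm P.αs (φ.sF₂ X g o) + k • φ.sG₁ X k g o - φ.Dh X (φ.sG₂ X g o)
    + wedge P.η₁ (φ.sH₂ X g o) φ.B₂ + wedge P.η₂ (φ.sH₂ X g o) φ.B₂

/-- The Euler–Lagrange form of `C₃`. -/
def eulerC₃ : Form I M 𝔩 (n - 3) :=
  φ.Dl X (φ.sH₁ X k g o) + wedge X.actL φ.A₂ (φ.sH₂ X g o) - mapForm P.βs (φ.sG₁ X k g o)

/-- The Euler–Lagrange form of `C₄`. -/
def eulerC₄ : Form I M 𝔩 (n - 4) :=
  k • φ.sH₁ X k g o - φ.Dl X (φ.sH₂ X g o) - mapForm P.βs (φ.sG₂ X g o)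

/-- The boundary form of the first variation. -/
def boundaryForm : Form I M 𝕜 (n - 1) :=
  wedge P.Bg δφ.A₁ (φ.sF₁ X k g o) (by ring) + wedge P.Bg δφ.A₂ (φ.sF₂ X g o) +
  wedge P.Bh δφ.B₂ (φ.sG₁ X k g o) + wedge P.Bh δφ.B₃ (φ.sG₂ X g o) +
  wedge P.Bl δφ.C₃ (φ.sH₁ X k g o) + wedge P.Bl δφ.C₄ (φ.sH₂ X g o)

variable {φ δφ}

theorem Smooth.sF₁ (h : φ.Smooth) : GYM.Smooth (φ.sF₁ X k g o) := (h.F₁ X k).star g o _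
theorem Smooth.sF₂ (h : φ.Smooth) : GYM.Smooth (φ.sF₂ X g o) := (h.F₂ X).star g o _
theorem Smooth.sG₁ (h : φ.Smooth) : GYM.Smooth (φ.sG₁ X k g o) := (h.G₁ X k).star g o _
theorem Smooth.sG₂ (h : φ.Smooth) : GYM.Smooth (φ.sG₂ X g o) := (h.G₂ X).star g o _
theorem Smooth.sH₁ (h : φ.Smooth) : GYM.Smooth (φ.sH₁ X k g o) := (h.H₁ X k).star g o _
set_option maxRecDepth 10000 in
theorem Smooth.sH₂ (h : φ.Smooth) : GYM.Smooth (φ.sH₂ X g o) := (h.H₂ X).star g o _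

theorem Smooth.Dg (h : φ.Smooth) {p r : ℤ} {E : Form I M 𝔤 p} (hE : GYM.Smooth E)
    (hr : p + 1 = r) : GYM.Smooth (φ.Dg 𝕜 E hr) := (hE.d _).add (h.1.wedge _ hE _)

theorem Smooth.Dh (h : φ.Smooth) {p r : ℤ} {E : Form I M 𝔥 p} (hE : GYM.Smooth E)
    (hr : p + 1 = r) : GYM.Smooth (φ.Dh X E hr) := (hE.d _).add (h.1.wedge _ hE _)

theorem Smooth.Dl (h : φ.Smooth) {p r : ℤ} {E : Form I M 𝔩 p} (hE : GYM.Smooth E)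
    (hr : p + 1 = r) : GYM.Smooth (φ.Dl X E hr) := (hE.d _).add (h.1.wedge _ hE _)

theorem Smooth.eulerA₁ (h : φ.Smooth) : GYM.Smooth (φ.eulerA₁ X P k g o) :=
  (((((h.Dg (h.sF₁ X k g o) _).add (h.2.1.wedge _ (h.sF₂ X g o) _)).sub
    ((h.sG₁ X k g o).wedge _ h.2.2.1 _)).add
    (((h.sG₂ X g o).wedge _ h.2.2.2.1 _).real_smul _)).add
    (((h.sH₁ X k g o).wedge _ h.2.2.2.2.1 _).real_smul _)).sub
    ((h.sH₂ X g o).wedge _ h.2.2.2.2.2 _)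

theorem Smooth.eulerA₂ (h : φ.Smooth) : GYM.Smooth (φ.eulerA₂ X P k g o) :=
  ((((h.sF₁ X k g o).smul k).sub (h.Dg (h.sF₂ X g o) _)).sub
    ((h.sG₂ X g o).wedge _ h.2.2.1 _)).add (((h.sH₂ X g o).wedge _ h.2.2.2.2.1 _).real_smul _)

theorem Smooth.eulerB₂ (h : φ.Smooth) : GYM.Smooth (φ.eulerB₂ X P k g o) :=
  (((((((h.sF₁ X k g o).mapForm _).add (h.Dh X (h.sG₁ X k g o) _)).add
    (h.2.1.wedge _ (h.sG₂ X g o) _)).add ((h.sH₁ X k g o).wedge _ h.2.2.1 _)).add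
    ((h.sH₁ X k g o).wedge _ h.2.2.1 _)).add
    (((h.sH₂ X g o).wedge _ h.2.2.2.1 _).real_smul _)).add
    (((h.sH₂ X g o).wedge _ h.2.2.2.1 _).real_smul _)

theorem Smooth.eulerB₃ (h : φ.Smooth) : GYM.Smooth (φ.eulerB₃ X P k g o) :=
  (((((h.sF₂ X g o).mapForm _).add ((h.sG₁ X k g o).smul k)).sub (h.Dh X (h.sG₂ X g o) _)).add
    ((h.sH₂ X g o).wedge _ h.2.2.1 _)).add ((h.sH₂ X g o).wedge _ h.2.2.1 _)

theorem Smooth.eulerC₃ (h : φ.Smooth) : GYM.Smooth (φ.eulerC₃ X P k g o) :=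
  ((h.Dl X (h.sH₁ X k g o) _).add (h.2.1.wedge _ (h.sH₂ X g o) _)).sub
    ((h.sG₁ X k g o).mapForm _)

theorem Smooth.eulerC₄ (h : φ.Smooth) : GYM.Smooth (φ.eulerC₄ X P k g o) :=
  (((h.sH₁ X k g o).smul k).sub (h.Dl X (h.sH₂ X g o) _)).sub ((h.sG₂ X g o).mapForm _)

theorem smoothSupp_boundaryForm {K : Set M} (h : φ.Smooth) (hδ : δφ.SmoothSupp K) :
    GYM.SmoothSupp K (φ.boundaryForm X P k g o δφ) :=
  (((((hδ.1.wedge_left _ (h.sF₁ X k g o) _).add (hδ.2.1.wedge_left _ (h.sF₂ X g o) _)).add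
    (hδ.2.2.1.wedge_left _ (h.sG₁ X k g o) _)).add
    (hδ.2.2.2.1.wedge_left _ (h.sG₂ X g o) _)).add
    (hδ.2.2.2.2.1.wedge_left _ (h.sH₁ X k g o) _)).add
    (hδ.2.2.2.2.2.wedge_left _ (h.sH₂ X g o) _)

/-- The first variation formula. -/
theorem linDensity_eq (h : φ.Smooth) (hδ : δφ.Smooth) :
    φ.linDensity X P k g o δφ =
      wedge P.Bg δφ.A₁ (φ.eulerA₁ X P k g o) + wedge P.Bg δφ.A₂ (φ.eulerA₂ X P k g o) -
      wedge P.Bh δφ.B₂ (φ.eulerB₂ X P k g o) - wedge P.Bh δφ.B₃ (φ.eulerB₃ X P k g o) +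
      wedge P.Bl δφ.C₃ (φ.eulerC₃ X P k g o) + wedge P.Bl δφ.C₄ (φ.eulerC₄ X P k g o) +
      d (φ.boundaryForm X P k g o δφ) := by
  have s1 := h.sF₁ X k g o
  have s2 := h.sF₂ X g o
  have s3 := h.sG₁ X k g o
  have s4 := h.sG₂ X g o
  have s5 := h.sH₁ X k g o
  have s6 := h.sH₂ X g o
  rw [linDensity, wedge_linF₁ X P k hδ s1, wedge_linF₂ X P hδ s2, wedge_linG₁ X P k hδ s3,
    wedge_linG₂ X P hδ s4, wedge_linH₁ X P k hδ s5, wedge_linH₂ X P hδ s6]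
  simp only [eulerA₁, eulerA₂, eulerB₂, eulerB₃, eulerC₃, eulerC₄, wedge_add_right,
    wedge_sub_right]
  have t1 : GYM.Smooth (wedge P.Bg δφ.A₁ (φ.sF₁ X k g o) (by ring) : Form I M 𝕜 (n - 1)) :=
    hδ.1.wedge _ s1 _
  have t2 : GYM.Smooth (wedge P.Bg δφ.A₂ (φ.sF₂ X g o) : Form I M 𝕜 (n - 1)) :=
    hδ.2.1.wedge _ s2 _
  have t3 : GYM.Smooth (wedge P.Bh δφ.B₂ (φ.sG₁ X k g o) : Form I M 𝕜 (n - 1)) :=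
    hδ.2.2.1.wedge _ s3 _
  have t4 : GYM.Smooth (wedge P.Bh δφ.B₃ (φ.sG₂ X g o) : Form I M 𝕜 (n - 1)) :=
    hδ.2.2.2.1.wedge _ s4 _
  have t5 : GYM.Smooth (wedge P.Bl δφ.C₃ (φ.sH₁ X k g o) : Form I M 𝕜 (n - 1)) :=
    hδ.2.2.2.2.1.wedge _ s5 _
  have t6 : GYM.Smooth (wedge P.Bl δφ.C₄ (φ.sH₂ X g o) : Form I M 𝕜 (n - 1)) :=
    hδ.2.2.2.2.2.wedge _ s6 _
  rw [boundaryForm, d_add ((((t1.add t2).add t3).add t4).add t5) t6,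
    d_add (((t1.add t2).add t3).add t4) t5, d_add ((t1.add t2).add t3) t4,
    d_add (t1.add t2) t3, d_add t1 t2]
  abel

/-- The boundary form inherits its compact support in the interior from the variation, so its
derivative integrates to zero by Stokes' theorem. The terms in `δB₂` and `δB₃` are negative because
their field equations are normalized with the opposite sign. -/
theorem integral_linDensity {K : Set M} (h : φ.Smooth) (hK : IsCompact K)
    (hKi : K ⊆ I.interior M) (hδ : δφ.SmoothSupp K) :
    integral o (φ.linDensity X P k g o δφ) rfl =
      integral o (wedge P.Bg δφ.A₁ (φ.eulerA₁ X P k g o) : Form I M 𝕜 n) rfl +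
      integral o (wedge P.Bg δφ.A₂ (φ.eulerA₂ X P k g o) : Form I M 𝕜 n) rfl -
      integral o (wedge P.Bh δφ.B₂ (φ.eulerB₂ X P k g o) : Form I M 𝕜 n) rfl -
      integral o (wedge P.Bh δφ.B₃ (φ.eulerB₃ X P k g o) : Form I M 𝕜 n) rfl +
      integral o (wedge P.Bl δφ.C₃ (φ.eulerC₃ X P k g o) : Form I M 𝕜 n) rfl +
      integral o (wedge P.Bl δφ.C₄ (φ.eulerC₄ X P k g o) : Form I M 𝕜 n) rfl := by
  have t1 : GYM.SmoothSupp K (wedge P.Bg δφ.A₁ (φ.eulerA₁ X P k g o) : Form I M 𝕜 n) :=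
    hδ.1.wedge_left _ (h.eulerA₁ X P k g o) _
  have t2 : GYM.SmoothSupp K (wedge P.Bg δφ.A₂ (φ.eulerA₂ X P k g o) : Form I M 𝕜 n) :=
    hδ.2.1.wedge_left _ (h.eulerA₂ X P k g o) _
  have t3 : GYM.SmoothSupp K (wedge P.Bh δφ.B₂ (φ.eulerB₂ X P k g o) : Form I M 𝕜 n) :=
    hδ.2.2.1.wedge_left _ (h.eulerB₂ X P k g o) _
  have t4 : GYM.SmoothSupp K (wedge P.Bh δφ.B₃ (φ.eulerB₃ X P k g o) : Form I M 𝕜 n) :=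
    hδ.2.2.2.1.wedge_left _ (h.eulerB₃ X P k g o) _
  have t5 : GYM.SmoothSupp K (wedge P.Bl δφ.C₃ (φ.eulerC₃ X P k g o) : Form I M 𝕜 n) :=
    hδ.2.2.2.2.1.wedge_left _ (h.eulerC₃ X P k g o) _
  have t6 : GYM.SmoothSupp K (wedge P.Bl δφ.C₄ (φ.eulerC₄ X P k g o) : Form I M 𝕜 n) :=
    hδ.2.2.2.2.2.wedge_left _ (h.eulerC₄ X P k g o) _
  have hb := smoothSupp_boundaryForm X P k g o h hδ
  rw [linDensity_eq X P k g o h hδ.smooth,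
    integral_add o hK (((((t1.add t2).sub t3).sub t4).add t5).add t6) (hb.d hK.isClosed _),
    integral_d_eq_zero o hK hKi hb, add_zero,
    integral_add o hK ((((t1.add t2).sub t3).sub t4).add t5) t6,
    integral_add o hK (((t1.add t2).sub t3).sub t4) t5,
    integral_sub o hK ((t1.add t2).sub t3) t4, integral_sub o hK (t1.add t2) t3,
    integral_add o hK t1 t2]

end Generalized3Connection
end YangMills

/-! ### Stationarity and the field equations. -/

section YangMills

variable {𝕜 : Type*} [RCLike 𝕜] {𝔤 𝔥 𝔩 : Type*}
  [NormedLieRing 𝔤] [NormedLieAlgebra 𝕜 𝔤] [NormedSpace ℝ 𝔤] [IsScalarTower ℝ 𝕜 𝔤]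
  [NormedLieRing 𝔥] [NormedLieAlgebra 𝕜 𝔥] [NormedSpace ℝ 𝔥] [IsScalarTower ℝ 𝕜 𝔥]
  [NormedLieRing 𝔩] [NormedLieAlgebra 𝕜 𝔩] [NormedSpace ℝ 𝔩] [IsScalarTower ℝ 𝕜 𝔩]
  [FiniteDimensional 𝕜 𝔤] [FiniteDimensional 𝕜 𝔥] [FiniteDimensional 𝕜 𝔩]
  [FiniteDimensional ℝ 𝔤] [FiniteDimensional ℝ 𝔥] [FiniteDimensional ℝ 𝔩]
  {n : ℕ} {H : Type*} [TopologicalSpace H]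
  {I : ModelWithCorners ℝ (EuclideanSpace ℝ (Fin n)) H}
  {M : Type*} [TopologicalSpace M] [ChartedSpace H M] [IsManifold I ∞ M]
  [T2Space M] [SigmaCompactSpace M]

theorem isTest_zero {V : Type*} [NormedAddCommGroup V] [NormedSpace ℝ V] [FiniteDimensional ℝ V]
    {p : ℤ} :
    IsTest (0 : Form I M V p) :=
  SmoothSupp.isTest isCompact_empty (Set.empty_subset _) SmoothSupp.zero

namespace Generalized3Connection

variable (X : Differential2CrossedModule 𝕜 𝔤 𝔥 𝔩) (P : InvariantForms X) (k : 𝕜)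
  (g : PseudoRiemannianMetric I M) (o : OrientationForm I M)
  {φ δφ : Generalized3Connection 𝔤 𝔥 𝔩 I M}

theorem stationary_iff_euler (h : φ.Smooth) (hδ : δφ.IsTest) :
    φ.Stationary X P k g o δφ ↔
      integral o (wedge P.Bg δφ.A₁ (φ.eulerA₁ X P k g o) : Form I M 𝕜 n) rfl +
      integral o (wedge P.Bg δφ.A₂ (φ.eulerA₂ X P k g o) : Form I M 𝕜 n) rfl -
      integral o (wedge P.Bh δφ.B₂ (φ.eulerB₂ X P k g o) : Form I M 𝕜 n) rfl -
      integral o (wedge P.Bh δφ.B₃ (φ.eulerB₃ X P k g o) : Form I M 𝕜 n) rfl +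
      integral o (wedge P.Bl δφ.C₃ (φ.eulerC₃ X P k g o) : Form I M 𝕜 n) rfl +
      integral o (wedge P.Bl δφ.C₄ (φ.eulerC₄ X P k g o) : Form I M 𝕜 n) rfl = 0 := by
  obtain ⟨K, hK, hKi, hs⟩ := hδ.exists_smoothSupp
  rw [stationary_iff X P k g o h hK hs, integral_linDensity X P k g o h hK hKi hs]

/-- For a variation of one field a single term of the first variation survives. The fundamental
lemma and the non-degeneracy of the form on `𝔤` give the vanishing of the Euler–Lagrange form, which
is the field equation by definition. The other five fields are treated in the same way. -/
theorem stationary_A₁_iff (h : φ.Smooth) :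
    (∀ a, GYM.IsTest a → φ.Stationary X P k g o ⟨a, 0, 0, 0, 0, 0⟩) ↔ φ.FieldEqA₁ X P k g o := by
  have key : ∀ a, GYM.IsTest a → (φ.Stationary X P k g o ⟨a, 0, 0, 0, 0, 0⟩ ↔
      integral o (wedge P.Bg a (φ.eulerA₁ X P k g o) : Form I M 𝕜 n) rfl = 0) := fun a ha => by
    rw [stationary_iff_euler X P k g o h
      ⟨ha, isTest_zero, isTest_zero, isTest_zero, isTest_zero, isTest_zero⟩]
    simp only [wedge_zero_left, integral_zero, add_zero, sub_zero]
  refine ⟨fun H => eq_zero_of_integral_wedge_eq_zero o P.Bg P.nondegenerate_g.2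
    (h.eulerA₁ X P k g o) _ fun a ha => (key a ha).1 (H a ha), fun E a ha => (key a ha).2 ?_⟩
  rw [show φ.eulerA₁ X P k g o = 0 from E, wedge_zero_right, integral_zero]

theorem stationary_A₂_iff (h : φ.Smooth) :
    (∀ a, GYM.IsTest a → φ.Stationary X P k g o ⟨0, a, 0, 0, 0, 0⟩) ↔ φ.FieldEqA₂ X P k g o := by
  have key : ∀ a, GYM.IsTest a → (φ.Stationary X P k g o ⟨0, a, 0, 0, 0, 0⟩ ↔
      integral o (wedge P.Bg a (φ.eulerA₂ X P k g o) : Form I M 𝕜 n) rfl = 0) := fun a ha => by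
    rw [stationary_iff_euler X P k g o h
      ⟨isTest_zero, ha, isTest_zero, isTest_zero, isTest_zero, isTest_zero⟩]
    simp only [wedge_zero_left, integral_zero, add_zero, sub_zero, zero_add]
  refine ⟨fun H => eq_zero_of_integral_wedge_eq_zero o P.Bg P.nondegenerate_g.2
    (h.eulerA₂ X P k g o) _ fun a ha => (key a ha).1 (H a ha), fun E a ha => (key a ha).2 ?_⟩
  rw [show φ.eulerA₂ X P k g o = 0 from E, wedge_zero_right, integral_zero]

theorem stationary_B₂_iff (h : φ.Smooth) :
    (∀ b, GYM.IsTest b → φ.Stationary X P k g o ⟨0, 0, b, 0, 0, 0⟩) ↔ φ.FieldEqB₂ X P k g o := by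
  have key : ∀ b, GYM.IsTest b → (φ.Stationary X P k g o ⟨0, 0, b, 0, 0, 0⟩ ↔
      integral o (wedge P.Bh b (φ.eulerB₂ X P k g o) : Form I M 𝕜 n) rfl = 0) := fun b hb => by
    rw [stationary_iff_euler X P k g o h
      ⟨isTest_zero, isTest_zero, hb, isTest_zero, isTest_zero, isTest_zero⟩]
    simp only [wedge_zero_left, integral_zero, add_zero, sub_zero, zero_sub, neg_eq_zero]
  refine ⟨fun H => eq_zero_of_integral_wedge_eq_zero o P.Bh P.nondegenerate_h.2
    (h.eulerB₂ X P k g o) _ fun b hb => (key b hb).1 (H b hb), fun E b hb => (key b hb).2 ?_⟩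
  rw [show φ.eulerB₂ X P k g o = 0 from E, wedge_zero_right, integral_zero]

theorem stationary_B₃_iff (h : φ.Smooth) :
    (∀ b, GYM.IsTest b → φ.Stationary X P k g o ⟨0, 0, 0, b, 0, 0⟩) ↔ φ.FieldEqB₃ X P k g o := by
  have key : ∀ b, GYM.IsTest b → (φ.Stationary X P k g o ⟨0, 0, 0, b, 0, 0⟩ ↔
      integral o (wedge P.Bh b (φ.eulerB₃ X P k g o) : Form I M 𝕜 n) rfl = 0) := fun b hb => by
    rw [stationary_iff_euler X P k g o h
      ⟨isTest_zero, isTest_zero, isTest_zero, hb, isTest_zero, isTest_zero⟩]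
    simp only [wedge_zero_left, integral_zero, add_zero, sub_zero, zero_sub, neg_eq_zero]
  refine ⟨fun H => eq_zero_of_integral_wedge_eq_zero o P.Bh P.nondegenerate_h.2
    (h.eulerB₃ X P k g o) _ fun b hb => (key b hb).1 (H b hb), fun E b hb => (key b hb).2 ?_⟩
  rw [show φ.eulerB₃ X P k g o = 0 from E, wedge_zero_right, integral_zero]

theorem stationary_C₃_iff (h : φ.Smooth) :
    (∀ c, GYM.IsTest c → φ.Stationary X P k g o ⟨0, 0, 0, 0, c, 0⟩) ↔ φ.FieldEqC₃ X P k g o := by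
  have key : ∀ c, GYM.IsTest c → (φ.Stationary X P k g o ⟨0, 0, 0, 0, c, 0⟩ ↔
      integral o (wedge P.Bl c (φ.eulerC₃ X P k g o) : Form I M 𝕜 n) rfl = 0) := fun c hc => by
    rw [stationary_iff_euler X P k g o h
      ⟨isTest_zero, isTest_zero, isTest_zero, isTest_zero, hc, isTest_zero⟩]
    simp only [wedge_zero_left, integral_zero, add_zero, sub_zero, zero_add]
  refine ⟨fun H => eq_zero_of_integral_wedge_eq_zero o P.Bl P.nondegenerate_l.2
    (h.eulerC₃ X P k g o) _ fun c hc => (key c hc).1 (H c hc), fun E c hc => (key c hc).2 ?_⟩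
  rw [show φ.eulerC₃ X P k g o = 0 from E, wedge_zero_right, integral_zero]

theorem stationary_C₄_iff (h : φ.Smooth) :
    (∀ c, GYM.IsTest c → φ.Stationary X P k g o ⟨0, 0, 0, 0, 0, c⟩) ↔ φ.FieldEqC₄ X P k g o := by
  have key : ∀ c, GYM.IsTest c → (φ.Stationary X P k g o ⟨0, 0, 0, 0, 0, c⟩ ↔
      integral o (wedge P.Bl c (φ.eulerC₄ X P k g o) : Form I M 𝕜 n) rfl = 0) := fun c hc => by
    rw [stationary_iff_euler X P k g o h
      ⟨isTest_zero, isTest_zero, isTest_zero, isTest_zero, isTest_zero, hc⟩]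
    simp only [wedge_zero_left, integral_zero, add_zero, sub_zero, zero_add]
  refine ⟨fun H => eq_zero_of_integral_wedge_eq_zero o P.Bl P.nondegenerate_l.2
    (h.eulerC₄ X P k g o) _ fun c hc => (key c hc).1 (H c hc), fun E c hc => (key c hc).2 ?_⟩
  rw [show φ.eulerC₄ X P k g o = 0 from E, wedge_zero_right, integral_zero]

/-- Variations of a single field are among the joint ones, and conversely the first variation is a
sum of terms each containing one Euler–Lagrange form. -/
theorem stationary_all_iff (h : φ.Smooth) :
    (∀ δφ : Generalized3Connection 𝔤 𝔥 𝔩 I M, δφ.IsTest → φ.Stationary X P k g o δφ) ↔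
      φ.FieldEqA₁ X P k g o ∧ φ.FieldEqA₂ X P k g o ∧ φ.FieldEqB₂ X P k g o ∧
      φ.FieldEqB₃ X P k g o ∧ φ.FieldEqC₃ X P k g o ∧ φ.FieldEqC₄ X P k g o := by
  constructor
  · intro H
    refine ⟨(stationary_A₁_iff X P k g o h).1 fun a ha => H _ ?_,
      (stationary_A₂_iff X P k g o h).1 fun a ha => H _ ?_,
      (stationary_B₂_iff X P k g o h).1 fun a ha => H _ ?_,
      (stationary_B₃_iff X P k g o h).1 fun a ha => H _ ?_,
      (stationary_C₃_iff X P k g o h).1 fun a ha => H _ ?_,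
      (stationary_C₄_iff X P k g o h).1 fun a ha => H _ ?_⟩
    · exact ⟨ha, isTest_zero, isTest_zero, isTest_zero, isTest_zero, isTest_zero⟩
    · exact ⟨isTest_zero, ha, isTest_zero, isTest_zero, isTest_zero, isTest_zero⟩
    · exact ⟨isTest_zero, isTest_zero, ha, isTest_zero, isTest_zero, isTest_zero⟩
    · exact ⟨isTest_zero, isTest_zero, isTest_zero, ha, isTest_zero, isTest_zero⟩
    · exact ⟨isTest_zero, isTest_zero, isTest_zero, isTest_zero, ha, isTest_zero⟩
    · exact ⟨isTest_zero, isTest_zero, isTest_zero, isTest_zero, isTest_zero, ha⟩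
  · rintro ⟨e1, e2, e3, e4, e5, e6⟩ δφ hδ
    rw [stationary_iff_euler X P k g o h hδ, show φ.eulerA₁ X P k g o = 0 from e1,
      show φ.eulerA₂ X P k g o = 0 from e2, show φ.eulerB₂ X P k g o = 0 from e3,
      show φ.eulerB₃ X P k g o = 0 from e4, show φ.eulerC₃ X P k g o = 0 from e5,
      show φ.eulerC₄ X P k g o = 0 from e6]
    simp only [wedge_zero_right, integral_zero, add_zero, sub_zero]

set_option maxRecDepth 10000 in
theorem Smooth.density (h : φ.Smooth) : GYM.Smooth (φ.density X P k g o) :=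
  ((((((h.F₁ X k).wedge _ (h.sF₁ X k g o) _).add ((h.F₂ X).wedge _ (h.sF₂ X g o) _)).add
    ((h.G₁ X k).wedge _ (h.sG₁ X k g o) _)).add ((h.G₂ X).wedge _ (h.sG₂ X g o) _)).add
    ((h.H₁ X k).wedge _ (h.sH₁ X k g o) _)).add ((h.H₂ X).wedge _ (h.sH₂ X g o) _)

theorem action_eq : φ.action X P k g o = integral o (φ.density X P k g o) rfl :=
  congrArg (nIntegral o) (lagrangian_snd_apply X P k g o φ _)

theorem Smooth.vary (h : φ.Smooth) (hδ : δφ.Smooth) (t : ℝ) : (φ.vary δφ t).Smooth :=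
  ⟨h.1.add (hδ.1.real_smul t), h.2.1.add (hδ.2.1.real_smul t), h.2.2.1.add (hδ.2.2.1.real_smul t),
    h.2.2.2.1.add (hδ.2.2.2.1.real_smul t), h.2.2.2.2.1.add (hδ.2.2.2.2.1.real_smul t),
    h.2.2.2.2.2.add (hδ.2.2.2.2.2.real_smul t)⟩

/-- Additivity of the integral is known for smooth forms vanishing outside a compact set; on compact
`M` the whole manifold serves. -/
theorem actionChange_eq_sub [CompactSpace M] (h : φ.Smooth) (hδ : δφ.Smooth) (t : ℝ) :
    φ.actionChange X P k g o δφ t = (φ.vary δφ t).action X P k g o - φ.action X P k g o := by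
  rw [actionChange_eq, action_eq, action_eq, integral_sub o isCompact_univ]
  · exact ⟨(h.vary hδ t).density X P k g o, fun m x hx => absurd (Set.mem_univ x) hx⟩
  · exact ⟨h.density X P k g o, fun m x hx => absurd (Set.mem_univ x) hx⟩

end Generalized3Connection
end YangMills

/-! ### Transport of forms along equalities of integer degrees. -/

section Cast

variable {𝕜 : Type*} [RCLike 𝕜] {n : ℕ} {H : Type*} [TopologicalSpace H]
  {I : ModelWithCorners ℝ (EuclideanSpace ℝ (Fin n)) H}
  {M : Type*} [TopologicalSpace M] [ChartedSpace H M]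
  {V W U : Type*} [NormedAddCommGroup V] [NormedSpace ℝ V]
  [NormedAddCommGroup W] [NormedSpace ℝ W] [NormedAddCommGroup U] [NormedSpace ℝ U]
  {p p' q r r' : ℤ}

/-- Transport of a form along an equality of degrees. -/
def Form.cast (h : p = p') (a : Form I M V p) : Form I M V p' := fun m => a ⟨m.1, by
  have := m.2; omega⟩

theorem Form.cast_rfl (h : p = p) (a : Form I M V p) : Form.cast h a = a := rfl

theorem Form.cast_cast {p'' : ℤ} (h : p = p') (h' : p' = p'') (a : Form I M V p) :
    Form.cast h' (Form.cast h a) = Form.cast (h.trans h') a := rfl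

theorem Form.cast_inj (h : p = p') {a b : Form I M V p} :
    Form.cast h a = Form.cast h b ↔ a = b := by
  subst h
  rfl

theorem Form.cast_add (h : p = p') (a b : Form I M V p) :
    Form.cast h (a + b) = Form.cast h a + Form.cast h b := rfl

theorem Form.cast_sub (h : p = p') (a b : Form I M V p) :
    Form.cast h (a - b) = Form.cast h a - Form.cast h b := rfl

theorem Form.cast_neg (h : p = p') (a : Form I M V p) :
    Form.cast h (-a) = -Form.cast h a := rfl

theorem Form.cast_real_smul (h : p = p') (c : ℝ) (a : Form I M V p) :
    Form.cast h (c • a) = c • Form.cast h a := rfl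

theorem Form.cast_d (h : r = r') (a : Form I M V p) (hr : p + 1 = r) :
    Form.cast h (d a hr) = d a (hr.trans h) := by
  subst h
  rfl

theorem d_cast (h : p = p') (a : Form I M V p) (hr : p' + 1 = r) :
    d (Form.cast h a) hr = d a (by omega) := by
  subst h
  rfl

theorem star_eq_cast (g : PseudoRiemannianMetric I M) (o : OrientationForm I M)
    (a : Form I M V p) (hr : p + r = n) (hr' : p + r' = n) :
    star g o a hr = Form.cast (by omega) (star g o a hr') := by
  obtain rfl : r = r' := by omega
  rfl

variable [Module 𝕜 V] [Module 𝕜 W] [Module 𝕜 U]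
  [IsScalarTower ℝ 𝕜 V] [IsScalarTower ℝ 𝕜 W] [IsScalarTower ℝ 𝕜 U]

theorem Form.cast_wedge (B : V →ₗ[𝕜] W →ₗ[𝕜] U) (h : r = r') (a : Form I M V p)
    (b : Form I M W q) (hr : p + q = r) :
    Form.cast h (wedge B a b hr) = wedge B a b (hr.trans h) := by
  subst h
  rfl

theorem wedge_cast_left (B : V →ₗ[𝕜] W →ₗ[𝕜] U) (h : p = p') (a : Form I M V p)
    (b : Form I M W q) (hr : p' + q = r) :
    wedge B (Form.cast h a) b hr = wedge B a b (by omega) := by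
  subst h
  rfl

theorem wedge_cast_right (B : V →ₗ[𝕜] W →ₗ[𝕜] U) {q' : ℤ} (h : q = q') (a : Form I M V p)
    (b : Form I M W q) (hr : p + q' = r) :
    wedge B a (Form.cast h b) hr = wedge B a b (by omega) := by
  subst h
  rfl

theorem mapForm_cast (f : V →ₗ[𝕜] W) (h : p = p') (a : Form I M V p) :
    mapForm f (Form.cast h a) = Form.cast h (mapForm f a) := rfl

theorem mapForm_neg (f : V →ₗ[𝕜] W) (a : Form I M V p) : mapForm f (-a) = -mapForm f a :=
  Form.ext fun m hm x => ContinuousAlternatingMap.ext fun v => map_neg f _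

theorem mapForm_zero (f : V →ₗ[𝕜] W) : mapForm f (0 : Form I M V p) = 0 :=
  Form.ext fun m hm x => ContinuousAlternatingMap.ext fun v => map_zero f

/-- The second component is listed before the first, in the order of the field equations, and is
brought to the degree in which the field equation is stated. -/
theorem GForm.ext_iff_cast (h : p + 1 = p') {a b : GForm I M V p} :
    a = b ↔ Form.cast h a.2 = Form.cast h b.2 ∧ a.1 = b.1 := by
  rw [Form.cast_inj, Prod.ext_iff, and_comm]

theorem gwedge_fst (B : V →ₗ[𝕜] W →ₗ[𝕜] U) (a : GForm I M V p) (b : GForm I M W q)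
    (hr : p + q = r) : (gwedge B a b hr).1 = wedge B a.1 b.1 hr := rfl

theorem gwedge_snd (B : V →ₗ[𝕜] W →ₗ[𝕜] U) (a : GForm I M V p) (b : GForm I M W q)
    (hr : p + q = r) : (gwedge B a b hr).2 = wedge B a.1 b.2 (by omega) +
      (-1 : ℝ) ^ q • wedge B a.2 b.1 (by omega) := rfl

theorem gmap_fst (f : V →ₗ[𝕜] W) (a : GForm I M V p) : (gmap f a).1 = mapForm f a.1 := rfl

theorem gmap_snd (f : V →ₗ[𝕜] W) (a : GForm I M V p) : (gmap f a).2 = mapForm f a.2 := rfl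

end Cast

section GD

variable {𝕜 : Type*} [RCLike 𝕜] {n : ℕ} {H : Type*} [TopologicalSpace H]
  {I : ModelWithCorners ℝ (EuclideanSpace ℝ (Fin n)) H}
  {M : Type*} [TopologicalSpace M] [ChartedSpace H M]
  {V : Type*} [NormedAddCommGroup V] [NormedSpace ℝ V] [NormedSpace 𝕜 V] [IsScalarTower ℝ 𝕜 V]
  {p r : ℤ}

theorem gd_fst (k : 𝕜) (a : GForm I M V p) (hr : p + 1 = r) :
    (gd k a hr).1 = d a.1 hr + (-1 : ℝ) ^ (p + 1) • k • Form.cast hr a.2 := rfl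

theorem gd_snd (k : 𝕜) (a : GForm I M V p) (hr : p + 1 = r) :
    (gd k a hr).2 = d a.2 (by omega) := rfl

theorem Form.smul_eq_zero_iff {k : 𝕜} (hk : k ≠ 0) (a : Form I M V p) : k • a = 0 ↔ a = 0 :=
  ⟨fun h => by rw [← inv_smul_smul₀ hk a, h, smul_zero], fun h => by rw [h, smul_zero]⟩

end GD

/-! ### The equations of generalized forms and the ordinary theory. -/

section YangMills

variable {𝕜 : Type*} [RCLike 𝕜] {𝔤 𝔥 𝔩 : Type*}
  [NormedLieRing 𝔤] [NormedLieAlgebra 𝕜 𝔤] [NormedSpace ℝ 𝔤] [IsScalarTower ℝ 𝕜 𝔤]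
  [NormedLieRing 𝔥] [NormedLieAlgebra 𝕜 𝔥] [NormedSpace ℝ 𝔥] [IsScalarTower ℝ 𝕜 𝔥]
  [NormedLieRing 𝔩] [NormedLieAlgebra 𝕜 𝔩] [NormedSpace ℝ 𝔩] [IsScalarTower ℝ 𝕜 𝔩]
  [FiniteDimensional 𝕜 𝔤] [FiniteDimensional 𝕜 𝔥] [FiniteDimensional 𝕜 𝔩]
  [FiniteDimensional ℝ 𝔤] [FiniteDimensional ℝ 𝔥] [FiniteDimensional ℝ 𝔩]
  {n : ℕ} {H : Type*} [TopologicalSpace H]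
  {I : ModelWithCorners ℝ (EuclideanSpace ℝ (Fin n)) H}
  {M : Type*} [TopologicalSpace M] [ChartedSpace H M] [IsManifold I ∞ M]
  [T2Space M] [SigmaCompactSpace M]

namespace Generalized3Connection

variable (X : Differential2CrossedModule 𝕜 𝔤 𝔥 𝔩) (P : InvariantForms X) (k : 𝕜)
  (g : PseudoRiemannianMetric I M) (o : OrientationForm I M)
  {φ δφ : Generalized3Connection 𝔤 𝔥 𝔩 I M}

/-- The parity of `n - 2 - 1` is that of `n + 1`. Writing the signs of `⋆𝓕`, `⋆𝓖`, `⋆𝓗` through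
`(-1)^n` lets all signs in the generalized equations be settled by the parity of `n`. -/
theorem star𝓕_fst : (φ.star𝓕 X k g o).1 = -((-1 : ℝ) ^ n • φ.sF₂ X g o) := by
  have h : (φ.star𝓕 X k g o).1 = (-1 : ℝ) ^ ((n : ℤ) - 2 - 1) • star g o (φ.𝓕 X k).2 := rfl
  rw [h, 𝓕_snd, show (-1 : ℝ) ^ ((n : ℤ) - 2 - 1) = (-1 : ℝ) ^ ((n + 1 : ℕ) : ℤ) from
    neg_one_zpow_congr ⟨-2, by push_cast; ring⟩, zpow_natCast, pow_succ, mul_neg_one, neg_smul]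
  rfl

theorem star𝓕_snd : (φ.star𝓕 X k g o).2 = Form.cast (by omega) (φ.sF₁ X k g o) := by
  have h : (φ.star𝓕 X k g o).2 = star g o (φ.𝓕 X k).1 := rfl
  rw [h, 𝓕_fst]
  exact star_eq_cast g o _ _ _

theorem star𝓖_fst : (φ.star𝓖 X k g o).1 = (-1 : ℝ) ^ n • φ.sG₂ X g o := by
  have h : (φ.star𝓖 X k g o).1 = (-1 : ℝ) ^ ((n : ℤ) - 3 - 1) • star g o (φ.𝓖 X k).2 := rfl
  rw [h, 𝓖_snd, show (-1 : ℝ) ^ ((n : ℤ) - 3 - 1) = (-1 : ℝ) ^ (n : ℤ) from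
    neg_one_zpow_congr ⟨-2, by ring⟩, zpow_natCast]
  rfl

theorem star𝓖_snd : (φ.star𝓖 X k g o).2 = Form.cast (by omega) (φ.sG₁ X k g o) := by
  have h : (φ.star𝓖 X k g o).2 = star g o (φ.𝓖 X k).1 := rfl
  rw [h, 𝓖_fst]
  exact star_eq_cast g o _ _ _

set_option maxRecDepth 10000 in
theorem star𝓗_fst : (φ.star𝓗 X k g o).1 = -((-1 : ℝ) ^ n • φ.sH₂ X g o) := by
  have h : (φ.star𝓗 X k g o).1 = (-1 : ℝ) ^ ((n : ℤ) - 4 - 1) • star g o (φ.𝓗 X k).2 := rfl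
  rw [h, 𝓗_snd, show (-1 : ℝ) ^ ((n : ℤ) - 4 - 1) = (-1 : ℝ) ^ ((n + 1 : ℕ) : ℤ) from
    neg_one_zpow_congr ⟨-3, by push_cast; ring⟩, zpow_natCast, pow_succ, mul_neg_one, neg_smul]
  rfl

theorem star𝓗_snd : (φ.star𝓗 X k g o).2 = Form.cast (by omega) (φ.sH₁ X k g o) := by
  have h : (φ.star𝓗 X k g o).2 = star g o (φ.𝓗 X k).1 := rfl
  rw [h, 𝓗_fst]
  exact star_eq_cast g o _ _ _

/-- Each component of a generalized equation need only agree with a field equation up to a nonzero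
factor. -/
theorem eq_iff_and_of_sub_eq {G G' : Type*} [AddCommGroup G] [Module ℝ G] [AddCommGroup G']
    [Module ℝ G'] {a b e : G} {a' b' e' : G'} {c c' : ℝ} (hc : c ≠ 0) (hc' : c' ≠ 0)
    (h : a - b = c • e) (h' : a' - b' = c' • e') : (a = b ∧ a' = b') ↔ (e = 0 ∧ e' = 0) := by
  rw [← sub_eq_zero, h, ← sub_eq_zero (a := a'), h', smul_eq_zero_iff_right hc,
    smul_eq_zero_iff_right hc']

/-- The second component is the equation of `A₁` itself; the first is `(-1)^n` times that of `A₂`,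
the factor coming from the sign of the generalized star. -/
theorem generalized_A_iff (h : φ.Smooth) :
    (gd k (φ.star𝓕 X k g o) + gwedge (bracket 𝕜 𝔤) φ.𝒜 (φ.star𝓕 X k g o) (by ring) :
        GForm I M 𝔤 (n - 2)) =
      gwedge P.σ (φ.star𝓖 X k g o) φ.ℬ +
        (-1 : ℝ) ^ (n + 1) • gwedge P.κ (φ.star𝓗 X k g o) φ.𝒞 ↔
    φ.FieldEqA₁ X P k g o ∧ φ.FieldEqA₂ X P k g o := by
  have s2 := h.sF₂ X g o
  have e1 : (-1 : ℝ) ^ ((n : ℤ) - 3) = -(-1 : ℝ) ^ n := by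
    rw [show (-1 : ℝ) ^ ((n : ℤ) - 3) = (-1 : ℝ) ^ ((n + 1 : ℕ) : ℤ) from
      neg_one_zpow_congr ⟨-2, by push_cast; ring⟩, zpow_natCast, pow_succ, mul_neg_one]
  have e2 : (-1 : ℝ) ^ ((n : ℤ) - 3 + 1) = (-1 : ℝ) ^ n := by
    rw [show (-1 : ℝ) ^ ((n : ℤ) - 3 + 1) = (-1 : ℝ) ^ (n : ℤ) from
      neg_one_zpow_congr ⟨-1, by ring⟩, zpow_natCast]
  have e3 : (-1 : ℝ) ^ (2 : ℤ) = 1 := by norm_num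
  have e4 : (-1 : ℝ) ^ (3 : ℤ) = -1 := by norm_num
  rw [GForm.ext_iff_cast (show (n : ℤ) - 2 + 1 = n - 1 by omega), FieldEqA₁, FieldEqA₂]
  refine eq_iff_and_of_sub_eq (c := 1) (c' := (-1) ^ n) one_ne_zero (by simp) ?_ ?_
  all_goals
    simp only [Prod.fst_add, Prod.snd_add, Prod.smul_fst, Prod.smul_snd, gd_fst, gd_snd,
      gwedge_fst, gwedge_snd, 𝒜, ℬ, 𝒞, star𝓕_fst, star𝓕_snd, star𝓖_fst, star𝓖_snd, star𝓗_fst,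
      star𝓗_snd, Form.cast_add, Form.cast_real_smul, Form.cast_cast, Form.cast_rfl,
      Form.cast_wedge, Form.cast_d, d_cast, wedge_cast_left, wedge_cast_right, wedge_neg_left,
      wedge_neg_right, wedge_real_smul_left, wedge_real_smul_right, d_neg (s2.real_smul _),
      d_real_smul _ s2, Dg, Form.cast_neg, e1, e2, e3, e4, pow_succ]
    -- For each parity of `n` all signs are numbers, and the identity is linear.
    rcases neg_one_pow_eq_or ℝ n with e | e <;> rw [e] <;> norm_num <;> module

theorem generalized_B_iff (h : φ.Smooth) :
    (gd k (φ.star𝓖 X k g o) + gwedge X.actH φ.𝒜 (φ.star𝓖 X k g o) (by ring) :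
        GForm I M 𝔥 (n - 3)) =
      -gwedge P.η₁ (φ.star𝓗 X k g o) φ.ℬ - gwedge P.η₂ (φ.star𝓗 X k g o) φ.ℬ -
        gmap P.αs (φ.star𝓕 X k g o) ↔
    φ.FieldEqB₂ X P k g o ∧ φ.FieldEqB₃ X P k g o := by
  have s2 := h.sG₂ X g o
  have e1 : (-1 : ℝ) ^ ((n : ℤ) - 4) = (-1 : ℝ) ^ n := by
    rw [show (-1 : ℝ) ^ ((n : ℤ) - 4) = (-1 : ℝ) ^ (n : ℤ) from
      neg_one_zpow_congr ⟨-2, by ring⟩, zpow_natCast]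
  have e2 : (-1 : ℝ) ^ ((n : ℤ) - 4 + 1) = -(-1 : ℝ) ^ n := by
    rw [show (-1 : ℝ) ^ ((n : ℤ) - 4 + 1) = (-1 : ℝ) ^ ((n + 1 : ℕ) : ℤ) from
      neg_one_zpow_congr ⟨-2, by push_cast; ring⟩, zpow_natCast, pow_succ, mul_neg_one]
  have e3 : (-1 : ℝ) ^ (2 : ℤ) = 1 := by norm_num
  rw [GForm.ext_iff_cast (show (n : ℤ) - 3 + 1 = n - 2 by omega), FieldEqB₂, FieldEqB₃]
  -- The first component of `⋆𝓖` carries the sign `(-1)^n`, opposite to that of `⋆𝓕` and `⋆𝓗`, while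
  -- `D∗G₂` enters the equation of `B₃` with a minus. Hence the factor `-(-1)^n`.
  refine eq_iff_and_of_sub_eq (c := 1) (c' := -(-1) ^ n) one_ne_zero (by simp) ?_ ?_
  all_goals
    simp only [Prod.fst_add, Prod.snd_add, Prod.fst_neg, Prod.snd_neg, Prod.fst_sub, Prod.snd_sub,
      gd_fst, gd_snd, gwedge_fst, gwedge_snd, gmap_fst, gmap_snd, 𝒜, ℬ, star𝓕_fst, star𝓕_snd,
      star𝓖_fst, star𝓖_snd, star𝓗_fst, star𝓗_snd, Form.cast_add, Form.cast_sub,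
      Form.cast_real_smul, Form.cast_cast, Form.cast_rfl, Form.cast_wedge, Form.cast_d, d_cast,
      mapForm_cast, mapForm_neg, mapForm_real_smul,
      wedge_cast_left, wedge_cast_right, wedge_neg_left, wedge_real_smul_left,
      wedge_real_smul_right, d_real_smul _ s2, Dh, Form.cast_neg, e1, e2, e3, pow_succ]
    rcases neg_one_pow_eq_or ℝ n with e | e <;> rw [e] <;> norm_num <;> module

theorem generalized_C_iff (h : φ.Smooth) :
    (gd k (φ.star𝓗 X k g o) + gwedge X.actL φ.𝒜 (φ.star𝓗 X k g o) (by ring) :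
        GForm I M 𝔩 (n - 4)) =
      gmap P.βs (φ.star𝓖 X k g o) ↔
    φ.FieldEqC₃ X P k g o ∧ φ.FieldEqC₄ X P k g o := by
  have s2 := h.sH₂ X g o
  have e1 : (-1 : ℝ) ^ ((n : ℤ) - 5) = -(-1 : ℝ) ^ n := by
    rw [show (-1 : ℝ) ^ ((n : ℤ) - 5) = (-1 : ℝ) ^ ((n + 1 : ℕ) : ℤ) from
      neg_one_zpow_congr ⟨-3, by push_cast; ring⟩, zpow_natCast, pow_succ, mul_neg_one]
  have e2 : (-1 : ℝ) ^ ((n : ℤ) - 5 + 1) = (-1 : ℝ) ^ n := by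
    rw [show (-1 : ℝ) ^ ((n : ℤ) - 5 + 1) = (-1 : ℝ) ^ (n : ℤ) from
      neg_one_zpow_congr ⟨-2, by ring⟩, zpow_natCast]
  rw [GForm.ext_iff_cast (show (n : ℤ) - 4 + 1 = n - 3 by omega), FieldEqC₃, FieldEqC₄]
  refine eq_iff_and_of_sub_eq (c := 1) (c' := (-1) ^ n) one_ne_zero (by simp) ?_ ?_
  all_goals
    simp only [Prod.fst_add, Prod.snd_add, gd_fst, gd_snd, gwedge_fst, gwedge_snd, gmap_fst,
      gmap_snd, 𝒜, star𝓖_fst, star𝓖_snd, star𝓗_fst, star𝓗_snd, Form.cast_add,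
      Form.cast_real_smul, Form.cast_cast, Form.cast_rfl, Form.cast_wedge, Form.cast_d, d_cast,
      mapForm_cast, mapForm_real_smul, wedge_cast_right, wedge_neg_right,
      wedge_real_smul_right, d_neg (s2.real_smul _),
      d_real_smul _ s2, Dl, Form.cast_neg, e1, e2]
    rcases neg_one_pow_eq_or ℝ n with e | e <;> rw [e] <;> norm_num <;> module

/-! ### The ordinary theory -/

theorem F₁_eq_of_eq_zero (h2 : φ.A₂ = 0) : φ.F₁ X k = φ.𝔽 X := by
  rw [F₁, h2, smul_zero, add_zero]

theorem G₁_eq_of_eq_zero (h3 : φ.B₃ = 0) : φ.G₁ X k = φ.𝔾 X := by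
  rw [G₁, h3, smul_zero, sub_zero]

theorem H₁_eq_of_eq_zero (h4 : φ.C₄ = 0) : φ.H₁ X k = φ.ℍ X := by
  rw [H₁, h4, smul_zero, add_zero]

theorem sF₁_eq_of_eq_zero (h2 : φ.A₂ = 0) : φ.sF₁ X k g o = φ.s𝔽 X g o :=
  congrArg (star g o ·) (F₁_eq_of_eq_zero X k h2)

theorem sG₁_eq_of_eq_zero (h3 : φ.B₃ = 0) : φ.sG₁ X k g o = φ.s𝔾 X g o :=
  congrArg (star g o ·) (G₁_eq_of_eq_zero X k h3)

theorem sH₁_eq_of_eq_zero (h4 : φ.C₄ = 0) : φ.sH₁ X k g o = φ.sℍ X g o :=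
  congrArg (star g o ·) (H₁_eq_of_eq_zero X k h4)

theorem F₂_eq_zero (h2 : φ.A₂ = 0) (h3 : φ.B₃ = 0) : φ.F₂ X = 0 := by
  rw [F₂, Dg, h2, h3, d_zero, wedge_zero_right, mapForm_zero, add_zero, sub_zero]

theorem G₂_eq_zero (h2 : φ.A₂ = 0) (h3 : φ.B₃ = 0) (h4 : φ.C₄ = 0) : φ.G₂ X = 0 := by
  rw [G₂, Dh, h2, h3, h4, d_zero, wedge_zero_right, wedge_zero_left, mapForm_zero]
  simp only [add_zero, sub_zero]

theorem H₂_eq_zero (h2 : φ.A₂ = 0) (h3 : φ.B₃ = 0) (h4 : φ.C₄ = 0) : φ.H₂ X = 0 := by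
  rw [H₂, Dl, h2, h3, h4, d_zero]
  simp only [wedge_zero_right, wedge_zero_left, add_zero, sub_zero]

theorem sF₂_eq_zero (h2 : φ.A₂ = 0) (h3 : φ.B₃ = 0) : φ.sF₂ X g o = 0 :=
  (congrArg (star g o ·) (F₂_eq_zero X h2 h3)).trans (star_zero g o _)

theorem sG₂_eq_zero (h2 : φ.A₂ = 0) (h3 : φ.B₃ = 0) (h4 : φ.C₄ = 0) : φ.sG₂ X g o = 0 :=
  (congrArg (star g o ·) (G₂_eq_zero X h2 h3 h4)).trans (star_zero g o _)

set_option maxRecDepth 10000 in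
theorem sH₂_eq_zero (h2 : φ.A₂ = 0) (h3 : φ.B₃ = 0) (h4 : φ.C₄ = 0) : φ.sH₂ X g o = 0 :=
  (congrArg (star g o ·) (H₂_eq_zero X h2 h3 h4)).trans (star_zero g o _)

theorem density_eq_ordinaryLagrangian (h2 : φ.A₂ = 0) (h3 : φ.B₃ = 0) (h4 : φ.C₄ = 0) :
    φ.density X P k g o = φ.ordinaryLagrangian X P g o := by
  rw [density, ordinaryLagrangian, F₂_eq_zero X h2 h3, G₂_eq_zero X h2 h3 h4,
    H₂_eq_zero X h2 h3 h4, F₁_eq_of_eq_zero X k h2, G₁_eq_of_eq_zero X k h3,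
    H₁_eq_of_eq_zero X k h4, sF₁_eq_of_eq_zero X k g o h2, sG₁_eq_of_eq_zero X k g o h3,
    sH₁_eq_of_eq_zero X k g o h4]
  simp only [wedge_zero_left, add_zero]

theorem fieldEqA₁_iff (h2 : φ.A₂ = 0) (h3 : φ.B₃ = 0) (h4 : φ.C₄ = 0) :
    φ.FieldEqA₁ X P k g o ↔
      (d (φ.s𝔽 X g o) + wedge (bracket 𝕜 𝔤) φ.A₁ (φ.s𝔽 X g o) (by ring) : Form I M 𝔤 (n - 1)) =
        wedge P.σ (φ.s𝔾 X g o) φ.B₂ + (-1 : ℝ) ^ n • wedge P.κ (φ.sℍ X g o) φ.C₃ := by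
  rw [FieldEqA₁, sF₁_eq_of_eq_zero X k g o h2, sG₁_eq_of_eq_zero X k g o h3,
    sH₁_eq_of_eq_zero X k g o h4, h2, h3, h4, Dg, ← sub_eq_zero (b := wedge P.σ _ _ + _)]
  simp only [wedge_zero_left, wedge_zero_right, smul_zero, add_zero, sub_zero, pow_succ,
    mul_neg_one]
  refine Eq.congr_left ?_
  module

theorem fieldEqB₂_iff (h2 : φ.A₂ = 0) (h3 : φ.B₃ = 0) (h4 : φ.C₄ = 0) :
    φ.FieldEqB₂ X P k g o ↔
      (d (φ.s𝔾 X g o) + wedge X.actH φ.A₁ (φ.s𝔾 X g o) (by ring) : Form I M 𝔥 (n - 2)) =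
        -wedge P.η₂ (φ.sℍ X g o) φ.B₂ - wedge P.η₁ (φ.sℍ X g o) φ.B₂ -
          mapForm P.αs (φ.s𝔽 X g o) := by
  rw [FieldEqB₂, sF₁_eq_of_eq_zero X k g o h2, sG₁_eq_of_eq_zero X k g o h3,
    sH₁_eq_of_eq_zero X k g o h4, h2, h3, Dh, ← sub_eq_zero (b := _ - _ - _)]
  simp only [wedge_zero_left, wedge_zero_right, smul_zero, add_zero]
  refine Eq.congr_left ?_
  abel

theorem fieldEqC₃_iff (h2 : φ.A₂ = 0) (h3 : φ.B₃ = 0) (h4 : φ.C₄ = 0) :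
    φ.FieldEqC₃ X P k g o ↔
      (d (φ.sℍ X g o) + wedge X.actL φ.A₁ (φ.sℍ X g o) (by ring) : Form I M 𝔩 (n - 3)) =
        mapForm P.βs (φ.s𝔾 X g o) := by
  rw [FieldEqC₃, sG₁_eq_of_eq_zero X k g o h3, sH₁_eq_of_eq_zero X k g o h4, h2, Dl,
    wedge_zero_left, add_zero, sub_eq_zero]

/-- All terms with second components vanish and `k∗𝔽 = 0` remains; divide by `k` and use the
injectivity of the star. The equations of `B₃` and `C₄` reduce in the same way. -/
theorem fieldEqA₂_iff (hk : k ≠ 0) (h2 : φ.A₂ = 0) (h3 : φ.B₃ = 0) (h4 : φ.C₄ = 0) :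
    φ.FieldEqA₂ X P k g o ↔ φ.𝔽 X = 0 := by
  rw [FieldEqA₂, sF₂_eq_zero X g o h2 h3, sG₂_eq_zero X g o h2 h3 h4, sH₂_eq_zero X g o h2 h3 h4,
    sF₁_eq_of_eq_zero X k g o h2, Dg, d_zero]
  simp only [wedge_zero_left, wedge_zero_right, smul_zero, add_zero, sub_zero]
  rw [Form.smul_eq_zero_iff hk, s𝔽, star_eq_zero_iff]

theorem fieldEqB₃_iff (hk : k ≠ 0) (h2 : φ.A₂ = 0) (h3 : φ.B₃ = 0) (h4 : φ.C₄ = 0) :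
    φ.FieldEqB₃ X P k g o ↔ φ.𝔾 X = 0 := by
  rw [FieldEqB₃, sF₂_eq_zero X g o h2 h3, sG₂_eq_zero X g o h2 h3 h4, sH₂_eq_zero X g o h2 h3 h4,
    sG₁_eq_of_eq_zero X k g o h3, Dh, d_zero]
  simp only [wedge_zero_left, wedge_zero_right, mapForm_zero, zero_add, add_zero, sub_zero]
  rw [Form.smul_eq_zero_iff hk, s𝔾, star_eq_zero_iff]

theorem fieldEqC₄_iff (hk : k ≠ 0) (h2 : φ.A₂ = 0) (h3 : φ.B₃ = 0) (h4 : φ.C₄ = 0) :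
    φ.FieldEqC₄ X P k g o ↔ φ.ℍ X = 0 := by
  rw [FieldEqC₄, sG₂_eq_zero X g o h2 h3 h4, sH₂_eq_zero X g o h2 h3 h4,
    sH₁_eq_of_eq_zero X k g o h4, Dl, d_zero]
  simp only [wedge_zero_right, mapForm_zero, add_zero, sub_zero]
  rw [Form.smul_eq_zero_iff hk, sℍ, star_eq_zero_iff]

end Generalized3Connection
end YangMills

end
end GYM

theorem mainTheorem3
    {𝕜 : Type*} [RCLike 𝕜] {𝔤 𝔥 𝔩 : Type*}
    [NormedLieRing 𝔤] [NormedLieAlgebra 𝕜 𝔤] [NormedSpace ℝ 𝔤] [IsScalarTower ℝ 𝕜 𝔤]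
    [NormedLieRing 𝔥] [NormedLieAlgebra 𝕜 𝔥] [NormedSpace ℝ 𝔥] [IsScalarTower ℝ 𝕜 𝔥]
    [NormedLieRing 𝔩] [NormedLieAlgebra 𝕜 𝔩] [NormedSpace ℝ 𝔩] [IsScalarTower ℝ 𝕜 𝔩]
    [FiniteDimensional 𝕜 𝔤] [FiniteDimensional 𝕜 𝔥] [FiniteDimensional 𝕜 𝔩]
    (X : Differential2CrossedModule 𝕜 𝔤 𝔥 𝔩) (P : InvariantForms X)
    {n : ℕ} {H : Type*} [TopologicalSpace H]
    {I : ModelWithCorners ℝ (EuclideanSpace ℝ (Fin n)) H}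
    {M : Type*} [TopologicalSpace M] [ChartedSpace H M] [IsManifold I ∞ M]
    [T2Space M] [SigmaCompactSpace M]
    (g : PseudoRiemannianMetric I M) (o : OrientationForm I M)
    (k : 𝕜) (hk : k ≠ 0)
    (φ : Generalized3Connection 𝔤 𝔥 𝔩 I M) (hφ : φ.Smooth) :
    -- varying each component field separately
    ((∀ a, IsTest a → φ.Stationary X P k g o ⟨a, 0, 0, 0, 0, 0⟩) ↔ φ.FieldEqA₁ X P k g o) ∧
    ((∀ a, IsTest a → φ.Stationary X P k g o ⟨0, a, 0, 0, 0, 0⟩) ↔ φ.FieldEqA₂ X P k g o) ∧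
    ((∀ b, IsTest b → φ.Stationary X P k g o ⟨0, 0, b, 0, 0, 0⟩) ↔ φ.FieldEqB₂ X P k g o) ∧
    ((∀ b, IsTest b → φ.Stationary X P k g o ⟨0, 0, 0, b, 0, 0⟩) ↔ φ.FieldEqB₃ X P k g o) ∧
    ((∀ c, IsTest c → φ.Stationary X P k g o ⟨0, 0, 0, 0, c, 0⟩) ↔ φ.FieldEqC₃ X P k g o) ∧
    ((∀ c, IsTest c → φ.Stationary X P k g o ⟨0, 0, 0, 0, 0, c⟩) ↔ φ.FieldEqC₄ X P k g o) ∧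
    -- varying all component fields simultaneously
    ((∀ δφ : Generalized3Connection 𝔤 𝔥 𝔩 I M, δφ.IsTest → φ.Stationary X P k g o δφ) ↔
      φ.FieldEqA₁ X P k g o ∧ φ.FieldEqA₂ X P k g o ∧ φ.FieldEqB₂ X P k g o ∧
      φ.FieldEqB₃ X P k g o ∧ φ.FieldEqC₃ X P k g o ∧ φ.FieldEqC₄ X P k g o) ∧
    -- on a compact manifold, the variation is that of the action itself
    (CompactSpace M → ∀ δφ : Generalized3Connection 𝔤 𝔥 𝔩 I M, δφ.IsTest → ∀ t : ℝ,
      φ.actionChange X P k g o δφ t =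
        (φ.vary δφ t).action X P k g o - φ.action X P k g o) ∧
    -- the equations in terms of generalized forms
    (((gd k (φ.star𝓕 X k g o) + gwedge (bracket 𝕜 𝔤) φ.𝒜 (φ.star𝓕 X k g o) :
          GForm I M 𝔤 (n - 2)) =
        gwedge P.σ (φ.star𝓖 X k g o) φ.ℬ +
          (-1 : ℝ) ^ (n + 1) • gwedge P.κ (φ.star𝓗 X k g o) φ.𝒞) ↔
      φ.FieldEqA₁ X P k g o ∧ φ.FieldEqA₂ X P k g o) ∧
    (((gd k (φ.star𝓖 X k g o) + gwedge X.actH φ.𝒜 (φ.star𝓖 X k g o) : GForm I M 𝔥 (n - 3)) =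
        -gwedge P.η₁ (φ.star𝓗 X k g o) φ.ℬ - gwedge P.η₂ (φ.star𝓗 X k g o) φ.ℬ -
          gmap P.αs (φ.star𝓕 X k g o)) ↔
      φ.FieldEqB₂ X P k g o ∧ φ.FieldEqB₃ X P k g o) ∧
    (((gd k (φ.star𝓗 X k g o) + gwedge X.actL φ.𝒜 (φ.star𝓗 X k g o) : GForm I M 𝔩 (n - 4)) =
        gmap P.βs (φ.star𝓖 X k g o)) ↔
      φ.FieldEqC₃ X P k g o ∧ φ.FieldEqC₄ X P k g o) ∧
    -- the ordinary theory
    (φ.A₂ = 0 → φ.B₃ = 0 → φ.C₄ = 0 →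
      φ.action X P k g o = integral o (φ.ordinaryLagrangian X P g o) ∧
      (φ.lagrangian X P k g o).2 ⟨n, by omega⟩ = φ.ordinaryLagrangian X P g o ⟨n, rfl⟩ ∧
      (φ.FieldEqA₁ X P k g o ↔
        (d (φ.s𝔽 X g o) + wedge (bracket 𝕜 𝔤) φ.A₁ (φ.s𝔽 X g o) : Form I M 𝔤 (n - 1)) =
          wedge P.σ (φ.s𝔾 X g o) φ.B₂ + (-1 : ℝ) ^ n • wedge P.κ (φ.sℍ X g o) φ.C₃) ∧
      (φ.FieldEqB₂ X P k g o ↔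
        (d (φ.s𝔾 X g o) + wedge X.actH φ.A₁ (φ.s𝔾 X g o) : Form I M 𝔥 (n - 2)) =
          -wedge P.η₂ (φ.sℍ X g o) φ.B₂ - wedge P.η₁ (φ.sℍ X g o) φ.B₂ -
            mapForm P.αs (φ.s𝔽 X g o)) ∧
      (φ.FieldEqC₃ X P k g o ↔
        (d (φ.sℍ X g o) + wedge X.actL φ.A₁ (φ.sℍ X g o) : Form I M 𝔩 (n - 3)) =
          mapForm P.βs (φ.s𝔾 X g o)) ∧
      (φ.FieldEqA₂ X P k g o ↔ φ.𝔽 X = 0) ∧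
      (φ.FieldEqB₃ X P k g o ↔ φ.𝔾 X = 0) ∧
      (φ.FieldEqC₄ X P k g o ↔ φ.ℍ X = 0)) := by
  -- The calculus of forms is real, so the value spaces must be finite-dimensional over `ℝ`, also
  -- when `𝕜 = ℂ`.
  have : FiniteDimensional ℝ 𝔤 := Module.Finite.trans 𝕜 𝔤
  have : FiniteDimensional ℝ 𝔥 := Module.Finite.trans 𝕜 𝔥
  have : FiniteDimensional ℝ 𝔩 := Module.Finite.trans 𝕜 𝔩
  open Generalized3Connection in
  refine ⟨stationary_A₁_iff X P k g o hφ, stationary_A₂_iff X P k g o hφ,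
    stationary_B₂_iff X P k g o hφ, stationary_B₃_iff X P k g o hφ, stationary_C₃_iff X P k g o hφ,
    stationary_C₄_iff X P k g o hφ, stationary_all_iff X P k g o hφ, ?_,
    generalized_A_iff X P k g o hφ, generalized_B_iff X P k g o hφ, generalized_C_iff X P k g o hφ,
    fun h2 h3 h4 => ⟨?_, ?_, fieldEqA₁_iff X P k g o h2 h3 h4, fieldEqB₂_iff X P k g o h2 h3 h4,
      fieldEqC₃_iff X P k g o h2 h3 h4, fieldEqA₂_iff X P k g o hk h2 h3 h4,
      fieldEqB₃_iff X P k g o hk h2 h3 h4, fieldEqC₄_iff X P k g o hk h2 h3 h4⟩⟩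
  · intro _ δφ hδ t
    obtain ⟨K, _, _, hs⟩ := hδ.exists_smoothSupp
    exact Generalized3Connection.actionChange_eq_sub X P k g o hφ hs.smooth t
  · rw [Generalized3Connection.action_eq,
      Generalized3Connection.density_eq_ordinaryLagrangian X P k g o h2 h3 h4]
  · rw [Generalized3Connection.lagrangian_snd_apply,
      Generalized3Connection.density_eq_ordinaryLagrangian X P k g o h2 h3 h4]
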